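/- \textbf{Setting.} Let $\mathbb{Y}$ be the set of all partitions, $\Lambda$ the algebra of symmetric functions over $\mathbb{R}$ in infinitely many variables, with monomial symmetric functions $m_\lambda$ and power sums $p_\lambda=\prod_i p_{\lambda_i}$. Fix real numbers $0<q,t,u<1$ and let $\langle\cdot,\cdot\rangle_{q,t}$ be the bilinear form on $\Lambda$ with $$\langle p_\lambda,p_\mu\rangle_{q,t}=\delta_{\lambda,\mu}\prod_{i\ge1}m_i(\lambda)!\,i^{m_i(\lambda)}\prod_{i=1}^{\ell(\lambda)}\frac{1-q^{\lambda_i}}{1-t^{\lambda_i}},$$ where $m_i(\lambda)$ is the multiplicity of $i$ in $\lambda$. Let $P_\lambda=P_\lambda(q,t)$ be the Macdonald symmetric functions: $P_\lambda-m_\lambda$ is a linear combination of the $m_\mu$ with $\mu<\lambda$ in the dominance order, and $\langle P_\lambda,P_\mu\rangle_{q,t}=0$ for $\lambda\neq\mu$. Let $Q_\lambda=P_\lambda/\langle P_\lambda,P_\lambda\rangle_{q,t}$. The skew functions are defined by $P_\lambda(X,Y)=\sum_{\mu}P_{\lambda/\mu}(X)P_\mu(Y)$ and $Q_\lambda(X,Y)=\sum_{\mu}Q_{\lambda/\mu}(X)Q_\mu(Y)$.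 A specialization is a homomorphism of unital $\mathbb{R}$-algebras $\theta:\Lambda\to\mathbb{R}$, and one writes $f(\theta)=\theta(f)$; it is $(q,t)$-Macdonald positive if $P_\lambda(\theta)\ge0$ for all $\lambda\in\mathbb{Y}$. Let $N\ge1$ and let $\rho^+_0,\dots,\rho^+_{N-1}$ and $\rho^-_1,\dots,\rho^-_N$ be $(q,t)$-Macdonald positive specializations. For $\boldsymbol\lambda=(\lambda^1,\dots,\lambda^N)$ and $\boldsymbol\mu=(\mu^1,\dots,\mu^N)$ in $\mathbb{Y}^N$ put $$W(\boldsymbol\lambda,\boldsymbol\mu)=u^{|\mu^N|}\prod_{i=1}^N Q_{\lambda^i/\mu^i}(\rho^-_i)\,P_{\lambda^{i+1}/\mu^i}(\rho^+_i),\qquad \lambda^{N+1}=\lambda^1,\quad \rho^+_N=\rho^+_0 .$$ Let $(a;p_1,\dots,p_n)_\infty=\prod_{i_1,\dots,i_n\ge0}(1-a\,p_1^{i_1}\cdots p_n^{i_n})$ (with $0^0=1$), and for $0\le v<1$ let $$\tilde\Pi_{q,t;v}(X;Y)=\prod_{i,j\ge1}\frac{(t x_iy_j;q,v)_\infty}{(x_iy_j;q,v)_\infty},$$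 a formal power series, symmetric in $X=(x_1,x_2,\dots)$ and in $Y=(y_1,y_2,\dots)$. If a formal power series $F(X;Y)$ is symmetric in $X$ and in $Y$, with components $F_{k,l}\in\Lambda_X\otimes\Lambda_Y$ of bidegree $(k,l)$, then for specializations $\theta,\eta$ put $F(\theta;\eta)=\sum_{k,l\ge0}(\theta\otimes\eta)(F_{k,l})$, and say that $F(\theta;\eta)$ converges if this series converges absolutely. For $0\le i\le N-1$ and $1\le j\le N$ let $$F_{ij}(X;Y)=\begin{cases}\tilde\Pi_{q,t;u}(X;Y), & i<j,\\ \tilde\Pi_{q,t;u}(X;Y)\big/\tilde\Pi_{q,t;0}(X;Y), & j\le i,\end{cases}$$ the quotient being one of formal power series. \textbf{Statement.} Assume that $F_{ij}(\rho^+_i;\rho^-_j)$ converges for all $i,j$. Then $$\sum_{\boldsymbol\lambda,\boldsymbol\mu\in\mathbb{Y}^N}W(\boldsymbol\lambda,\boldsymbol\mu)=\frac{1}{(u;u)_\infty}\prod_{i=0}^{N-1}\prod_{j=1}^{N}F_{ij}(\rho^+_i;\rho^-_j)$$ in the following sense. If one first forms the finite sums of $W(\boldsymbol\lambda,\boldsymbol\mu)$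 over all $(\boldsymbol\lambda,\boldsymbol\mu)$ with prescribed weights $|\lambda^1|,\dots,|\lambda^N|,|\mu^1|,\dots,|\mu^N|$, then the resulting series, indexed by $(\mathbb{Z}_{\ge0})^{2N}$, converges unconditionally with the stated sum. If all the numbers $W(\boldsymbol\lambda,\boldsymbol\mu)$ are non-negative, then the double series over $(\boldsymbol\lambda,\boldsymbol\mu)\in\mathbb{Y}^N\times\mathbb{Y}^N$ itself converges unconditionally with this sum. If moreover all the $\tilde\Pi_{q,t;u}(\rho^+_i;\rho^-_j)$ converge, then the $\tilde\Pi_{q,t;0}(\rho^+_i;\rho^-_j)$ with $j\le i$ converge as well and the right-hand side is equal to $$\frac{1}{(u;u)_\infty}\;\frac{\prod_{i=0}^{N-1}\prod_{j=1}^{N}\tilde\Pi_{q,t;u}(\rho^+_i;\rho^-_j)}{\prod_{i=0}^{N-1}\prod_{j=1}^{i}\tilde\Pi_{q,t;0}(\rho^+_i;\rho^-_j)} .$$ -/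

import Mathlib

open scoped MvPowerSeries.WithPiTopology

noncomputable section

namespace PeriodicMacdonald

/-! ### Partitions -/

/-- The set of all partitions; `l.1` is the weight `|l|`. -/
abbrev Part : Type := Σ n : ℕ, n.Partition

/-- The parts of a partition as a weakly decreasing list. -/
def sortedParts {n : ℕ} (l : n.Partition) : List ℕ := l.parts.sort (· ≥ ·)

/-- The exponent of the monomial `x₀ ^ l₁ * x₁ ^ l₂ * ⋯`. -/
def expo {n : ℕ} (l : n.Partition) : ℕ →₀ ℕ := (sortedParts l).toFinsupp

/-- The dominance order on partitions of `n`. -/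
def DomLE {n : ℕ} (m l : n.Partition) : Prop :=
  ∀ k : ℕ, ((sortedParts m).take k).sum ≤ ((sortedParts l).take k).sum

/-- The strict lexicographic order on partitions of `n`, a total order refining dominance. -/
def LexLT {n : ℕ} (m l : n.Partition) : Prop := sortedParts m < sortedParts l

theorem sortedParts_injective {n : ℕ} :
    Function.Injective (sortedParts : n.Partition → List ℕ) := by
  intro a b h
  apply Nat.Partition.ext
  have := congrArg (fun l : List ℕ => (l : Multiset ℕ)) h
  simpa [sortedParts] using this

theorem lexLT_wf (n : ℕ) : WellFounded (LexLT (n := n)) := by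
  have : IsTrans n.Partition LexLT := ⟨fun a b c h k => List.lt_trans (l₁ := sortedParts a) h k⟩
  have : Std.Irrefl (LexLT (n := n)) := ⟨fun a h => List.lt_irrefl (sortedParts a) h⟩
  exact Finite.wellFounded_of_trans_of_irrefl _

theorem lexLT_of_domLE {n : ℕ} {m l : n.Partition} (h : DomLE m l) (hne : m ≠ l) :
    LexLT m l := by
  have key : ∀ a b : List ℕ, (∀ x ∈ a, 0 < x) →
      (∀ k : ℕ, (a.take k).sum ≤ (b.take k).sum) → a ≠ b → a < b := by
    intro a
    induction a with
    | nil =>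
      intro b _ _ hab
      cases b with
      | nil => exact absurd rfl hab
      | cons y b => exact List.Lex.nil
    | cons x a ih =>
      intro b hpos hk hab
      cases b with
      | nil =>
        have h1 := hk 1
        have h2 := hpos x (by simp)
        simp at h1
        omega
      | cons y b =>
        have h1 : x ≤ y := by simpa using hk 1
        rcases h1.lt_or_eq with h2 | rfl
        · exact List.Lex.rel h2
        · refine List.Lex.cons (ih b (fun z hz => hpos z (by simp [hz])) (fun k => ?_) ?_)
          · simpa using hk (k + 1)
          · rintro rfl
            exact hab rfl
  refine key _ _ (fun x hx => ?_) h (fun e => hne (sortedParts_injective e))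
  exact m.parts_pos (by simpa [sortedParts] using hx)

/-! ### The ring of symmetric functions over the reals -/

/-- Symmetric functions in `x₀, x₁, x₂, …` with real coefficients: formal power series that are
invariant under permutations of the variables and have bounded degree. -/
def SymFun : Subalgebra ℝ (MvPowerSeries ℕ ℝ) where
  carrier := {f | (∀ s : Equiv.Perm ℕ, MvPowerSeries.renameEquiv ℝ s f = f) ∧
    ∃ d : ℕ, ∀ e : ℕ →₀ ℕ, d < e.degree → MvPowerSeries.coeff e f = 0}
  mul_mem' := by
    rintro f g ⟨hf, d, hd⟩ ⟨hg, c, hc⟩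
    refine ⟨fun s => by rw [map_mul, hf, hg], d + c, fun e he => ?_⟩
    rw [MvPowerSeries.coeff_mul]
    refine Finset.sum_eq_zero fun p hp => ?_
    rw [Finset.HasAntidiagonal.mem_antidiagonal] at hp
    have h : p.1.degree + p.2.degree = e.degree := by rw [← hp, map_add]
    rcases lt_or_ge d p.1.degree with h1 | h1
    · rw [hd _ h1, zero_mul]
    · rw [hc _ (by omega), mul_zero]
  add_mem' := by
    rintro f g ⟨hf, d, hd⟩ ⟨hg, c, hc⟩
    refine ⟨fun s => by rw [map_add, hf, hg], d + c, fun e he => ?_⟩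
    rw [map_add, hd _ (by omega), hc _ (by omega), add_zero]
  algebraMap_mem' := by
    intro r
    refine ⟨fun s => by rw [AlgEquiv.commutes], 0, fun e he => ?_⟩
    have : e ≠ 0 := by rintro rfl; simp at he
    classical
    rw [MvPowerSeries.algebraMap_apply, MvPowerSeries.coeff_C, if_neg this]

theorem mem_symFun {f : MvPowerSeries ℕ ℝ} (d : ℕ)
    (hs : ∀ (s : Equiv.Perm ℕ) (e : ℕ →₀ ℕ),
      MvPowerSeries.coeff (e.mapDomain s) f = MvPowerSeries.coeff e f)
    (hd : ∀ e : ℕ →₀ ℕ, d < e.degree → MvPowerSeries.coeff e f = 0) : f ∈ SymFun := by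
  refine ⟨fun s => ?_, d, hd⟩
  ext e
  have h2 : e = (e.mapDomain s.symm).mapDomain s := by
    rw [← Finsupp.mapDomain_comp]; simp
  have h3 := MvPowerSeries.coeff_embDomain_rename s.toEmbedding f (e.mapDomain s.symm)
  rw [Finsupp.embDomain_eq_mapDomain] at h3
  rw [h2, MvPowerSeries.renameEquiv_apply]
  refine Eq.trans h3 ?_
  rw [hs s]

/-- The nonzero exponents of a monomial, as a multiset. -/
def shape (e : ℕ →₀ ℕ) : Multiset ℕ := e.support.val.map e

theorem shape_mapDomain (s : Equiv.Perm ℕ) (e : ℕ →₀ ℕ) : shape (e.mapDomain s) = shape e := by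
  have h := Finsupp.embDomain_eq_mapDomain s.toEmbedding e
  have h1 : e.mapDomain s = e.embDomain s.toEmbedding := h.symm
  rw [h1, shape, shape, Finsupp.support_embDomain, Finset.map_val, Multiset.map_map]
  refine Multiset.map_congr rfl fun x _ => ?_
  exact Finsupp.embDomain_apply_self s.toEmbedding e x

open Classical in
/-- The symmetric function which is the sum of all monomials whose multiset of nonzero exponents
is `a`. -/
def monomialSum (a : Multiset ℕ) : SymFun :=
  ⟨fun e => if shape e = a then 1 else 0, by
    refine mem_symFun a.sum (fun s e => ?_) (fun e he => ?_)
    · change (if shape (e.mapDomain s) = a then (1 : ℝ) else 0) = if shape e = a then 1 else 0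
      rw [shape_mapDomain]
    · change (if shape e = a then (1 : ℝ) else 0) = 0
      refine if_neg ?_
      rintro rfl
      exact he.ne rfl⟩

/-- The monomial symmetric function `m_l`. -/
def mono (l : Part) : SymFun := monomialSum l.2.parts

/-- The power sum `p_r = ∑ x_i ^ r` (for `r ≥ 1`). -/
def psum (r : ℕ) : SymFun := monomialSum {r}

/-- `p_l = ∏ p_{l_i}`. -/
def psumPart (l : Part) : SymFun := (l.2.parts.map psum).prod

/-! ### The scalar product and Macdonald symmetric functions -/

/-- `z_l(q,t)`. -/
def zqt (q t : ℝ) (l : Part) : ℝ :=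
  (∏ i ∈ l.2.parts.toFinset, ((l.2.parts.count i).factorial * i ^ l.2.parts.count i : ℝ)) *
    (l.2.parts.map fun r => (1 - q ^ r) / (1 - t ^ r)).prod

/-- The coordinates of a symmetric function in the basis `(p_l)`. -/
def psumCoord : SymFun →ₗ[ℝ] (Part →₀ ℝ) :=
  (Finsupp.linearCombination ℝ psumPart).leftInverse

/-- The bilinear form with `⟨p_l, p_m⟩ = z_l(q,t) δ_{l,m}`. -/
def form (q t : ℝ) (f g : SymFun) : ℝ :=
  (psumCoord f).sum fun l a => zqt q t l * a * psumCoord g l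

theorem form_add_left (q t : ℝ) (f g h : SymFun) :
    form q t (f + g) h = form q t f h + form q t g h := by
  unfold form
  rw [map_add]
  exact Finsupp.sum_add_index' (by simp) (by intros; ring)

theorem form_smul_left (q t : ℝ) (c : ℝ) (f h : SymFun) :
    form q t (c • f) h = c * form q t f h := by
  unfold form
  rw [map_smul, Finsupp.sum_smul_index (by simp), Finsupp.mul_sum]
  exact Finsupp.sum_congr fun l _ => by ring

theorem form_sum_left (q t : ℝ) {ι : Type*} (s : Finset ι) (f : ι → SymFun) (h : SymFun) :
    form q t (∑ i ∈ s, f i) h = ∑ i ∈ s, form q t (f i) h := by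
  classical
  induction s using Finset.induction_on with
  | empty => simp [form]
  | insert a s ha ih => rw [Finset.sum_insert ha, Finset.sum_insert ha, form_add_left, ih]

open Classical in
/-- Gram-Schmidt orthogonalization of `(m_l)`, `l` a partition of `n`, along the lexicographic
order. -/
def macdonaldAux (q t : ℝ) (n : ℕ) : n.Partition → SymFun :=
  (lexLT_wf n).fix fun l P =>
    mono ⟨n, l⟩ - ∑ m : {m : n.Partition // LexLT m l},
      (form q t (mono ⟨n, l⟩) (P m.1 m.2) / form q t (P m.1 m.2) (P m.1 m.2)) • P m.1 m.2

/-- The Macdonald symmetric function `P_l(q,t)`, obtained from the monomial symmetric functions by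
orthogonalization along a linear extension of the dominance order. The resulting family is the
unique orthogonal family which is unitriangular for dominance, see
`IsMacdonaldFamily.eq_macdonaldP`. -/
def macdonaldP (q t : ℝ) (l : Part) : SymFun := macdonaldAux q t l.1 l.2

/-- The two properties that specify the Macdonald symmetric functions (the norms being nonzero, so
that the dual family makes sense). -/
structure IsMacdonaldFamily (q t : ℝ) (P : Part → SymFun) : Prop where
  triangular : ∀ (n : ℕ) (l : n.Partition), P ⟨n, l⟩ - mono ⟨n, l⟩ ∈
    Submodule.span ℝ ((fun m : n.Partition => mono ⟨n, m⟩) '' {m | DomLE m l ∧ m ≠ l})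
  orthogonal : ∀ l m : Part, l ≠ m → form q t (P l) (P m) = 0
  norm_ne_zero : ∀ l : Part, form q t (P l) (P l) ≠ 0

theorem macdonaldAux_eq (q t : ℝ) (n : ℕ) (l : n.Partition) [Fintype {m // LexLT m l}] :
    macdonaldAux q t n l = mono ⟨n, l⟩ - ∑ m : {m : n.Partition // LexLT m l},
      (form q t (mono ⟨n, l⟩) (macdonaldAux q t n m.1) /
        form q t (macdonaldAux q t n m.1) (macdonaldAux q t n m.1)) • macdonaldAux q t n m.1 := by
  conv_lhs => rw [macdonaldAux, WellFounded.fix_eq]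
  congr!

theorem IsMacdonaldFamily.eq_macdonaldP {q t : ℝ} {P : Part → SymFun}
    (hP : IsMacdonaldFamily q t P) : P = macdonaldP q t := by
  classical
  suffices h : ∀ (n : ℕ) (l : n.Partition), P ⟨n, l⟩ = macdonaldAux q t n l from
    funext fun l => h l.1 l.2
  intro n l
  induction l using (lexLT_wf n).induction with
  | _ l ih =>
  let S : n.Partition → Submodule ℝ SymFun := fun l =>
    Submodule.span ℝ (Set.range fun m : {m : n.Partition // LexLT m l} => P ⟨n, m.1⟩)
  have htr : ∀ a b c : n.Partition, LexLT a b → LexLT b c → LexLT a c :=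
    fun a b c h k => List.lt_trans (l₁ := sortedParts a) h k
  have hmono : ∀ a : n.Partition,
      mono ⟨n, a⟩ - P ⟨n, a⟩ ∈ S a := by
    intro a
    induction a using (lexLT_wf n).induction with
    | _ a iha =>
    rw [← neg_sub]
    refine (S a).neg_mem (Submodule.span_le.2 ?_ (hP.triangular n a))
    rintro _ ⟨m, ⟨h1, h2⟩, rfl⟩
    have hlt := lexLT_of_domLE h1 h2
    have e : mono ⟨n, m⟩ = (mono ⟨n, m⟩ - P ⟨n, m⟩) + P ⟨n, m⟩ := by abel
    change mono ⟨n, m⟩ ∈ S a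
    rw [e]
    refine (S a).add_mem (Submodule.span_mono ?_ (iha m hlt)) (Submodule.subset_span ⟨⟨m, hlt⟩, rfl⟩)
    rintro _ ⟨k, rfl⟩
    exact ⟨⟨k.1, htr _ _ _ k.2 hlt⟩, rfl⟩
  obtain ⟨c, hc⟩ := (Submodule.mem_span_range_iff_exists_fun ℝ).1 (hmono l)
  have hml : mono ⟨n, l⟩ = P ⟨n, l⟩ + ∑ m : {m : n.Partition // LexLT m l}, c m • P ⟨n, m.1⟩ := by
    rw [hc]; abel
  have hcoef : ∀ m : {m : n.Partition // LexLT m l},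
      form q t (mono ⟨n, l⟩) (P ⟨n, m.1⟩) = c m * form q t (P ⟨n, m.1⟩) (P ⟨n, m.1⟩) := by
    intro m
    have hne : l ≠ m.1 := by
      rintro h
      exact List.lt_irrefl (sortedParts l) (by have := m.2; rw [← h] at this; exact this)
    rw [hml, form_add_left, form_sum_left, hP.orthogonal _ _ (by simpa using hne), zero_add,
      Finset.sum_eq_single m]
    · rw [form_smul_left]
    · intro b _ hb
      rw [form_smul_left, hP.orthogonal _ _ (by simpa using fun h => hb (Subtype.ext h)), mul_zero]
    · intro h
      exact absurd (Finset.mem_univ m) h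
  rw [macdonaldAux_eq, eq_sub_iff_add_eq]
  conv_rhs => rw [hml]
  congr 1
  refine Finset.sum_congr rfl fun m _ => ?_
  rw [← ih m.1 m.2, hcoef m, mul_div_cancel_right₀ _ (hP.norm_ne_zero _)]

/-- The dual Macdonald symmetric function `Q_l = P_l / ⟨P_l, P_l⟩`. -/
def macdonaldQ (q t : ℝ) (l : Part) : SymFun :=
  (form q t (macdonaldP q t l) (macdonaldP q t l))⁻¹ • macdonaldP q t l

/-! ### Two alphabets and skew functions -/

/-- Formal power series in two alphabets `X` and `Y` of infinitely many variables. -/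
abbrev Series2 : Type := MvPowerSeries (ℕ ⊕ ℕ) ℝ

/-- `f(X)`. -/
def inX (f : SymFun) : Series2 := MvPowerSeries.rename (Function.Embedding.inl : ℕ ↪ ℕ ⊕ ℕ) f.1

/-- `f(Y)`. -/
def inY (f : SymFun) : Series2 := MvPowerSeries.rename (Function.Embedding.inr : ℕ ↪ ℕ ⊕ ℕ) f.1

/-- `f(X,Y)`: the symmetric function `f` in the union of the two alphabets. -/
def inXY (f : SymFun) : Series2 :=
  MvPowerSeries.renameEquiv ℝ Equiv.natSumNatEquivNat.symm f.1

/-- The coefficients `B_{l/m}` in the expansion `B_l(X,Y) = ∑_m B_{l/m}(X) B_m(Y)`, for a basis `B`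
of the ring of symmetric functions. -/
def skew (B : Part → SymFun) (l : Part) : Part →₀ SymFun :=
  Classical.epsilon fun S : Part →₀ SymFun =>
    inXY (B l) = S.sum fun m f => inX f * inY (B m)

/-- `P_{l/m}(q,t)`. -/
def skewP (q t : ℝ) (l m : Part) : SymFun := skew (macdonaldP q t) l m

/-- `Q_{l/m}(q,t)`. -/
def skewQ (q t : ℝ) (l m : Part) : SymFun := skew (macdonaldQ q t) l m

/-! ### Specializations -/

/-- Specializations of the ring of symmetric functions; `θ f` is `f(θ)`. -/
abbrev Specialization : Type := SymFun →ₐ[ℝ] ℝ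

/-- `(q,t)`-Macdonald positivity. -/
def MacdonaldPositive (q t : ℝ) (θ : Specialization) : Prop :=
  ∀ l : Part, 0 ≤ θ (macdonaldP q t l)

/-- For a series `F(X,Y)` that is symmetric in `X` and in `Y`, the value under `θ ⊗ η` of the
component of bidegree `d`. That component is `∑ a_{l,m} m_l(X) m_m(Y)` where `a_{l,m}` is the
coefficient of `x^l y^m` in `F`, the sum being over `|l| = d.1` and `|m| = d.2`. -/
def specComponent (F : Series2) (θ η : Specialization) (d : ℕ × ℕ) : ℝ :=
  ∑ l : d.1.Partition, ∑ m : d.2.Partition,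
    MvPowerSeries.coeff ((expo l).sumElim (expo m)) F * θ (mono ⟨d.1, l⟩) * η (mono ⟨d.2, m⟩)

/-- The series `F(θ;η)` of specialized bihomogeneous components converges. -/
def SpecConverges (F : Series2) (θ η : Specialization) : Prop := Summable (specComponent F θ η)

/-- The value `F(θ;η)`. -/
def specValue (F : Series2) (θ η : Specialization) : ℝ := ∑' d : ℕ × ℕ, specComponent F θ η d

/-! ### Multiple Pochhammer symbols and the kernel -/

/-- `(a; p₁, …, pₙ)_∞`, for real `pᵢ` and for `a` in a topological real algebra. -/
def qPoch {A : Type*} [CommRing A] [Algebra ℝ A] [TopologicalSpace A] {n : ℕ}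
    (a : A) (p : Fin n → ℝ) : A :=
  ∏' k : Fin n → ℕ, (1 - (∏ i, p i ^ k i) • a)

/-- The formal series
`∏_{i,j} (t x_i y_j; q, u)_∞ / (x_i y_j; q, u)_∞`
(an infinite product for coefficientwise convergence). -/
def kernel (q t u : ℝ) : Series2 :=
  ∏' ij : ℕ × ℕ,
    (qPoch (t • (MvPowerSeries.X (Sum.inl ij.1) * MvPowerSeries.X (Sum.inr ij.2) : Series2)) ![q, u] *
      (qPoch (MvPowerSeries.X (Sum.inl ij.1) * MvPowerSeries.X (Sum.inr ij.2) : Series2) ![q, u])⁻¹)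

/-! ### The periodic Macdonald weight

Indexing: for `k : Fin N`, `lam k`, `mu k`, `ρm k` stand for the objects with index `k + 1 ∈ {1,…,N}`,
and `ρp k` stands for the one with index `k ∈ {0,…,N-1}`. Addition in `Fin N` is cyclic. -/

variable {N : ℕ} [NeZero N]

/-- `u^{|μ^N|} ∏_{i=1}^N Q_{λ^i/μ^i}(ρ⁻_i) P_{λ^{i+1}/μ^i}(ρ⁺_i)`, where `λ^{N+1} = λ^1` and
`ρ⁺_N = ρ⁺_0`. -/
def weight (q t u : ℝ) (ρp ρm : Fin N → Specialization) (lam mu : Fin N → Part) : ℝ :=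
  u ^ (mu ⊤).1 * ∏ k : Fin N,
    (ρm k (skewQ q t (lam k) (mu k)) * ρp (k + 1) (skewP q t (lam (k + 1)) (mu k)))

/-- The formal factor of the partition function coming from `ρ⁺_i` and `ρ⁻_{j+1}`: the kernel with
parameter `u`, divided by the kernel with parameter `0` if `j + 1 ≤ i`. -/
def pairKernel (q t u : ℝ) (i j : Fin N) : Series2 :=
  if j < i then kernel q t u * (kernel q t 0)⁻¹ else kernel q t u

end PeriodicMacdonald

end

/-!
The weight of a sequence of partitions is a product of matrix coefficients. In the ring of symmetric
functions, with `Q_l` as a basis and `P_l` as the dual basis for the scalar product, the numbers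
`Q_{l/m}(ρ)` are the matrix coefficients of the operators `lower ρ d` (substitution of `X, zρ` for
`X`, followed by extraction of `z ^ d`), and the numbers `P_{l/m}(σ)` are those of the operators
`raise q t σ d` (multiplication by the component of degree `d` of the kernel specialized at `σ`).
The two families are adjoint to each other, see `form_raise`, `skewQ_eq` and `skewP_eq`. For fixed
sizes of all the partitions, the sum of the weights is therefore the trace, on a homogeneous
component, of a cyclic word in these operators (`sum_weight`).

With one formal variable for each operator, the generating series satisfy
`A_j B_i = H_ij B_i A_j` with a scalar series `H_ij` (`lower_mul_raise`, `inVar_mul_inVar_comm`).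
Here `A_j` belongs to the `j`-th lowering and `B_i` to the `i`-th raising specialization, and the
coefficients of `H_ij`, the components of the specialized kernel with parameter `0`, are
non-negative by the positivity of the specializations (`pairing_nonneg`). Normal ordering the word
produces the factors `H_ij` with `i ≤ j` (`word_eq`). It leaves the traces `G_n` of the normally
ordered word `B ⋯ B A ⋯ A` on the components of degree `n`. By cyclicity of the trace and by
restoring the normal order, `G_n` is determined by the traces of lower degree
(`coeff_normalTrace`), and all its coefficients are non-negative (`coeffNonneg_normalTrace`).

Let `G(c)` be the sum of `u ^ n * G_n`, with the lowering variables evaluated at `c` and the raising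
variables at `1`. All terms being non-negative, no question of convergence arises in the extended
non-negative reals, and the recursion becomes `G(c) = ∏ H_ij(uc) * G(uc)` (`traceSum_one_eq`). The
specialized kernels `F_ij` with parameter `u` satisfy `F_ij(c) = H_ij(c) F_ij(uc)`
(`value_kernelSum`). Iteration of the two equations, and the value `∑ p(n) u ^ n = 1 / (u; u)_∞` of
`G` at `0` (`tsum_partitions`), give `G(1) = ∏ F_ij(u) / (u; u)_∞`, see `traceSum_one`; finiteness
of `G(1)` comes from truncation to finitely many degrees. Finally `F_ij(u)` is the value of the
quotient of the kernels with parameters `u` and `0`, and multiplication by the factors `H_ij(1)`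
with `i ≤ j` turns it into the value `F_ij(1)` of the kernel itself.

The kernels are treated as exponentials of sums of products of power sums: `hsum a d` is the
coefficient of degree `d` in `exp (∑ a_r z ^ r / r)`, and `kernel_eq_expSeries` rewrites the
infinite products in this way.
-/

open scoped MvPowerSeries.WithPiTopology

noncomputable section

namespace PeriodicMacdonald

/-! ### Symmetric functions: coefficients, grading and the monomial basis -/

/-- The coefficient of a symmetric function at a monomial, as a linear form. -/
def symCoeff (e : ℕ →₀ ℕ) : SymFun →ₗ[ℝ] ℝ :=
  (MvPowerSeries.coeff (R := ℝ) e).comp SymFun.val.toLinearMap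

theorem symCoeff_apply (e : ℕ →₀ ℕ) (f : SymFun) : symCoeff e f = MvPowerSeries.coeff e f.1 := rfl

theorem symFun_ext {f g : SymFun} (h : ∀ e, symCoeff e f = symCoeff e g) : f = g :=
  Subtype.ext (MvPowerSeries.ext h)

open Classical in
theorem symCoeff_monomialSum (e : ℕ →₀ ℕ) (a : Multiset ℕ) :
    symCoeff e (monomialSum a) = if shape e = a then 1 else 0 := by
  simp only [symCoeff_apply]
  change (if shape e = a then (1 : ℝ) else 0) = _
  congr

open Classical in
theorem symCoeff_mul (e : ℕ →₀ ℕ) (f g : SymFun) :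
    symCoeff e (f * g) = ∑ p ∈ Finset.HasAntidiagonal.antidiagonal e, symCoeff p.1 f * symCoeff p.2 g := by
  simp only [symCoeff_apply]
  rw [MulMemClass.coe_mul, MvPowerSeries.coeff_mul]

theorem symCoeff_one (e : ℕ →₀ ℕ) : symCoeff e 1 = if e = 0 then 1 else 0 := by
  classical
  simp only [symCoeff_apply, OneMemClass.coe_one, MvPowerSeries.coeff_one]

theorem sum_shape (e : ℕ →₀ ℕ) : (shape e).sum = e.degree := rfl

theorem card_shape (e : ℕ →₀ ℕ) : (shape e).card = e.support.card := by
  simp [shape]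

theorem pos_of_mem_shape {e : ℕ →₀ ℕ} {i : ℕ} (h : i ∈ shape e) : 0 < i := by
  obtain ⟨j, hj, rfl⟩ := Multiset.mem_map.1 h
  exact Nat.pos_of_ne_zero (Finsupp.mem_support_iff.1 hj)

/-- The partition formed by the nonzero exponents of a monomial. -/
def partOf (e : ℕ →₀ ℕ) : e.degree.Partition := ⟨shape e, pos_of_mem_shape, sum_shape e⟩

theorem shape_toFinsupp (L : List ℕ) (hL : ∀ x ∈ L, x ≠ 0) : shape L.toFinsupp = (L : Multiset ℕ) := by
  have hs : L.toFinsupp.support = Finset.range L.length := by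
    ext i
    simp only [Finsupp.mem_support_iff, List.toFinsupp_apply, Finset.mem_range]
    constructor
    · intro h
      by_contra h'
      exact h (List.getD_eq_default _ _ (by omega))
    · intro h
      rw [List.getD_eq_getElem _ _ h]
      exact hL _ (List.getElem_mem h)
  rw [shape, hs]
  change Multiset.map _ ((List.range L.length : List ℕ) : Multiset ℕ) = _
  rw [Multiset.map_coe]
  congr 1
  refine List.ext_getElem (by simp) fun i h1 h2 => ?_
  simp [List.getElem?_eq_getElem h2]

theorem shape_expo {n : ℕ} (l : n.Partition) : shape (expo l) = l.parts := by
  rw [expo, shape_toFinsupp]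
  · simp [sortedParts]
  · intro x hx
    exact (l.parts_pos (by simpa [sortedParts] using hx)).ne'

theorem degree_expo {n : ℕ} (l : n.Partition) : (expo l).degree = n := by
  rw [← sum_shape, shape_expo, l.parts_sum]

theorem exists_perm_of_shape_eq {e e' : ℕ →₀ ℕ} (h : shape e = shape e') :
    ∃ s : Equiv.Perm ℕ, e.mapDomain s = e' := by
  classical
  have hcard : ∀ (a : ℕ →₀ ℕ) (c : ℕ),
      Fintype.card {i : a.support // a i = c} = (shape a).count c := by
    intro a c
    rw [shape, Multiset.count_map, Fintype.card_subtype, ← Finset.card_subtype,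
      Finset.card_subtype, ← Finset.filter_val, Finset.card_val, ← Finset.card_map
      (Function.Embedding.subtype _)]
    congr 1
    ext i
    simp [eq_comm, and_comm]
  have hf : ∀ c, Nonempty ({i : e.support // e i = c} ≃ {i : e'.support // e' i = c}) := fun c =>
    Fintype.card_eq.1 (by rw [hcard, hcard, h])
  -- a bijection of the supports that preserves the exponents
  let φ : e.support ≃ e'.support := Equiv.ofFiberEquiv (f := fun i => e i) (g := fun i => e' i)
    fun c => (hf c).some
  have hφ : ∀ i : e.support, e' (φ i) = e i := fun i =>
    Equiv.ofFiberEquiv_map (f := fun i : e.support => e i) (g := fun i : e'.support => e' i) _ i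
  obtain ⟨s, hs⟩ := Equiv.Perm.exists_extending_pair (fun i : e.support => (i : ℕ))
    (fun i => (φ i : ℕ)) Subtype.val_injective (Subtype.val_injective.comp φ.injective)
  refine ⟨s, ?_⟩
  ext i
  obtain ⟨j, rfl⟩ := s.surjective i
  rw [Finsupp.mapDomain_apply s.injective]
  by_cases hj : j ∈ e.support
  · rw [hs ⟨j, hj⟩, hφ]
  · rw [Finsupp.notMem_support_iff.1 hj]
    by_contra h0
    have h1 : s j ∈ e'.support := Finsupp.mem_support_iff.2 (Ne.symm h0)
    obtain ⟨i, hi⟩ := φ.surjective ⟨s j, h1⟩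
    have h2 := hs i
    rw [hi] at h2
    exact hj (s.injective h2 ▸ i.2)

theorem symCoeff_mapDomain (s : Equiv.Perm ℕ) (e : ℕ →₀ ℕ) (f : SymFun) :
    symCoeff (e.mapDomain s) f = symCoeff e f := by
  have h3 := MvPowerSeries.coeff_embDomain_rename s.toEmbedding f.1 e
  rw [Finsupp.embDomain_eq_mapDomain] at h3
  have h4 : MvPowerSeries.rename s.toEmbedding f.1 = f.1 := f.2.1 s
  rw [h4] at h3
  exact h3

theorem symCoeff_congr {e e' : ℕ →₀ ℕ} (h : shape e = shape e') (f : SymFun) :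
    symCoeff e f = symCoeff e' f := by
  obtain ⟨s, rfl⟩ := exists_perm_of_shape_eq h
  rw [symCoeff_mapDomain]

theorem symCoeff_sum_mono {n : ℕ} (a : n.Partition → ℝ) (e : ℕ →₀ ℕ) :
    symCoeff e (∑ l : n.Partition, a l • mono ⟨n, l⟩) =
      if h : e.degree = n then a (h ▸ partOf e) else 0 := by
  classical
  simp only [map_sum, map_smul, mono, symCoeff_monomialSum, smul_eq_mul, mul_ite, mul_one, mul_zero]
  split_ifs with h
  · subst h
    rw [Finset.sum_eq_single (partOf e)]
    · simp [partOf]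
    · intro b _ hb
      rw [if_neg]
      rintro h
      exact hb (Nat.Partition.ext h.symm)
    · simp
  · refine Finset.sum_eq_zero fun l _ => if_neg fun h' => h ?_
    rw [← sum_shape, h', l.parts_sum]

/-- The symmetric functions that are homogeneous of degree `m`. The degree is an integer so that
operators lowering the degree need no case distinction; for `m < 0` this is the zero space. -/
def gr (m : ℤ) : Submodule ℝ SymFun where
  carrier := {f | ∀ e : ℕ →₀ ℕ, (e.degree : ℤ) ≠ m → symCoeff e f = 0}
  add_mem' := fun hf hg e he => by rw [map_add, hf e he, hg e he, add_zero]
  zero_mem' := fun e _ => map_zero _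
  smul_mem' := fun c f hf e he => by rw [map_smul, hf e he, smul_zero]

theorem monomialSum_mem_gr (a : Multiset ℕ) : monomialSum a ∈ gr a.sum := by
  intro e he
  rw [symCoeff_monomialSum, if_neg]
  rintro rfl
  exact he rfl

theorem mono_mem_gr (l : Part) : mono l ∈ gr l.1 := by
  have := monomialSum_mem_gr l.2.parts
  rwa [l.2.parts_sum] at this

theorem eq_zero_of_mem_gr_neg {m : ℤ} (hm : m < 0) {f : SymFun} (hf : f ∈ gr m) : f = 0 :=
  symFun_ext fun e => by rw [hf e (by omega), map_zero]

theorem one_mem_gr : (1 : SymFun) ∈ gr 0 := by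
  intro e he
  rw [symCoeff_one, if_neg]
  rintro rfl
  simp at he

theorem mul_mem_gr {m k : ℤ} {f g : SymFun} (hf : f ∈ gr m) (hg : g ∈ gr k) : f * g ∈ gr (m + k) := by
  classical
  intro e he
  rw [symCoeff_mul]
  refine Finset.sum_eq_zero fun p hp => ?_
  rw [Finset.HasAntidiagonal.mem_antidiagonal] at hp
  have h : p.1.degree + p.2.degree = e.degree := by rw [← hp, map_add]
  by_cases h1 : (p.1.degree : ℤ) = m
  · rw [hg p.2 (by omega), mul_zero]
  · rw [hf p.1 h1, zero_mul]

theorem eq_sum_mono {n : ℕ} {f : SymFun} (hf : f ∈ gr n) :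
    f = ∑ l : n.Partition, symCoeff (expo l) f • mono ⟨n, l⟩ := by
  refine symFun_ext fun e => ?_
  rw [symCoeff_sum_mono]
  split_ifs with h
  · subst h
    exact symCoeff_congr (shape_expo (partOf e)).symm f
  · exact hf e (by exact_mod_cast h)

theorem eq_sum_sum_mono (f : SymFun) : ∃ d : ℕ,
    f = ∑ n ∈ Finset.range d, ∑ l : n.Partition, symCoeff (expo l) f • mono ⟨n, l⟩ := by
  obtain ⟨d, hd⟩ := f.2.2
  refine ⟨d + 1, symFun_ext fun e => ?_⟩
  rw [map_sum]
  simp_rw [symCoeff_sum_mono]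
  by_cases h : e.degree ≤ d
  · rw [Finset.sum_eq_single e.degree]
    · simp only [dif_pos]
      exact symCoeff_congr (shape_expo (partOf e)).symm f
    · intro b _ hb
      rw [dif_neg (Ne.symm hb)]
    · intro h'
      exact absurd (Finset.mem_range.2 (by omega)) h'
  · rw [symCoeff_apply, hd e (by omega), Finset.sum_eq_zero]
    intro n hn
    rw [Finset.mem_range] at hn
    rw [dif_neg (by omega)]

/-! ### Power sums -/

theorem psum_mem_gr (r : ℕ) : psum r ∈ gr r := by
  have := monomialSum_mem_gr {r}
  rwa [Multiset.sum_singleton] at this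

theorem prod_psum_mem_gr (s : Multiset ℕ) : (s.map psum).prod ∈ gr s.sum := by
  induction s using Multiset.induction_on with
  | empty => simpa using one_mem_gr
  | cons a s ih =>
    rw [Multiset.map_cons, Multiset.prod_cons, Multiset.sum_cons, Nat.cast_add]
    exact mul_mem_gr (psum_mem_gr a) ih

theorem psumPart_mem_gr (l : Part) : psumPart l ∈ gr l.1 := by
  have := prod_psum_mem_gr l.2.parts
  rwa [l.2.parts_sum] at this

theorem symCoeff_psum (e : ℕ →₀ ℕ) {r : ℕ} (h : symCoeff e (psum r) ≠ 0) :
    ∃ i, e = Finsupp.single i r := by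
  classical
  rw [psum, symCoeff_monomialSum] at h
  have h1 : shape e = {r} := by
    by_contra h'
    exact h (if_neg h')
  have h2 : e.support.card = 1 := by rw [← card_shape, h1]; rfl
  obtain ⟨i, b, hb, rfl⟩ := Finsupp.card_support_eq_one'.1 h2
  refine ⟨i, ?_⟩
  have : shape (Finsupp.single i b) = {b} := by
    simp [shape, Finsupp.support_single i hb]
  rw [this] at h1
  simp at h1
  rw [h1]

theorem shape_single (i : ℕ) {r : ℕ} (hr : r ≠ 0) : shape (Finsupp.single i r) = {r} := by
  simp [shape, Finsupp.support_single i hr]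

theorem symCoeff_psum_single (i : ℕ) {r : ℕ} (hr : r ≠ 0) :
    symCoeff (Finsupp.single i r) (psum r) = 1 := by
  rw [psum, symCoeff_monomialSum, if_pos (shape_single i hr)]

theorem symCoeff_psum_nonneg (e : ℕ →₀ ℕ) (r : ℕ) : 0 ≤ symCoeff e (psum r) := by
  rw [psum, symCoeff_monomialSum]
  split_ifs <;> norm_num

theorem symCoeff_prod_psum_nonneg (s : Multiset ℕ) (e : ℕ →₀ ℕ) :
    0 ≤ symCoeff e (s.map psum).prod := by
  induction s using Multiset.induction_on generalizing e with
  | empty =>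
    rw [Multiset.map_zero, Multiset.prod_zero, symCoeff_one]
    split_ifs <;> norm_num
  | cons a s ih =>
    classical
    rw [Multiset.map_cons, Multiset.prod_cons, symCoeff_mul]
    exact Finset.sum_nonneg fun p _ => mul_nonneg (symCoeff_psum_nonneg _ _) (ih _)

/-- A monomial occurring in `p_s` has at most `ℓ(s)` variables, and if it has exactly `ℓ(s)` then
its exponents are the parts of `s`. -/
theorem shape_of_symCoeff_prod_psum (s : Multiset ℕ) (hs : ∀ r ∈ s, r ≠ 0) (e : ℕ →₀ ℕ)
    (h : symCoeff e (s.map psum).prod ≠ 0) :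
    e.support.card ≤ s.card ∧ (e.support.card = s.card → shape e = s) := by
  classical
  induction s using Multiset.induction_on generalizing e with
  | empty =>
    rw [Multiset.map_zero, Multiset.prod_zero, symCoeff_one] at h
    have : e = 0 := by
      by_contra h'
      exact h (if_neg h')
    subst this
    simp [shape]
  | cons a s ih =>
    rw [Multiset.map_cons, Multiset.prod_cons, symCoeff_mul] at h
    obtain ⟨p, hp, hne⟩ := Finset.exists_ne_zero_of_sum_ne_zero h
    rw [Finset.HasAntidiagonal.mem_antidiagonal] at hp
    have ha : a ≠ 0 := hs a (by simp)
    obtain ⟨i, hi⟩ := symCoeff_psum p.1 (left_ne_zero_of_mul hne)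
    obtain ⟨h1, h2⟩ := ih (fun r hr => hs r (by simp [hr])) p.2 (right_ne_zero_of_mul hne)
    have hsupp : e.support = {i} ∪ p.2.support := by
      ext j
      rw [← hp, hi, Finset.mem_union, Finset.mem_singleton, Finsupp.mem_support_iff,
        Finsupp.mem_support_iff, Finsupp.add_apply]
      rcases eq_or_ne j i with rfl | hj
      · simp [ha]
      · simp [hj]
    have hcard : e.support.card ≤ 1 + p.2.support.card := by
      rw [hsupp]
      exact (Finset.card_union_le _ _).trans (by simp)
    rw [Multiset.card_cons]
    refine ⟨by omega, fun h3 => ?_⟩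
    have h4 := h2 (by omega)
    have hi2 : i ∉ p.2.support := by
      intro hi2
      have : e.support = p.2.support := by
        rw [hsupp]
        exact Finset.union_eq_right.2 (by simpa using hi2)
      rw [this] at h3
      omega
    rw [shape, hsupp, ← Finset.insert_eq, Finset.insert_val_of_notMem hi2, Multiset.map_cons, ← h4,
      shape]
    rw [Finsupp.notMem_support_iff] at hi2
    congr 1
    · rw [← hp, hi]
      simp [hi2]
    · refine Multiset.map_congr rfl fun j hj => ?_
      have : j ≠ i := by
        rintro rfl
        exact (Finsupp.mem_support_iff.1 hj) hi2
      rw [← hp, hi]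
      simp [this.symm]

theorem symCoeff_prod_psum_pos (s : Multiset ℕ) (hs : ∀ r ∈ s, r ≠ 0) (e : ℕ →₀ ℕ)
    (h : shape e = s) : 0 < symCoeff e (s.map psum).prod := by
  classical
  induction s using Multiset.induction_on generalizing e with
  | empty =>
    have : e = 0 := by
      rw [← Finsupp.support_eq_empty, ← Finset.card_eq_zero, ← card_shape, h]
      rfl
    rw [Multiset.map_zero, Multiset.prod_zero, symCoeff_one, if_pos this]
    norm_num
  | cons a s ih =>
    rw [Multiset.map_cons, Multiset.prod_cons, symCoeff_mul]
    have ha : a ≠ 0 := hs a (by simp)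
    have : a ∈ shape e := by simp [h]
    obtain ⟨i, hi, rfl⟩ := Multiset.mem_map.1 this
    have hsh : shape (e.erase i) = s := by
      have h5 : shape e = e i ::ₘ shape (e.erase i) := by
        have h6 : e.support = insert i (e.erase i).support := by
          rw [Finsupp.support_erase, Finset.insert_erase hi]
        rw [shape, h6, Finset.insert_val_of_notMem (by simp), Multiset.map_cons, shape]
        congr 1
        refine Multiset.map_congr rfl fun j hj => ?_
        have : j ≠ i := by
          rintro rfl
          exact Finsupp.mem_support_iff.1 hj (Finsupp.erase_same)
        rw [Finsupp.erase_ne this]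
      rw [h5] at h
      exact (Multiset.cons_inj_right _).1 h
    have hpos := ih (fun r hr => hs r (by simp [hr])) _ hsh
    refine Finset.sum_pos' (fun p _ => mul_nonneg (symCoeff_psum_nonneg _ _)
      (symCoeff_prod_psum_nonneg _ _)) ⟨(Finsupp.single i (e i), e.erase i), ?_, ?_⟩
    · rw [Finset.HasAntidiagonal.mem_antidiagonal]
      exact Finsupp.single_add_erase i e
    · rw [symCoeff_psum_single i ha, one_mul]
      exact hpos

theorem Part.ne_zero_of_mem (l : Part) {r : ℕ} (hr : r ∈ l.2.parts) : r ≠ 0 :=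
  (l.2.parts_pos hr).ne'

theorem part_ext {l m : Part} (h : l.2.parts = m.2.parts) : l = m := by
  obtain ⟨n, l⟩ := l
  obtain ⟨k, m⟩ := m
  have : n = k := by rw [← l.parts_sum, ← m.parts_sum, h]
  subst this
  exact congrArg _ (Nat.Partition.ext h)

/-- The coefficient of `p_m` at the exponent of `l` vanishes if `m` has fewer parts than `l`, or as
many and `m ≠ l`. A partition with the most parts in the support of a relation gives a
contradiction. -/
theorem linearIndependent_psumPart : LinearIndependent ℝ psumPart := by
  classical
  rw [linearIndependent_iff]
  intro c hc
  by_contra hne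
  obtain ⟨l, hl, hmax⟩ := Finset.exists_max_image c.support (fun l => l.2.parts.card)
    (Finsupp.support_nonempty_iff.2 hne)
  have h1 := congrArg (symCoeff (expo l.2)) hc
  rw [Finsupp.linearCombination_apply, Finsupp.sum, map_sum, Finset.sum_eq_single l] at h1
  · rw [map_smul, map_zero, smul_eq_mul] at h1
    rcases mul_eq_zero.1 h1 with h2 | h2
    · exact Finsupp.mem_support_iff.1 hl h2
    · exact (symCoeff_prod_psum_pos _ (fun _ => l.ne_zero_of_mem) _ (shape_expo l.2)).ne' h2
  · intro m hm hml
    rw [map_smul, smul_eq_mul, mul_eq_zero]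
    right
    by_contra h2
    obtain ⟨h3, h4⟩ := shape_of_symCoeff_prod_psum _ (fun _ => m.ne_zero_of_mem) _ h2
    rw [← card_shape, shape_expo] at h3 h4
    exact hml (part_ext (h4 (le_antisymm h3 (hmax m hm)))).symm
  · intro h
    exact absurd hl h

/-- Every `m_μ` other than `m_l` that occurs in `p_l` has fewer parts than `l`. -/
theorem mono_mem_span_psumPart (n : ℕ) (l : n.Partition) :
    mono ⟨n, l⟩ ∈ Submodule.span ℝ (Set.range fun m : n.Partition => psumPart ⟨n, m⟩) := by
  classical
  induction h : l.parts.card using Nat.strong_induction_on generalizing l with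
  | _ k ih =>
  subst h
  have h1 := eq_sum_mono (n := n) (psumPart_mem_gr ⟨n, l⟩)
  have hpos := symCoeff_prod_psum_pos l.parts (fun r hr => (l.parts_pos hr).ne') _ (shape_expo l)
  rw [← Finset.add_sum_erase _ _ (Finset.mem_univ l)] at h1
  have h2 : mono ⟨n, l⟩ = (symCoeff (expo l) (psumPart ⟨n, l⟩))⁻¹ • (psumPart ⟨n, l⟩ -
      ∑ m ∈ Finset.univ.erase l, symCoeff (expo m) (psumPart ⟨n, l⟩) • mono ⟨n, m⟩) := by
    rw [sub_eq_of_eq_add h1, smul_smul, inv_mul_cancel₀, one_smul]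
    exact hpos.ne'
  rw [h2]
  refine Submodule.smul_mem _ _ (Submodule.sub_mem _ (Submodule.subset_span ⟨l, rfl⟩)
    (Submodule.sum_mem _ fun m hm => ?_))
  by_cases h3 : symCoeff (expo m) (psumPart ⟨n, l⟩) = 0
  · rw [h3, zero_smul]
    exact Submodule.zero_mem _
  · refine Submodule.smul_mem _ _ (ih _ ?_ m rfl)
    obtain ⟨h4, h5⟩ := shape_of_symCoeff_prod_psum _ (fun r hr => (l.parts_pos hr).ne') _ h3
    rw [← card_shape, shape_expo] at h4 h5
    refine lt_of_le_of_ne h4 fun h6 => ?_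
    exact Finset.ne_of_mem_erase hm (Nat.Partition.ext (h5 h6))

theorem mem_span_psumPart {n : ℕ} {f : SymFun} (hf : f ∈ gr n) :
    f ∈ Submodule.span ℝ (Set.range fun m : n.Partition => psumPart ⟨n, m⟩) := by
  rw [eq_sum_mono hf]
  exact Submodule.sum_mem _ fun l _ => Submodule.smul_mem _ _ (mono_mem_span_psumPart n l)

theorem span_psumPart : Submodule.span ℝ (Set.range psumPart) = ⊤ := by
  rw [eq_top_iff]
  rintro f -
  obtain ⟨d, hd⟩ := eq_sum_sum_mono f
  rw [hd]
  refine Submodule.sum_mem _ fun n _ => Submodule.sum_mem _ fun l _ => Submodule.smul_mem _ _ ?_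
  refine Submodule.span_mono ?_ (mono_mem_span_psumPart n l)
  rintro _ ⟨m, rfl⟩
  exact ⟨_, rfl⟩

/-- The basis of power sums. -/
def psumBasis : Module.Basis Part ℝ SymFun :=
  Module.Basis.mk linearIndependent_psumPart span_psumPart.ge

theorem psumBasis_apply (l : Part) : psumBasis l = psumPart l := by
  simp [psumBasis]

theorem psumCoord_linearCombination (c : Part →₀ ℝ) :
    psumCoord (Finsupp.linearCombination ℝ psumPart c) = c :=
  LinearMap.leftInverse_apply_of_inj
    (LinearMap.ker_eq_bot.2 linearIndependent_psumPart) c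

theorem psumCoord_psumPart (l : Part) : psumCoord (psumPart l) = Finsupp.single l 1 := by
  have := psumCoord_linearCombination (Finsupp.single l 1)
  simpa using this

theorem psumCoord_eq_repr (f : SymFun) : psumCoord f = psumBasis.repr f := by
  have : psumCoord = psumBasis.repr.toLinearMap := by
    refine psumBasis.ext fun l => ?_
    rw [psumBasis_apply, psumCoord_psumPart, ← psumBasis_apply]
    simp
  rw [this]
  rfl

/-- The partition in which the part `k + 1` has multiplicity `m k`. -/
def partOfExp (m : ℕ →₀ ℕ) : Part :=
  ⟨(m.toMultiset.map Nat.succ).sum, m.toMultiset.map Nat.succ, fun h => by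
    obtain ⟨j, _, rfl⟩ := Multiset.mem_map.1 h
    exact Nat.succ_pos j, rfl⟩

/-- The bijection between the monomials in `p_1, p_2, …` and the partitions. -/
def expEquiv : (ℕ →₀ ℕ) ≃ Part where
  toFun := partOfExp
  invFun l := Multiset.toFinsupp (l.2.parts.map Nat.pred)
  left_inv m := by
    change Multiset.toFinsupp ((m.toMultiset.map Nat.succ).map Nat.pred) = m
    rw [Multiset.map_map]
    simp
  right_inv l := by
    refine part_ext ?_
    change ((Multiset.toFinsupp (l.2.parts.map Nat.pred)).toMultiset.map Nat.succ) = _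
    rw [Multiset.toFinsupp_toMultiset, Multiset.map_map]
    conv_rhs => rw [← Multiset.map_id l.2.parts]
    exact Multiset.map_congr rfl fun r hr => Nat.succ_pred (l.ne_zero_of_mem hr)

theorem aeval_psum_monomial (m : ℕ →₀ ℕ) :
    MvPolynomial.aeval (fun k => psum (k + 1)) (MvPolynomial.monomial m (1 : ℝ)) =
      psumPart (expEquiv m) := by
  rw [MvPolynomial.aeval_monomial, map_one, one_mul, psumPart]
  change _ = ((m.toMultiset.map Nat.succ).map psum).prod
  rw [Multiset.map_map, Finsupp.toMultiset_apply, Finsupp.sum, Finsupp.prod,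
    ← Multiset.coe_mapAddMonoidHom, map_sum, Multiset.prod_sum]
  exact Finset.prod_congr rfl fun i _ => by
    rw [Multiset.coe_mapAddMonoidHom, Multiset.map_nsmul, Multiset.map_singleton, Multiset.prod_nsmul, Multiset.prod_singleton]
    rfl

theorem aeval_psum_bijective : Function.Bijective
    (MvPolynomial.aeval (R := ℝ) (fun k => psum (k + 1))) := by
  have h : (MvPolynomial.aeval (R := ℝ) (fun k => psum (k + 1))).toLinearMap =
      ((MvPolynomial.basisMonomials ℕ ℝ).equiv psumBasis expEquiv).toLinearMap := by
    refine (MvPolynomial.basisMonomials ℕ ℝ).ext fun m => ?_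
    rw [AlgHom.toLinearMap_apply, MvPolynomial.coe_basisMonomials, aeval_psum_monomial,
      ← psumBasis_apply, ← MvPolynomial.coe_basisMonomials, LinearEquiv.coe_coe,
      Module.Basis.equiv_apply]
  have h2 : ⇑(MvPolynomial.aeval (R := ℝ) (fun k => psum (k + 1))) =
      ⇑((MvPolynomial.basisMonomials ℕ ℝ).equiv psumBasis expEquiv) :=
    funext fun x => LinearMap.congr_fun h x
  rw [h2]
  exact LinearEquiv.bijective _

/-- The ring of symmetric functions is the polynomial ring in the power sums. -/
def psumEquiv : MvPolynomial ℕ ℝ ≃ₐ[ℝ] SymFun :=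
  AlgEquiv.ofBijective (MvPolynomial.aeval (fun k => psum (k + 1))) aeval_psum_bijective

theorem psumEquiv_X (k : ℕ) : psumEquiv (MvPolynomial.X k) = psum (k + 1) := by
  simp [psumEquiv]

theorem psumEquiv_monomial (m : ℕ →₀ ℕ) :
    psumEquiv (MvPolynomial.monomial m 1) = psumPart (expEquiv m) := aeval_psum_monomial m

theorem symFun_algHom_ext {R : Type*} [CommRing R] [Algebra ℝ R] {φ χ : SymFun →ₐ[ℝ] R}
    (h : ∀ k, φ (psum (k + 1)) = χ (psum (k + 1))) : φ = χ := by
  have : φ.comp psumEquiv.toAlgHom = χ.comp psumEquiv.toAlgHom := by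
    refine MvPolynomial.algHom_ext fun k => ?_
    change φ (psumEquiv (MvPolynomial.X k)) = χ (psumEquiv (MvPolynomial.X k))
    rw [psumEquiv_X, h]
  ext f
  obtain ⟨x, rfl⟩ := psumEquiv.surjective f
  exact DFunLike.congr_fun this x

/-- The algebra homomorphism on symmetric functions with prescribed values on `p_1, p_2, …`. -/
def psumLift {R : Type*} [CommRing R] [Algebra ℝ R] (a : ℕ → R) : SymFun →ₐ[ℝ] R :=
  (MvPolynomial.aeval fun k => a (k + 1)).comp psumEquiv.symm.toAlgHom

theorem psumLift_psum {R : Type*} [CommRing R] [Algebra ℝ R] (a : ℕ → R) {r : ℕ} (hr : r ≠ 0) :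
    psumLift a (psum r) = a r := by
  obtain ⟨k, rfl⟩ := Nat.exists_eq_succ_of_ne_zero hr
  have : psumEquiv.symm (psum (k + 1)) = MvPolynomial.X k := by
    rw [← psumEquiv_X, AlgEquiv.symm_apply_apply]
  change MvPolynomial.aeval _ (psumEquiv.symm (psum (k + 1))) = _
  rw [this, MvPolynomial.aeval_X]

theorem symFun_induction {p : SymFun → Prop} (h1 : p 1) (hadd : ∀ f g, p f → p g → p (f + g))
    (hsmul : ∀ (c : ℝ) f, p f → p (c • f)) (hmul : ∀ k f, p f → p (f * psum (k + 1)))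
    (f : SymFun) : p f := by
  obtain ⟨x, rfl⟩ := psumEquiv.surjective f
  induction x using MvPolynomial.induction_on with
  | C a =>
    rw [← MvPolynomial.algebraMap_eq, AlgEquiv.commutes, Algebra.algebraMap_eq_smul_one]
    exact hsmul a 1 h1
  | add x y hx hy => rw [map_add]; exact hadd _ _ hx hy
  | mul_X x k hx => rw [map_mul, psumEquiv_X]; exact hmul k _ hx

end PeriodicMacdonald

namespace PeriodicMacdonald

/-! ### The scalar product and the dual bases `P`, `Q` -/

theorem zqt_pos {q t : ℝ} (hq0 : 0 < q) (hq1 : q < 1) (ht0 : 0 < t) (ht1 : t < 1) (l : Part) :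
    0 < zqt q t l := by
  refine mul_pos (Finset.prod_pos fun i hi => ?_) (Multiset.prod_pos fun x hx => ?_)
  · have : 0 < i := l.2.parts_pos (Multiset.mem_toFinset.1 hi)
    positivity
  · obtain ⟨r, hr, rfl⟩ := Multiset.mem_map.1 hx
    have hr0 := l.ne_zero_of_mem hr
    exact div_pos (sub_pos.2 (pow_lt_one₀ hq0.le hq1 hr0)) (sub_pos.2 (pow_lt_one₀ ht0.le ht1 hr0))

theorem form_comm (q t : ℝ) (f g : SymFun) : form q t f g = form q t g f := by
  classical
  unfold form
  rw [Finsupp.sum_of_support_subset _ (Finset.subset_union_left (s₂ := (psumCoord g).support)) _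
      (by simp),
    Finsupp.sum_of_support_subset _ (Finset.subset_union_right (s₁ := (psumCoord f).support)) _
      (by simp)]
  exact Finset.sum_congr rfl fun l _ => by ring

theorem form_add_right (q t : ℝ) (f g h : SymFun) :
    form q t f (g + h) = form q t f g + form q t f h := by
  rw [form_comm, form_add_left, form_comm q t g, form_comm q t h]

theorem form_smul_right (q t : ℝ) (c : ℝ) (f h : SymFun) :
    form q t f (c • h) = c * form q t f h := by
  rw [form_comm, form_smul_left, form_comm]

/-- The linear form `⟨f, ·⟩`. -/
def formL (q t : ℝ) (f : SymFun) : SymFun →ₗ[ℝ] ℝ where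
  toFun := form q t f
  map_add' := form_add_right q t f
  map_smul' c h := form_smul_right q t c f h

theorem formL_apply (q t : ℝ) (f g : SymFun) : formL q t f g = form q t f g := rfl

theorem form_sum_right (q t : ℝ) {ι : Type*} (s : Finset ι) (f : ι → SymFun) (h : SymFun) :
    form q t h (∑ i ∈ s, f i) = ∑ i ∈ s, form q t h (f i) := map_sum (formL q t h) f s

theorem form_zero_right (q t : ℝ) (f : SymFun) : form q t f 0 = 0 := map_zero (formL q t f)

theorem form_zero_left (q t : ℝ) (f : SymFun) : form q t 0 f = 0 := by
  rw [form_comm, form_zero_right]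

theorem form_sub_left (q t : ℝ) (f g h : SymFun) :
    form q t (f - g) h = form q t f h - form q t g h := by
  rw [form_comm, form_comm q t f, form_comm q t g]
  exact map_sub (formL q t h) f g

theorem form_psumPart_left (q t : ℝ) (l : Part) (g : SymFun) :
    form q t (psumPart l) g = zqt q t l * psumCoord g l := by
  rw [form, psumCoord_psumPart, Finsupp.sum_single_index] <;> simp

theorem form_psumPart (q t : ℝ) (l m : Part) :
    form q t (psumPart l) (psumPart m) = if l = m then zqt q t l else 0 := by
  classical
  rw [form_psumPart_left, psumCoord_psumPart, Finsupp.single_apply]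
  split_ifs with h1 h2 h2 <;> simp_all

theorem form_self_pos {q t : ℝ} (hq0 : 0 < q) (hq1 : q < 1) (ht0 : 0 < t) (ht1 : t < 1)
    {f : SymFun} (hf : f ≠ 0) : 0 < form q t f f := by
  have hne : psumCoord f ≠ 0 := by
    rw [psumCoord_eq_repr]
    simpa using hf
  refine Finset.sum_pos (fun l hl => ?_) (Finsupp.support_nonempty_iff.2 hne)
  change 0 < _ * _ * _
  rw [mul_assoc]
  exact mul_pos (zqt_pos hq0 hq1 ht0 ht1 l)
    (mul_self_pos.2 (Finsupp.mem_support_iff.1 hl))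

theorem form_eq_zero_of_ne (q t : ℝ) {m k : ℤ} {f g : SymFun} (hf : f ∈ gr m) (hg : g ∈ gr k)
    (h : m ≠ k) : form q t f g = 0 := by
  rcases lt_or_ge m 0 with hm | hm
  · rw [eq_zero_of_mem_gr_neg hm hf, form_zero_left]
  rcases lt_or_ge k 0 with hk | hk
  · rw [eq_zero_of_mem_gr_neg hk hg, form_zero_right]
  lift m to ℕ using hm
  lift k to ℕ using hk
  obtain ⟨a, rfl⟩ := (Submodule.mem_span_range_iff_exists_fun ℝ).1 (mem_span_psumPart hf)
  obtain ⟨b, rfl⟩ := (Submodule.mem_span_range_iff_exists_fun ℝ).1 (mem_span_psumPart hg)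
  rw [form_sum_left]
  refine Finset.sum_eq_zero fun l _ => ?_
  rw [form_sum_right]
  refine Finset.sum_eq_zero fun l' _ => ?_
  rw [form_smul_left, form_smul_right, form_psumPart, if_neg, mul_zero, mul_zero]
  intro h'
  exact h (congrArg (fun x : ℕ => (x : ℤ)) (congrArg Sigma.fst h'))

theorem lexLT_trichotomy {n : ℕ} (a b : n.Partition) : LexLT a b ∨ a = b ∨ LexLT b a := by
  rcases lt_trichotomy (sortedParts a) (sortedParts b) with h | h | h
  · exact Or.inl h
  · exact Or.inr (Or.inl (sortedParts_injective h))
  · exact Or.inr (Or.inr h)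

theorem lexLT_trans {n : ℕ} {a b c : n.Partition} (h : LexLT a b) (k : LexLT b c) : LexLT a c :=
  List.lt_trans (l₁ := sortedParts a) h k

theorem lexLT_irrefl {n : ℕ} (a : n.Partition) : ¬ LexLT a a := List.lt_irrefl (sortedParts a)

theorem symCoeff_expo_mono {n : ℕ} (l k : n.Partition) :
    symCoeff (expo k) (mono ⟨n, l⟩) = if k = l then 1 else 0 := by
  classical
  rw [mono, symCoeff_monomialSum, shape_expo]
  refine if_congr ⟨fun h => Nat.Partition.ext h, fun h => by rw [h]⟩ rfl rfl

theorem symCoeff_macdonaldAux (q t : ℝ) {n : ℕ} (l k : n.Partition) (h : ¬ LexLT k l) :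
    symCoeff (expo k) (macdonaldAux q t n l) = if k = l then 1 else 0 := by
  classical
  induction l using (lexLT_wf n).induction with
  | _ l ih =>
  rw [macdonaldAux_eq, map_sub, symCoeff_expo_mono, sub_eq_self, map_sum]
  refine Finset.sum_eq_zero fun m _ => ?_
  have h1 : ¬ LexLT k m.1 := fun h' => h (lexLT_trans h' m.2)
  rw [map_smul, ih m.1 m.2 h1, if_neg, smul_zero]
  rintro rfl
  exact h m.2

theorem macdonaldAux_ne_zero (q t : ℝ) {n : ℕ} (l : n.Partition) : macdonaldAux q t n l ≠ 0 := by
  intro h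
  have := symCoeff_macdonaldAux q t l l (lexLT_irrefl l)
  rw [h, map_zero, if_pos rfl] at this
  exact zero_ne_one this

theorem macdonaldP_mem_gr (q t : ℝ) (l : Part) : macdonaldP q t l ∈ gr l.1 := by
  classical
  obtain ⟨n, l⟩ := l
  change macdonaldAux q t n l ∈ gr n
  induction l using (lexLT_wf n).induction with
  | _ l ih =>
  rw [macdonaldAux_eq]
  exact Submodule.sub_mem _ (mono_mem_gr ⟨n, l⟩)
    (Submodule.sum_mem _ fun m _ => Submodule.smul_mem _ _ (ih m.1 m.2))

theorem mono_mem_span_macdonaldP (q t : ℝ) {n : ℕ} (l : n.Partition) : mono ⟨n, l⟩ ∈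
    Submodule.span ℝ (Set.range fun m : n.Partition => macdonaldP q t ⟨n, m⟩) := by
  classical
  have h := macdonaldAux_eq q t n l
  rw [eq_sub_iff_add_eq] at h
  rw [← h]
  exact Submodule.add_mem _ (Submodule.subset_span ⟨l, rfl⟩) (Submodule.sum_mem _ fun m _ =>
    Submodule.smul_mem _ _ (Submodule.subset_span ⟨m.1, rfl⟩))

/-- The parameters satisfy `0 < q, t < 1`. -/
structure Params (q t : ℝ) : Prop where
  q_pos : 0 < q
  q_lt : q < 1
  t_pos : 0 < t
  t_lt : t < 1

variable {q t : ℝ}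

theorem form_macdonaldP_self_pos (H : Params q t) (l : Part) :
    0 < form q t (macdonaldP q t l) (macdonaldP q t l) :=
  form_self_pos H.q_pos H.q_lt H.t_pos H.t_lt (macdonaldAux_ne_zero q t l.2)

theorem form_macdonaldP_of_lexLT (H : Params q t) {n : ℕ} (l m : n.Partition) (h : LexLT m l) :
    form q t (macdonaldP q t ⟨n, l⟩) (macdonaldP q t ⟨n, m⟩) = 0 := by
  classical
  induction l using (lexLT_wf n).induction generalizing m with
  | _ l ih =>
  have h1 : macdonaldP q t ⟨n, l⟩ = _ := macdonaldAux_eq q t n l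
  rw [h1, form_sub_left, form_sum_left, Finset.sum_eq_single ⟨m, h⟩]
  · rw [form_smul_left]
    change form q t _ (macdonaldP q t ⟨n, m⟩) - _ / form q t (macdonaldP q t ⟨n, m⟩)
      (macdonaldP q t ⟨n, m⟩) * form q t (macdonaldP q t ⟨n, m⟩) (macdonaldP q t ⟨n, m⟩) = 0
    rw [div_mul_cancel₀ _ (form_macdonaldP_self_pos H ⟨n, m⟩).ne', sub_eq_zero]
    rfl
  · intro k _ hk
    rw [form_smul_left, mul_eq_zero]
    right
    rcases lexLT_trichotomy k.1 m with h2 | h2 | h2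
    · rw [form_comm]
      exact ih m h k.1 h2
    · exact absurd (Subtype.ext h2) hk
    · exact ih k.1 k.2 m h2
  · intro h'
    exact absurd (Finset.mem_univ _) h'

theorem form_macdonaldP_of_ne (H : Params q t) {l m : Part} (h : l ≠ m) :
    form q t (macdonaldP q t l) (macdonaldP q t m) = 0 := by
  by_cases h1 : l.1 = m.1
  · obtain ⟨n, l⟩ := l
    obtain ⟨k, m⟩ := m
    obtain rfl : n = k := h1
    rcases lexLT_trichotomy l m with h2 | h2 | h2
    · rw [form_comm]
      exact form_macdonaldP_of_lexLT H _ _ h2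
    · exact absurd (by rw [h2]) h
    · exact form_macdonaldP_of_lexLT H _ _ h2
  · exact form_eq_zero_of_ne q t (macdonaldP_mem_gr q t l) (macdonaldP_mem_gr q t m)
      (by exact_mod_cast h1)

theorem macdonaldQ_mem_gr (q t : ℝ) (l : Part) : macdonaldQ q t l ∈ gr l.1 :=
  Submodule.smul_mem _ _ (macdonaldP_mem_gr q t l)

theorem form_macdonaldP_macdonaldQ (H : Params q t) (l m : Part) [Decidable (l = m)] :
    form q t (macdonaldP q t l) (macdonaldQ q t m) = if l = m then 1 else 0 := by
  rw [macdonaldQ, form_smul_right]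
  split_ifs with h
  · subst h
    exact inv_mul_cancel₀ (form_macdonaldP_self_pos H l).ne'
  · rw [form_macdonaldP_of_ne H h, mul_zero]

/-- A homogeneous symmetric function that is orthogonal to all `P_l` vanishes. -/
theorem eq_of_form_macdonaldP (H : Params q t) {n : ℕ} {f g : SymFun} (hf : f ∈ gr n)
    (hg : g ∈ gr n) (h : ∀ l : n.Partition, form q t (macdonaldP q t ⟨n, l⟩) f =
      form q t (macdonaldP q t ⟨n, l⟩) g) : f = g := by
  rw [← sub_eq_zero]
  have hd : f - g ∈ gr n := Submodule.sub_mem _ hf hg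
  have h1 : ∀ l : n.Partition, form q t (f - g) (macdonaldP q t ⟨n, l⟩) = 0 := fun l => by
    rw [form_sub_left, form_comm, h, form_comm, sub_self]
  have h2 : ∀ x ∈ Submodule.span ℝ (Set.range fun m : n.Partition => macdonaldP q t ⟨n, m⟩),
      formL q t (f - g) x = 0 := by
    intro x hx
    have : Submodule.span ℝ (Set.range fun m : n.Partition => macdonaldP q t ⟨n, m⟩) ≤
        LinearMap.ker (formL q t (f - g)) := by
      refine Submodule.span_le.2 ?_
      rintro _ ⟨l, rfl⟩
      exact h1 l
    exact this hx
  by_contra hne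
  refine (form_self_pos H.q_pos H.q_lt H.t_pos H.t_lt hne).ne' (h2 _ ?_)
  rw [eq_sum_mono hd]
  exact Submodule.sum_mem _ fun l _ => Submodule.smul_mem _ _ (mono_mem_span_macdonaldP q t l)

theorem eq_sum_macdonaldQ (H : Params q t) {n : ℕ} {f : SymFun} (hf : f ∈ gr n) :
    f = ∑ l : n.Partition, form q t (macdonaldP q t ⟨n, l⟩) f • macdonaldQ q t ⟨n, l⟩ := by
  classical
  refine eq_of_form_macdonaldP H hf (Submodule.sum_mem _ fun l _ =>
    Submodule.smul_mem _ _ (macdonaldQ_mem_gr q t ⟨n, l⟩)) fun l => ?_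
  rw [form_sum_right, Finset.sum_eq_single l]
  · rw [form_smul_right, form_macdonaldP_macdonaldQ H, if_pos rfl, mul_one]
  · intro m _ hm
    rw [form_smul_right, form_macdonaldP_macdonaldQ H, if_neg, mul_zero]
    intro h
    exact hm (by simpa using h.symm)
  · intro h
    exact absurd (Finset.mem_univ l) h

theorem linearIndependent_macdonaldP (H : Params q t) : LinearIndependent ℝ (macdonaldP q t) := by
  classical
  rw [linearIndependent_iff]
  intro c hc
  ext l
  have h := congrArg (form q t (macdonaldP q t l)) hc
  rw [Finsupp.linearCombination_apply, Finsupp.sum, form_sum_right, form_zero_right,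
    Finset.sum_eq_single l] at h
  · rw [form_smul_right] at h
    exact (mul_eq_zero.1 h).resolve_right (form_macdonaldP_self_pos H l).ne'
  · intro m _ hm
    rw [form_smul_right, form_macdonaldP_of_ne H hm.symm, mul_zero]
  · intro hl
    rw [Finsupp.notMem_support_iff.1 hl, zero_smul, form_zero_right]

theorem span_macdonaldP (q t : ℝ) : Submodule.span ℝ (Set.range (macdonaldP q t)) = ⊤ := by
  rw [eq_top_iff]
  rintro f -
  obtain ⟨d, hd⟩ := eq_sum_sum_mono f
  rw [hd]
  refine Submodule.sum_mem _ fun n _ => Submodule.sum_mem _ fun l _ => Submodule.smul_mem _ _ ?_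
  refine Submodule.span_mono ?_ (mono_mem_span_macdonaldP q t l)
  rintro _ ⟨m, rfl⟩
  exact ⟨_, rfl⟩

/-- The basis of Macdonald symmetric functions `P_l`. -/
def macdonaldPBasis (H : Params q t) : Module.Basis Part ℝ SymFun :=
  Module.Basis.mk (linearIndependent_macdonaldP H) (span_macdonaldP q t).ge

theorem coe_macdonaldPBasis (H : Params q t) : ⇑(macdonaldPBasis H) = macdonaldP q t := by
  simp [macdonaldPBasis]

/-- The basis of dual Macdonald symmetric functions `Q_l`. -/
def macdonaldQBasis (H : Params q t) : Module.Basis Part ℝ SymFun :=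
  (macdonaldPBasis H).isUnitSMul
    (w := fun l => (form q t (macdonaldP q t l) (macdonaldP q t l))⁻¹)
    fun l => (inv_ne_zero (form_macdonaldP_self_pos H l).ne').isUnit

theorem coe_macdonaldQBasis (H : Params q t) : ⇑(macdonaldQBasis H) = macdonaldQ q t := by
  ext1 l
  rw [macdonaldQBasis, Module.Basis.isUnitSMul_apply, coe_macdonaldPBasis]
  rfl

end PeriodicMacdonald

namespace PeriodicMacdonald

/-! ### Exponentials of power sums -/

/-- The number `z_s = ∏ i, m_i! * i ^ m_i`, where `m_i` is the multiplicity of `i` in `s`. -/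
def zStd (s : Multiset ℕ) : ℝ :=
  ∏ i ∈ s.toFinset, ((s.count i).factorial * i ^ s.count i : ℝ)

theorem zStd_eq_prod {s : Multiset ℕ} {T : Finset ℕ} (h : s.toFinset ⊆ T) :
    zStd s = ∏ i ∈ T, ((s.count i).factorial * i ^ s.count i : ℝ) := by
  refine Finset.prod_subset h fun i _ hi => ?_
  rw [Multiset.mem_toFinset] at hi
  simp [Multiset.count_eq_zero_of_notMem hi]

theorem zStd_cons (r : ℕ) (s : Multiset ℕ) :
    zStd (r ::ₘ s) = (r * (r ::ₘ s).count r) * zStd s := by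
  rw [zStd_eq_prod (T := insert r s.toFinset) (by simp),
    zStd_eq_prod (s := s) (Finset.subset_insert r s.toFinset),
    ← Finset.mul_prod_erase _ _ (Finset.mem_insert_self r s.toFinset),
    ← Finset.mul_prod_erase _ _ (Finset.mem_insert_self r s.toFinset)]
  have : ∏ x ∈ (insert r s.toFinset).erase r,
      (((r ::ₘ s).count x).factorial * (x : ℝ) ^ (r ::ₘ s).count x) =
      ∏ x ∈ (insert r s.toFinset).erase r, ((s.count x).factorial * (x : ℝ) ^ s.count x) :=
    Finset.prod_congr rfl fun x hx => by
      rw [Multiset.count_cons_of_ne (Finset.ne_of_mem_erase hx)]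
  rw [this, Multiset.count_cons_self, Nat.factorial_succ, pow_succ]
  push_cast
  ring

theorem zStd_ne_zero {s : Multiset ℕ} (hs : ∀ r ∈ s, 0 < r) : zStd s ≠ 0 := by
  refine Finset.prod_ne_zero_iff.2 fun i hi => ?_
  have := hs i (Multiset.mem_toFinset.1 hi)
  positivity

theorem prod_map_pow_eq {R : Type*} [CommMonoid R] (x : R) (s : Multiset ℕ) : (s.map (x ^ ·)).prod = x ^ s.sum := by
  induction s using Multiset.induction_on with
  | empty => simp
  | cons a s ih => rw [Multiset.map_cons, Multiset.prod_cons, ih, Multiset.sum_cons, pow_add]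

section

variable {R : Type*} [CommRing R] [Algebra ℝ R]

/-- The coefficient of `z ^ d` in `exp (∑ r ≥ 1, a r * z ^ r / r)`, written as a sum over the
partitions of `d`. The value `a 0` plays no role. -/
def hsum (a : ℕ → R) (d : ℕ) : R :=
  ∑ l : d.Partition, (zStd l.parts)⁻¹ • (l.parts.map a).prod

theorem hsum_congr {a b : ℕ → R} (h : ∀ r, r ≠ 0 → a r = b r) (d : ℕ) : hsum a d = hsum b d := by
  refine Finset.sum_congr rfl fun l _ => ?_
  rw [Multiset.map_congr rfl fun r hr => h r (l.parts_pos hr).ne']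

theorem map_hsum {S : Type*} [CommRing S] [Algebra ℝ S] (φ : R →ₐ[ℝ] S) (a : ℕ → R) (d : ℕ) :
    φ (hsum a d) = hsum (fun r => φ (a r)) d := by
  rw [hsum, map_sum]
  refine Finset.sum_congr rfl fun l _ => ?_
  rw [map_smul, map_multiset_prod, Multiset.map_map]
  rfl

theorem hsum_pow_mul (x : R) (a : ℕ → R) (d : ℕ) :
    hsum (fun r => x ^ r * a r) d = x ^ d * hsum a d := by
  rw [hsum, hsum, Finset.mul_sum]
  refine Finset.sum_congr rfl fun l _ => ?_
  rw [mul_smul_comm, Multiset.prod_map_mul, prod_map_pow_eq, l.parts_sum]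

theorem hsum_zero_right (a : ℕ → R) : hsum a 0 = 1 := by
  rw [hsum, Fintype.sum_eq_single (default : Nat.Partition 0) fun x hx =>
    absurd (Subsingleton.elim _ _) hx]
  simp [zStd]

open Finset in
/-- The recursion that says `z f' = (∑ r, a r * z ^ r) f` for the exponential series. -/
theorem succ_smul_hsum (a : ℕ → R) (n : ℕ) : ((n + 1 : ℕ) : ℝ) • hsum a (n + 1) =
    ∑ i ∈ range (n + 1), a (i + 1) * hsum a (n - i) := by
  classical
  let w : Multiset ℕ → R := fun s => (zStd s)⁻¹ • (s.map a).prod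
  let pt : ℕ → Finset (Multiset ℕ) := fun d => (univ : Finset d.Partition).image fun l => l.parts
  have mem_pt : ∀ d s, s ∈ pt d ↔ (∀ r ∈ s, 0 < r) ∧ s.sum = d := by
    intro d s
    simp only [pt, mem_image, mem_univ, true_and]
    constructor
    · rintro ⟨l, rfl⟩
      exact ⟨fun r hr => l.parts_pos hr, l.parts_sum⟩
    · rintro ⟨h1, h2⟩
      exact ⟨⟨s, fun {r} hr => h1 r hr, h2⟩, rfl⟩
  have hs : ∀ d, hsum a d = ∑ s ∈ pt d, w s := by
    intro d
    rw [sum_image]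
    · rfl
    · intro x _ y _ h
      exact Nat.Partition.ext h
  have h1 : ((n + 1 : ℕ) : ℝ) • hsum a (n + 1) =
      ∑ s ∈ pt (n + 1), ∑ r ∈ s.toFinset, ((r * s.count r : ℕ) : ℝ) • w s := by
    rw [hs, smul_sum]
    refine sum_congr rfl fun s hs => ?_
    rw [← sum_smul, ← Nat.cast_sum]
    congr 2
    rw [← ((mem_pt _ _).1 hs).2, sum_multiset_count]
    exact sum_congr rfl fun r _ => by rw [smul_eq_mul, mul_comm]
  rw [h1]
  simp_rw [hs, mul_sum]
  rw [sum_sigma', sum_sigma']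
  -- A partition with a distinguished part `r` corresponds to `r` and the partition without it.
  refine sum_bij' (fun x _ => ⟨x.2 - 1, x.1.erase x.2⟩) (fun y _ => ⟨(y.1 + 1) ::ₘ y.2, y.1 + 1⟩)
    ?_ ?_ ?_ ?_ ?_
  · rintro ⟨s, r⟩ h
    simp only [mem_sigma, mem_pt, Multiset.mem_toFinset, mem_range] at h ⊢
    obtain ⟨⟨h1, h2⟩, h3⟩ := h
    have h4 := h1 r h3
    have h5 : r + (s.erase r).sum = n + 1 := by rw [Multiset.sum_erase h3, h2]
    exact ⟨by omega, fun k hk => h1 k (Multiset.mem_of_mem_erase hk), by omega⟩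
  · rintro ⟨i, s⟩ h
    simp only [mem_sigma, mem_pt, Multiset.mem_toFinset, mem_range] at h ⊢
    obtain ⟨h1, h2, h3⟩ := h
    refine ⟨⟨fun k hk => ?_, ?_⟩, by simp⟩
    · rcases Multiset.mem_cons.1 hk with rfl | hk
      · omega
      · exact h2 k hk
    · rw [Multiset.sum_cons, h3]
      omega
  · rintro ⟨s, r⟩ h
    simp only [mem_sigma, mem_pt, Multiset.mem_toFinset] at h
    have h4 : r - 1 + 1 = r := by have := h.1.1 r h.2; omega
    simp only [h4, Multiset.cons_erase h.2]
  · rintro ⟨i, s⟩ _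
    simp
  · rintro ⟨s, r⟩ h
    simp only [mem_sigma, mem_pt, Multiset.mem_toFinset] at h
    have h4 : r - 1 + 1 = r := by have := h.1.1 r h.2; omega
    obtain ⟨s', hs'⟩ := Multiset.exists_cons_of_mem h.2
    have hz : zStd s ≠ 0 := zStd_ne_zero h.1.1
    have hc := zStd_cons r s'
    simp only [h4, w]
    rw [hs', Multiset.erase_cons_head, Multiset.map_cons, Multiset.prod_cons, smul_smul,
      mul_smul_comm]
    congr 1
    rw [hs'] at hz
    rw [hc] at hz ⊢
    push_cast
    have h5 := left_ne_zero_of_mul hz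
    have h6 := right_ne_zero_of_mul hz
    rw [mul_inv, ← mul_assoc, mul_inv_cancel₀ h5, one_mul]

/-- The series `exp (∑ r ≥ 1, a r * z ^ r / r)`. -/
def hser (a : ℕ → R) : PowerSeries R := PowerSeries.mk (hsum a)

theorem coeff_hser (a : ℕ → R) (d : ℕ) : PowerSeries.coeff d (hser a) = hsum a d :=
  PowerSeries.coeff_mk _ _

theorem derivative_hser (a : ℕ → R) : PowerSeries.derivative R (hser a) =
    PowerSeries.mk (fun i => a (i + 1)) * hser a := by
  ext n
  rw [PowerSeries.coeff_derivative, coeff_hser, PowerSeries.coeff_mul,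
    Finset.Nat.sum_antidiagonal_eq_sum_range_succ_mk]
  simp only [PowerSeries.coeff_mk, coeff_hser]
  rw [← succ_smul_hsum, Algebra.smul_def, mul_comm]
  simp

theorem powerSeries_eq_of_derivative {α F G : PowerSeries R}
    (hF : PowerSeries.derivative R F = α * F) (hG : PowerSeries.derivative R G = α * G)
    (h0 : PowerSeries.coeff 0 F = PowerSeries.coeff 0 G) : F = G := by
  ext n
  induction n using Nat.strong_induction_on with
  | _ n ih =>
  rcases n with _ | n
  · exact h0
  have h1 := congrArg (PowerSeries.coeff n) hF
  have h2 := congrArg (PowerSeries.coeff n) hG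
  rw [PowerSeries.coeff_derivative, PowerSeries.coeff_mul] at h1 h2
  have h3 : PowerSeries.coeff (n + 1) F * (n + 1) = PowerSeries.coeff (n + 1) G * (n + 1) := by
    rw [h1, h2]
    refine Finset.sum_congr rfl fun p hp => ?_
    rw [Finset.HasAntidiagonal.mem_antidiagonal] at hp
    rw [ih p.2 (by omega)]
  have h4 : (n + 1 : R) = algebraMap ℝ R (n + 1) := by simp
  have h5 : IsUnit (n + 1 : R) := by
    rw [h4]
    exact (IsUnit.mk0 (n + 1 : ℝ) (by positivity)).map _
  exact h5.mul_right_cancel h3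

theorem hser_add (a b : ℕ → R) : hser (fun r => a r + b r) = hser a * hser b := by
  refine powerSeries_eq_of_derivative (derivative_hser _) ?_ ?_
  · rw [Derivation.leibniz, derivative_hser, derivative_hser, smul_eq_mul, smul_eq_mul]
    have : PowerSeries.mk (fun i => a (i + 1) + b (i + 1)) =
      PowerSeries.mk (fun i => a (i + 1)) + PowerSeries.mk (fun i => b (i + 1)) := rfl
    rw [this]
    ring
  · simp [hser, hsum_zero_right]

open Finset in
theorem hsum_add (a b : ℕ → R) (d : ℕ) :
    hsum (fun r => a r + b r) d = ∑ p ∈ antidiagonal d, hsum a p.1 * hsum b p.2 := by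
  rw [← coeff_hser, hser_add, PowerSeries.coeff_mul]
  simp only [coeff_hser]

theorem hser_neg_one : hser (fun _ => (-1 : R)) = 1 - PowerSeries.X := by
  refine powerSeries_eq_of_derivative (derivative_hser _) ?_ ?_
  · have h : PowerSeries.mk (fun _ => (-1 : R)) = - PowerSeries.mk (fun _ => (1 : R)) := by
      ext n
      simp
    rw [h, neg_mul, ← Pi.one_def, PowerSeries.mk_one_mul_one_sub_eq_one, map_sub]
    simp [PowerSeries.derivative_X]
  · simp [hser, hsum_zero_right]

theorem hsum_zero_left (d : ℕ) : hsum (fun _ => (0 : R)) d = if d = 0 then 1 else 0 := by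
  have h : hser (fun _ => (0 : R)) = 1 := by
    refine powerSeries_eq_of_derivative (derivative_hser _) ?_ ?_
    · have : PowerSeries.mk (fun _ => (0 : R)) = 0 := by ext n; simp
      rw [this, zero_mul]
      simp
    · simp [hser, hsum_zero_right]
  rw [← coeff_hser, h, PowerSeries.coeff_one]

end

end PeriodicMacdonald

namespace PeriodicMacdonald

/-! ### The kernel as an exponential -/

/-- The degree of a monomial in the first alphabet. -/
def xdeg : ((ℕ ⊕ ℕ) →₀ ℕ) →+ ℕ := Finsupp.weight (Sum.elim (fun _ => 1) fun _ => 0)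

theorem xdeg_single_inl (i r : ℕ) : xdeg (Finsupp.single (Sum.inl i) r) = r := by
  simp [xdeg, Finsupp.weight_apply]

theorem xdeg_single_inr (i r : ℕ) : xdeg (Finsupp.single (Sum.inr i) r) = 0 := by
  simp [xdeg, Finsupp.weight_apply]

theorem xdeg_sumElim (a b : ℕ →₀ ℕ) : xdeg (a.sumElim b) = a.degree := by
  have h : ∀ a : ℕ →₀ ℕ, xdeg (a.sumElim 0) = a.degree := by
    intro a
    induction a using Finsupp.induction_linear with
    | zero => simp
    | add f g hf hg =>
      rw [map_add, ← hf, ← hg, ← map_add, ← Finsupp.sumElim_add, add_zero]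
    | single i r => rw [Finsupp.sumElim_single_zero, xdeg_single_inl, Finsupp.degree_single]
  have h' : ∀ b : ℕ →₀ ℕ, xdeg ((0 : ℕ →₀ ℕ).sumElim b) = 0 := by
    intro b
    induction b using Finsupp.induction_linear with
    | zero => simp
    | add f g hf hg =>
      have : (0 : ℕ →₀ ℕ).sumElim (f + g) =
          (0 : ℕ →₀ ℕ).sumElim f + (0 : ℕ →₀ ℕ).sumElim g := by
        rw [← Finsupp.sumElim_add, add_zero]
      rw [this, map_add, hf, hg]
    | single i r => rw [Finsupp.sumElim_zero_single, xdeg_single_inr]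
  have : a.sumElim b = a.sumElim 0 + (0 : ℕ →₀ ℕ).sumElim b := by
    rw [← Finsupp.sumElim_add, add_zero, zero_add]
  rw [this, map_add, h, h', add_zero]

/-- `F` is homogeneous of degree `k` in the first alphabet. -/
def XHom (k : ℕ) (F : Series2) : Prop := ∀ e, xdeg e ≠ k → MvPowerSeries.coeff e F = 0

theorem XHom.mul {k l : ℕ} {F G : Series2} (hF : XHom k F) (hG : XHom l G) :
    XHom (k + l) (F * G) := by
  classical
  intro e he
  rw [MvPowerSeries.coeff_mul]
  refine Finset.sum_eq_zero fun p hp => ?_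
  rw [Finset.HasAntidiagonal.mem_antidiagonal] at hp
  by_cases h1 : xdeg p.1 = k
  · rw [hG p.2, mul_zero]
    rintro rfl
    exact he (by rw [← hp, map_add, h1])
  · rw [hF _ h1, zero_mul]

theorem XHom.smul {k : ℕ} {F : Series2} (hF : XHom k F) (c : ℝ) : XHom k (c • F) := fun e he => by
  rw [map_smul, hF e he, smul_zero]

theorem XHom.one : XHom 0 1 := by
  classical
  intro e he
  rw [MvPowerSeries.coeff_one, if_neg]
  rintro rfl
  simp at he

theorem XHom.sum {k : ℕ} {ι : Type*} (s : Finset ι) {F : ι → Series2}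
    (hF : ∀ i ∈ s, XHom k (F i)) : XHom k (∑ i ∈ s, F i) := fun e he => by
  rw [map_sum]
  exact Finset.sum_eq_zero fun i hi => hF i hi e he

theorem XHom.pow {k : ℕ} {F : Series2} (hF : XHom k F) (r : ℕ) : XHom (r * k) (F ^ r) := by
  induction r with
  | zero => simpa using XHom.one
  | succ r ih => rw [pow_succ, add_mul, one_mul]; exact ih.mul hF

/-- A sequence whose term of index `r ≥ 1` is homogeneous of degree `r` in the first alphabet. -/
def XSeq (a : ℕ → Series2) : Prop := ∀ r, r ≠ 0 → XHom r (a r)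

theorem XSeq.hsum {a : ℕ → Series2} (ha : XSeq a) (d : ℕ) : XHom d (hsum a d) := by
  refine XHom.sum _ fun l _ => XHom.smul ?_ _
  have h : ∀ s : Multiset ℕ, (∀ r ∈ s, r ≠ 0) → XHom s.sum (s.map a).prod := by
    intro s hs
    induction s using Multiset.induction_on with
    | empty => simpa using XHom.one
    | cons r s ih =>
      rw [Multiset.map_cons, Multiset.prod_cons, Multiset.sum_cons]
      exact (ha r (hs r (by simp))).mul (ih fun k hk => hs k (by simp [hk]))
  have := h l.parts fun r hr => (l.parts_pos hr).ne'
  rwa [l.parts_sum] at this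

/-- The series `exp (∑ r ≥ 1, a r / r)` for a sequence `a` whose term `a r` is homogeneous of degree
`r` in the first alphabet. -/
def expSeries (a : ℕ → Series2) : Series2 := fun e => MvPowerSeries.coeff e (hsum a (xdeg e))

theorem coeff_expSeries (a : ℕ → Series2) (e : (ℕ ⊕ ℕ) →₀ ℕ) :
    MvPowerSeries.coeff e (expSeries a) = MvPowerSeries.coeff e (hsum a (xdeg e)) := rfl

theorem expSeries_congr {a b : ℕ → Series2} (h : ∀ r, r ≠ 0 → a r = b r) :
    expSeries a = expSeries b := by
  ext e
  rw [coeff_expSeries, coeff_expSeries, hsum_congr h]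

theorem expSeries_zero : expSeries (fun _ => 0) = 1 := by
  classical
  ext e
  rw [coeff_expSeries, hsum_zero_left]
  split_ifs with h
  · rfl
  · rw [map_zero, MvPowerSeries.coeff_one, if_neg]
    rintro rfl
    simp at h

theorem expSeries_add {a : ℕ → Series2} (ha : XSeq a) (b : ℕ → Series2) :
    expSeries (fun r => a r + b r) = expSeries a * expSeries b := by
  classical
  ext e
  rw [coeff_expSeries, hsum_add, MvPowerSeries.coeff_mul, map_sum]
  simp_rw [MvPowerSeries.coeff_mul]
  rw [Finset.sum_comm]
  refine Finset.sum_congr rfl fun p hp => ?_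
  rw [Finset.HasAntidiagonal.mem_antidiagonal] at hp
  rw [Finset.sum_eq_single (xdeg p.1, xdeg p.2)]
  · rfl
  · rintro ⟨i, j⟩ hij hne
    rw [Finset.HasAntidiagonal.mem_antidiagonal] at hij
    rw [ha.hsum i p.1, zero_mul]
    rintro rfl
    refine hne (Prod.ext rfl ?_)
    rw [← hp, map_add] at hij
    exact Nat.add_left_cancel hij
  · intro h
    refine absurd ?_ h
    rw [Finset.HasAntidiagonal.mem_antidiagonal, ← map_add, hp]

theorem expSeries_sum {ι : Type*} (s : Finset ι) {a : ι → ℕ → Series2} (ha : ∀ i, XSeq (a i)) :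
    expSeries (fun r => ∑ i ∈ s, a i r) = ∏ i ∈ s, expSeries (a i) := by
  classical
  induction s using Finset.induction_on with
  | empty => simpa using expSeries_zero
  | insert i s hi ih =>
    rw [Finset.prod_insert hi, ← ih, ← expSeries_add (ha i)]
    simp_rw [Finset.sum_insert hi]

theorem tendsto_expSeries {ι : Type*} {L : Filter ι} {a : ι → ℕ → Series2} {A : ℕ → Series2}
    (h : ∀ r, r ≠ 0 → Filter.Tendsto (fun i => a i r) L (nhds (A r))) :
    Filter.Tendsto (fun i => expSeries (a i)) L (nhds (expSeries A)) := by
  rw [MvPowerSeries.WithPiTopology.tendsto_iff_coeff_tendsto]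
  intro e
  simp_rw [coeff_expSeries]
  refine ((MvPowerSeries.WithPiTopology.continuous_coeff ℝ e).tendsto _).comp ?_
  refine tendsto_finsetSum _ fun l _ => ?_
  simp_rw [Algebra.smul_def]
  refine tendsto_const_nhds.mul ?_
  have h' : ∀ s : Multiset ℕ, (∀ r ∈ s, r ≠ 0) → Filter.Tendsto (fun i => (s.map (a i)).prod) L
      (nhds (s.map A).prod) := by
    intro s hs
    induction s using Multiset.induction_on with
    | empty => simpa using tendsto_const_nhds
    | cons r s ih =>
      simp only [Multiset.map_cons, Multiset.prod_cons]
      exact (h r (hs r (by simp))).mul (ih fun k hk => hs k (by simp [hk]))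
  exact h' l.parts fun r hr => (l.parts_pos hr).ne'

/-- The exponential turns sums that converge coefficientwise into products. -/
theorem hasProd_expSeries {ι : Type*} {a : ι → ℕ → Series2} {A : ℕ → Series2}
    (ha : ∀ i, XSeq (a i)) (h : ∀ r, r ≠ 0 → HasSum (fun i => a i r) (A r)) :
    HasProd (fun i => expSeries (a i)) (expSeries A) := by
  rw [HasProd]
  simp_rw [← expSeries_sum _ ha]
  exact tendsto_expSeries fun r hr => h r hr

theorem one_sub_smul_eq_expSeries {M : Series2} (hM : XHom 1 M) (w : ℝ) :
    1 - w • M = expSeries fun r => -(w ^ r) • M ^ r := by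
  have h1 : (fun r => -(w ^ r) • M ^ r) = fun r => (w • M) ^ r * (-1) := by
    ext1 r
    rw [smul_pow, mul_neg_one, neg_smul]
  have h0 := hM.smul w
  rw [h1]
  ext e
  rw [coeff_expSeries, hsum_pow_mul, ← coeff_hser, hser_neg_one, map_sub, map_sub,
    PowerSeries.coeff_one, PowerSeries.coeff_X]
  rcases Nat.lt_trichotomy (xdeg e) 1 with h | h | h
  · have h2 : xdeg e = 0 := by omega
    rw [h0 e (by omega), h2]
    simp
  · rw [XHom.one e (by omega), h]
    simp
  · rw [h0 e (by omega), XHom.one e (by omega), if_neg (by omega), if_neg (by omega)]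
    simp

theorem hasSum_geometric_two {p : Fin 2 → ℝ} (h0 : ∀ i, 0 ≤ p i) (h1 : ∀ i, p i < 1) {r : ℕ}
    (hr : r ≠ 0) : HasSum (fun k : Fin 2 → ℕ => (∏ i, p i ^ k i) ^ r)
      ((1 - p 0 ^ r) * (1 - p 1 ^ r))⁻¹ := by
  have hg : ∀ i, HasSum (fun n : ℕ => (p i ^ r) ^ n) (1 - p i ^ r)⁻¹ := fun i =>
    hasSum_geometric_of_lt_one (pow_nonneg (h0 i) r) (pow_lt_one₀ (h0 i) (h1 i) hr)
  have h2 := (hg 0).mul (hg 1) ((hg 0).summable.mul_of_nonneg (hg 1).summable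
    (fun n => pow_nonneg (pow_nonneg (h0 0) r) n) fun n => pow_nonneg (pow_nonneg (h0 1) r) n)
  rw [mul_inv, ← (finTwoArrowEquiv ℕ).symm.hasSum_iff]
  refine h2.congr_fun ?_
  rintro ⟨a, b⟩
  simp [Fin.prod_univ_two, mul_pow, ← pow_mul, mul_comm]

theorem hasSum_smul_series {ι : Type*} {f : ι → ℝ} {c : ℝ} (h : HasSum f c) (F : Series2) :
    HasSum (fun i => f i • F) (c • F) := by
  rw [MvPowerSeries.WithPiTopology.hasSum_iff_hasSum_coeff]
  intro e
  simpa using h.mul_right (MvPowerSeries.coeff e F)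

theorem qPoch_eq_expSeries {p : Fin 2 → ℝ} (h0 : ∀ i, 0 ≤ p i) (h1 : ∀ i, p i < 1) {M : Series2}
    (hM : XHom 1 M) (s : ℝ) : qPoch (s • M) p =
      expSeries fun r => (-(s ^ r * ((1 - p 0 ^ r) * (1 - p 1 ^ r))⁻¹)) • M ^ r := by
  have h : HasProd (fun k : Fin 2 → ℕ => 1 - (∏ i, p i ^ k i) • (s • M))
      (expSeries fun r => (-(s ^ r * ((1 - p 0 ^ r) * (1 - p 1 ^ r))⁻¹)) • M ^ r) := by
    have h2 : (fun k : Fin 2 → ℕ => 1 - (∏ i, p i ^ k i) • (s • M)) =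
        fun k => expSeries fun r => -(((∏ i, p i ^ k i) * s) ^ r) • M ^ r := by
      ext1 k
      rw [smul_smul, one_sub_smul_eq_expSeries hM]
    rw [h2]
    refine hasProd_expSeries (fun k r _ => ?_) fun r hr => ?_
    · have := hM.pow r
      rw [mul_one] at this
      exact this.smul _
    · refine hasSum_smul_series ?_ _
      have := ((hasSum_geometric_two h0 h1 hr).mul_left (s ^ r)).neg
      refine this.congr_fun fun k => ?_
      rw [mul_pow, mul_comm]
  exact h.tprod_eq

/-- The coefficients `c_r` in `log (t z; q, u)_∞ / (z; q, u)_∞ = ∑ c_r z ^ r / r`. -/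
def kerCoeff (q t u : ℝ) (r : ℕ) : ℝ := (1 - t ^ r) / ((1 - q ^ r) * (1 - u ^ r))

theorem inv_expSeries {a : ℕ → Series2} (ha : XSeq a) :
    (expSeries a)⁻¹ = expSeries fun r => -a r := by
  have h : expSeries a * expSeries (fun r => -a r) = 1 := by
    rw [← expSeries_add ha]
    simpa using expSeries_zero
  have hc : MvPowerSeries.constantCoeff (expSeries a) ≠ 0 := fun h0 => by
    have := congrArg MvPowerSeries.constantCoeff h
    rw [map_mul, h0, zero_mul, map_one] at this
    exact zero_ne_one this
  exact (MvPowerSeries.inv_eq_iff_mul_eq_one hc).2 (by rw [mul_comm, h])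

theorem coeff_inX (f : SymFun) (a b : ℕ →₀ ℕ) :
    MvPowerSeries.coeff (a.sumElim b) (inX f) = if b = 0 then symCoeff a f else 0 := by
  split_ifs with h
  · subst h
    have h1 : a.sumElim 0 = a.embDomain (Function.Embedding.inl : ℕ ↪ ℕ ⊕ ℕ) := by
      ext (i | i)
      · exact (Finsupp.embDomain_apply_self (Function.Embedding.inl : ℕ ↪ ℕ ⊕ ℕ) a i).symm
      · rw [Finsupp.sumElim_inr, Finsupp.embDomain_of_notMem_range]
        · rfl
        · simp
    rw [h1]
    exact MvPowerSeries.coeff_embDomain_rename _ f.1 a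
  · refine MvPowerSeries.coeff_rename_eq_zero _ _ ?_
    rintro ⟨c, hc⟩
    refine h (Finsupp.ext fun i => ?_)
    have := DFunLike.congr_fun hc (Sum.inr i)
    rw [Finsupp.sumElim_inr, Finsupp.mapDomain_of_notMem_range] at this
    · exact this.symm
    · simp

theorem coeff_inY (f : SymFun) (a b : ℕ →₀ ℕ) :
    MvPowerSeries.coeff (a.sumElim b) (inY f) = if a = 0 then symCoeff b f else 0 := by
  split_ifs with h
  · subst h
    have h1 : (0 : ℕ →₀ ℕ).sumElim b = b.embDomain (Function.Embedding.inr : ℕ ↪ ℕ ⊕ ℕ) := by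
      ext (i | i)
      · rw [Finsupp.sumElim_inl, Finsupp.embDomain_of_notMem_range]
        · rfl
        · simp
      · exact (Finsupp.embDomain_apply_self (Function.Embedding.inr : ℕ ↪ ℕ ⊕ ℕ) b i).symm
    rw [h1]
    exact MvPowerSeries.coeff_embDomain_rename _ f.1 b
  · refine MvPowerSeries.coeff_rename_eq_zero _ _ ?_
    rintro ⟨c, hc⟩
    refine h (Finsupp.ext fun i => ?_)
    have := DFunLike.congr_fun hc (Sum.inl i)
    rw [Finsupp.sumElim_inl, Finsupp.mapDomain_of_notMem_range] at this
    · exact this.symm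
    · simp

theorem exists_sumElim (e : (ℕ ⊕ ℕ) →₀ ℕ) : ∃ a b : ℕ →₀ ℕ, e = a.sumElim b :=
  ⟨_, _, (Finsupp.comapDomain_sumElim_comapDomain e).symm⟩

theorem sumElim_inj {a b a' b' : ℕ →₀ ℕ} (h : a.sumElim b = a'.sumElim b') : a = a' ∧ b = b' := by
  refine ⟨Finsupp.ext fun i => ?_, Finsupp.ext fun i => ?_⟩
  · simpa using DFunLike.congr_fun h (Sum.inl i)
  · simpa using DFunLike.congr_fun h (Sum.inr i)

theorem coeff_inX_mul_inY (f g : SymFun) (a b : ℕ →₀ ℕ) :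
    MvPowerSeries.coeff (a.sumElim b) (inX f * inY g) = symCoeff a f * symCoeff b g := by
  classical
  rw [MvPowerSeries.coeff_mul, Finset.sum_eq_single (a.sumElim 0, (0 : ℕ →₀ ℕ).sumElim b)]
  · rw [coeff_inX, coeff_inY, if_pos rfl, if_pos rfl]
  · rintro ⟨p1, p2⟩ hp hne
    obtain ⟨a1, b1, rfl⟩ := exists_sumElim p1
    obtain ⟨a2, b2, rfl⟩ := exists_sumElim p2
    rw [Finset.HasAntidiagonal.mem_antidiagonal, ← Finsupp.sumElim_add] at hp
    obtain ⟨h1, h2⟩ := sumElim_inj hp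
    rw [coeff_inX, coeff_inY]
    split_ifs with h3 h4
    · subst h3 h4
      rw [add_zero] at h1
      rw [zero_add] at h2
      exact absurd (by rw [h1, h2]) hne
    all_goals simp
  · intro h
    refine absurd ?_ h
    rw [Finset.HasAntidiagonal.mem_antidiagonal, ← Finsupp.sumElim_add, add_zero, zero_add]

/-- The embedding `f ↦ f(X)` as an algebra homomorphism. -/
def inXHom : SymFun →ₐ[ℝ] Series2 :=
  (MvPowerSeries.rename (Function.Embedding.inl : ℕ ↪ ℕ ⊕ ℕ)).comp SymFun.val

/-- The embedding `f ↦ f(Y)` as an algebra homomorphism. -/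
def inYHom : SymFun →ₐ[ℝ] Series2 :=
  (MvPowerSeries.rename (Function.Embedding.inr : ℕ ↪ ℕ ⊕ ℕ)).comp SymFun.val

theorem inXHom_apply (f : SymFun) : inXHom f = inX f := rfl

theorem inYHom_apply (f : SymFun) : inYHom f = inY f := rfl

theorem xHom_inX_mul_inY (r : ℕ) : XHom r (inX (psum r) * inY (psum r)) := by
  intro e he
  obtain ⟨a, b, rfl⟩ := exists_sumElim e
  rw [xdeg_sumElim] at he
  rw [coeff_inX_mul_inY, psum_mem_gr r a (by exact_mod_cast he), zero_mul]

theorem xSeq_diag (c : ℕ → ℝ) : XSeq fun r => c r • (inX (psum r) * inY (psum r)) :=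
  fun r _ => (xHom_inX_mul_inY r).smul _

theorem X_inl_mul_X_inr_pow (i j r : ℕ) :
    ((MvPowerSeries.X (Sum.inl i) * MvPowerSeries.X (Sum.inr j) : Series2)) ^ r =
      MvPowerSeries.monomial ((Finsupp.single i r).sumElim (Finsupp.single j r)) 1 := by
  rw [mul_pow, MvPowerSeries.X_pow_eq, MvPowerSeries.X_pow_eq, MvPowerSeries.monomial_mul_monomial,
    one_mul, Finsupp.sumElim_single_single]

theorem xHom_X_mul_X (i j : ℕ) :
    XHom 1 (MvPowerSeries.X (Sum.inl i) * MvPowerSeries.X (Sum.inr j) : Series2) := by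
  classical
  intro e he
  rw [← pow_one (_ * _), X_inl_mul_X_inr_pow, MvPowerSeries.coeff_monomial, if_neg]
  rintro rfl
  rw [xdeg_sumElim, Finsupp.degree_single] at he
  exact he rfl

/-- `p_r(X) p_r(Y)` is the power sum `p_r` of the products `x_i y_j`. -/
theorem hasSum_psum_mul_psum {r : ℕ} (hr : r ≠ 0) : HasSum (fun ij : ℕ × ℕ =>
    (MvPowerSeries.X (Sum.inl ij.1) * MvPowerSeries.X (Sum.inr ij.2) : Series2) ^ r)
      (inX (psum r) * inY (psum r)) := by
  classical
  rw [MvPowerSeries.WithPiTopology.hasSum_iff_hasSum_coeff]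
  intro e
  obtain ⟨a, b, rfl⟩ := exists_sumElim e
  rw [coeff_inX_mul_inY]
  simp_rw [X_inl_mul_X_inr_pow, MvPowerSeries.coeff_monomial]
  by_cases h : symCoeff a (psum r) * symCoeff b (psum r) = 0
  · rw [h]
    convert hasSum_zero using 1
    ext1 ij
    rw [if_neg]
    intro h'
    obtain ⟨rfl, rfl⟩ := sumElim_inj h'
    rw [symCoeff_psum_single _ hr, symCoeff_psum_single _ hr, mul_one] at h
    exact one_ne_zero h
  · obtain ⟨i, rfl⟩ := symCoeff_psum a (left_ne_zero_of_mul h)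
    obtain ⟨j, rfl⟩ := symCoeff_psum b (right_ne_zero_of_mul h)
    rw [symCoeff_psum_single _ hr, symCoeff_psum_single _ hr, mul_one]
    have h1 := hasSum_single (f := fun ij : ℕ × ℕ =>
      if (Finsupp.single i r).sumElim (Finsupp.single j r) =
        (Finsupp.single ij.1 r).sumElim (Finsupp.single ij.2 r) then (1 : ℝ) else 0) (i, j) ?_
    · simpa using h1
    · rintro ⟨i', j'⟩ hne
      refine if_neg fun h' => hne ?_
      obtain ⟨h2, h3⟩ := sumElim_inj h'
      rw [Finsupp.single_left_inj hr] at h2 h3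
      rw [h2, h3]

/-- Each factor `(t x y; q, u)_∞ / (x y; q, u)_∞` is an exponential in the powers `(x y) ^ r`, and
the exponents add up over all pairs of variables. -/
theorem kernel_eq_expSeries {q t u : ℝ} (H : Params q t) (hu0 : 0 ≤ u) (hu1 : u < 1) :
    kernel q t u = expSeries fun r => kerCoeff q t u r • (inX (psum r) * inY (psum r)) := by
  have h0 : ∀ i, 0 ≤ (![q, u] : Fin 2 → ℝ) i := Fin.forall_fin_two.2 ⟨H.q_pos.le, hu0⟩
  have h1 : ∀ i, (![q, u] : Fin 2 → ℝ) i < 1 := Fin.forall_fin_two.2 ⟨H.q_lt, hu1⟩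
  have hpow : ∀ (i j r : ℕ), XHom r
      ((MvPowerSeries.X (Sum.inl i) * MvPowerSeries.X (Sum.inr j) : Series2) ^ r) := by
    intro i j r
    simpa using (xHom_X_mul_X i j).pow r
  have h2 : ∀ ij : ℕ × ℕ,
      qPoch (t • (MvPowerSeries.X (Sum.inl ij.1) * MvPowerSeries.X (Sum.inr ij.2) : Series2)) ![q, u] *
      (qPoch (MvPowerSeries.X (Sum.inl ij.1) * MvPowerSeries.X (Sum.inr ij.2) : Series2) ![q, u])⁻¹ =
      expSeries fun r => kerCoeff q t u r •
        (MvPowerSeries.X (Sum.inl ij.1) * MvPowerSeries.X (Sum.inr ij.2) : Series2) ^ r := by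
    intro ij
    have hM := xHom_X_mul_X ij.1 ij.2
    have h3 := qPoch_eq_expSeries h0 h1 hM 1
    rw [one_smul] at h3
    rw [qPoch_eq_expSeries h0 h1 hM, h3, inv_expSeries fun r _ => (hpow _ _ r).smul _,
      ← expSeries_add fun r _ => (hpow _ _ r).smul _]
    refine expSeries_congr fun r _ => ?_
    rw [← neg_smul, ← add_smul, kerCoeff]
    congr 1
    change -(t ^ r * ((1 - q ^ r) * (1 - u ^ r))⁻¹) + -(-(1 ^ r * ((1 - q ^ r) * (1 - u ^ r))⁻¹)) = _
    rw [div_eq_mul_inv, one_pow]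
    ring
  rw [kernel]
  simp_rw [h2]
  refine (hasProd_expSeries (fun ij r _ => (hpow _ _ r).smul _) fun r hr => ?_).tprod_eq
  exact (hasSum_psum_mul_psum hr).const_smul _

theorem pairKernel_quotient_eq_expSeries {q t u : ℝ} (H : Params q t) (hu0 : 0 ≤ u) (hu1 : u < 1) :
    kernel q t u * (kernel q t 0)⁻¹ =
      expSeries fun r => (u ^ r * kerCoeff q t u r) • (inX (psum r) * inY (psum r)) := by
  rw [kernel_eq_expSeries H hu0 hu1, kernel_eq_expSeries H le_rfl one_pos,
    inv_expSeries (xSeq_diag _), ← expSeries_add (xSeq_diag _)]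
  refine expSeries_congr fun r hr => ?_
  rw [← neg_smul, ← add_smul]
  congr 1
  have h1 : 1 - q ^ r ≠ 0 := (sub_pos.2 (pow_lt_one₀ H.q_pos.le H.q_lt hr)).ne'
  have h2 : 1 - u ^ r ≠ 0 := (sub_pos.2 (pow_lt_one₀ hu0 hu1 hr)).ne'
  rw [kerCoeff, kerCoeff, zero_pow hr]
  field_simp
  ring

theorem sum_symCoeff_mul {n : ℕ} {f : SymFun} (hf : f ∈ gr n) (θ : Specialization) :
    ∑ l : n.Partition, symCoeff (expo l) f * θ (mono ⟨n, l⟩) = θ f := by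
  conv_rhs => rw [eq_sum_mono hf, map_sum]
  exact Finset.sum_congr rfl fun l _ => by rw [map_smul, smul_eq_mul]

/-- Specializing an exponential of products `p_r(X) p_r(Y)` gives, in bidegree `(d, d)`, the
coefficient of degree `d` of a scalar exponential, and zero off the diagonal. -/
theorem specComponent_expSeries (c : ℕ → ℝ) (θ η : Specialization) (d : ℕ × ℕ) :
    specComponent (expSeries fun r => c r • (inX (psum r) * inY (psum r))) θ η d =
      if d.1 = d.2 then hsum (fun r => c r * (θ (psum r) * η (psum r))) d.1 else 0 := by
  obtain ⟨d1, d2⟩ := d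
  have h1 : ∀ (l : d1.Partition) (m : d2.Partition), MvPowerSeries.coeff ((expo l).sumElim (expo m))
      (expSeries fun r => c r • (inX (psum r) * inY (psum r))) =
      ∑ n : d1.Partition, (zStd n.parts)⁻¹ * (n.parts.map c).prod *
        (symCoeff (expo l) (psumPart ⟨d1, n⟩) * symCoeff (expo m) (psumPart ⟨d1, n⟩)) := by
    intro l m
    rw [coeff_expSeries, xdeg_sumElim, degree_expo, hsum, map_sum]
    refine Finset.sum_congr rfl fun n _ => ?_
    have h2 : (n.parts.map fun r => c r • (inX (psum r) * inY (psum r))).prod =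
        (n.parts.map c).prod • (inX (psumPart ⟨d1, n⟩) * inY (psumPart ⟨d1, n⟩)) := by
      simp_rw [Algebra.smul_def]
      rw [Multiset.prod_map_mul, Multiset.prod_map_mul, ← inXHom_apply, ← inYHom_apply, psumPart,
        map_multiset_prod, map_multiset_prod, map_multiset_prod, Multiset.map_map, Multiset.map_map,
        Multiset.map_map]
      rfl
    rw [h2, map_smul, map_smul, coeff_inX_mul_inY, smul_eq_mul, smul_eq_mul, mul_assoc]
  have h3 : specComponent (expSeries fun r => c r • (inX (psum r) * inY (psum r))) θ η (d1, d2) =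
      ∑ n : d1.Partition, (zStd n.parts)⁻¹ * (n.parts.map c).prod *
        ((∑ l : d1.Partition, symCoeff (expo l) (psumPart ⟨d1, n⟩) * θ (mono ⟨d1, l⟩)) *
        ∑ m : d2.Partition, symCoeff (expo m) (psumPart ⟨d1, n⟩) * η (mono ⟨d2, m⟩)) := by
    rw [specComponent]
    simp_rw [h1, Finset.sum_mul_sum, Finset.mul_sum, Finset.sum_mul]
    rw [Finset.sum_comm]
    refine (Finset.sum_congr rfl fun m _ => Finset.sum_comm).trans ?_
    rw [Finset.sum_comm]
    refine Finset.sum_congr rfl fun n _ => ?_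
    rw [Finset.sum_comm]
    refine Finset.sum_congr rfl fun l _ => Finset.sum_congr rfl fun m _ => ?_
    ring
  rw [h3]
  dsimp only
  split_ifs with h
  · subst h
    rw [hsum]
    refine Finset.sum_congr rfl fun n _ => ?_
    rw [sum_symCoeff_mul (psumPart_mem_gr ⟨d1, n⟩), sum_symCoeff_mul (psumPart_mem_gr ⟨d1, n⟩),
      Multiset.prod_map_mul, Multiset.prod_map_mul, psumPart, map_multiset_prod, map_multiset_prod,
      Multiset.map_map, Multiset.map_map, smul_eq_mul, mul_assoc]
    rfl
  · refine Finset.sum_eq_zero fun n _ => ?_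
    rw [Finset.sum_eq_zero (s := (Finset.univ : Finset d2.Partition)), mul_zero, mul_zero]
    intro m _
    rw [psumPart_mem_gr ⟨d1, n⟩ (expo m) (by rw [degree_expo]; exact_mod_cast Ne.symm h), zero_mul]

end PeriodicMacdonald

namespace PeriodicMacdonald

/-! ### Multiplication and skewing operators -/

open Polynomial in
/-- The algebra homomorphism `f ↦ f(X, zρ)`, a polynomial in `z`. -/
def lowerHom (ρ : Specialization) : SymFun →ₐ[ℝ] Polynomial SymFun :=
  psumLift fun r => C (psum r) + X ^ r * C (algebraMap ℝ SymFun (ρ (psum r)))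

theorem lowerHom_psum (ρ : Specialization) {r : ℕ} (hr : r ≠ 0) : lowerHom ρ (psum r) =
    Polynomial.C (psum r) + Polynomial.X ^ r * Polynomial.C (algebraMap ℝ SymFun (ρ (psum r))) :=
  psumLift_psum _ hr

/-- The part of degree `d` in `ρ` of the operator `f ↦ f(X, ρ)`. It lowers the degree by `d`. -/
def lower (ρ : Specialization) (d : ℕ) : Module.End ℝ SymFun where
  toFun f := (lowerHom ρ f).coeff d
  map_add' f g := by rw [map_add, Polynomial.coeff_add]
  map_smul' c f := by rw [map_smul, Polynomial.coeff_smul, RingHom.id_apply]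

theorem lower_apply (ρ : Specialization) (d : ℕ) (f : SymFun) :
    lower ρ d f = (lowerHom ρ f).coeff d := rfl

theorem lower_one_apply (ρ : Specialization) (d : ℕ) :
    lower ρ d 1 = if d = 0 then 1 else 0 := by
  rw [lower_apply, map_one, Polynomial.coeff_one]

theorem lower_mul_psum (ρ : Specialization) (d k : ℕ) (f : SymFun) :
    lower ρ d (f * psum (k + 1)) = lower ρ d f * psum (k + 1) +
      if k + 1 ≤ d then ρ (psum (k + 1)) • lower ρ (d - (k + 1)) f else 0 := by
  rw [lower_apply, map_mul, lowerHom_psum ρ k.succ_ne_zero, mul_add, Polynomial.coeff_add,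
    Polynomial.coeff_mul_C, mul_left_comm, Polynomial.coeff_X_pow_mul', Polynomial.coeff_mul_C,
    mul_comm _ (algebraMap ℝ SymFun _), ← Algebra.smul_def]
  rfl

theorem lower_mem_gr (ρ : Specialization) (d : ℕ) {m : ℤ} {f : SymFun} (hf : f ∈ gr m) :
    lower ρ d f ∈ gr (m - d) := by
  rcases lt_or_ge m 0 with hm | hm
  · rw [eq_zero_of_mem_gr_neg hm hf, map_zero]
    exact Submodule.zero_mem _
  lift m to ℕ using hm
  obtain ⟨a, rfl⟩ := (Submodule.mem_span_range_iff_exists_fun ℝ).1 (mem_span_psumPart hf)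
  rw [map_sum]
  refine Submodule.sum_mem _ fun l _ => ?_
  rw [map_smul]
  refine Submodule.smul_mem _ _ ?_
  have h : ∀ (s : Multiset ℕ), (∀ r ∈ s, r ≠ 0) → ∀ d : ℕ,
      lower ρ d (s.map psum).prod ∈ gr ((s.sum : ℕ) - d) := by
    intro s hs
    induction s using Multiset.induction_on with
    | empty =>
      intro d
      rw [Multiset.map_zero, Multiset.prod_zero, lower_one_apply]
      split_ifs with h
      · subst h
        simpa using one_mem_gr
      · exact Submodule.zero_mem _
    | cons r s ih =>
      intro d
      obtain ⟨k, rfl⟩ := Nat.exists_eq_succ_of_ne_zero (hs r (by simp))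
      have ih := ih fun r hr => hs r (by simp [hr])
      rw [Multiset.map_cons, Multiset.prod_cons, mul_comm, Multiset.sum_cons, Nat.succ_eq_add_one,
        lower_mul_psum]
      refine Submodule.add_mem _ ?_ ?_
      · have := mul_mem_gr (ih d) (psum_mem_gr (k + 1))
        convert this using 2
        push_cast
        ring
      · split_ifs with h
        · refine Submodule.smul_mem _ _ ?_
          have := ih (d - (k + 1))
          convert this using 2
          push_cast [Nat.cast_sub h]
          ring
        · exact Submodule.zero_mem _
  have := h l.parts (fun r hr => (l.parts_pos hr).ne') d
  rwa [l.parts_sum] at this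

/-- The component `g_d(X; σ)` of degree `d` of the kernel `∏ (t x y; q)_∞ / (x y; q)_∞`, the second
alphabet being specialized to `σ`. -/
def raiseGen (q t : ℝ) (σ : Specialization) (d : ℕ) : SymFun :=
  hsum (fun r => (kerCoeff q t 0 r * σ (psum r)) • psum r) d

/-- The operator of multiplication by `g_d(X; σ)`. It raises the degree by `d`. -/
def raise (q t : ℝ) (σ : Specialization) (d : ℕ) : Module.End ℝ SymFun :=
  LinearMap.mulLeft ℝ (raiseGen q t σ d)

/-- The component of degree `(d, d)` of the kernel, specialized in both alphabets. -/
def pairing (q t : ℝ) (σ ρ : Specialization) (d : ℕ) : ℝ :=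
  hsum (fun r => kerCoeff q t 0 r * (σ (psum r) * ρ (psum r))) d

theorem hsum_psum_eq (b : ℕ → ℝ) (d : ℕ) : hsum (fun r => b r • psum r) d =
    ∑ l : d.Partition, ((zStd l.parts)⁻¹ * (l.parts.map b).prod) • psumPart ⟨d, l⟩ := by
  refine Finset.sum_congr rfl fun l _ => ?_
  have : (l.parts.map fun r => b r • psum r).prod = (l.parts.map b).prod • psumPart ⟨d, l⟩ := by
    simp_rw [Algebra.smul_def]
    rw [Multiset.prod_map_mul, psumPart, map_multiset_prod, Multiset.map_map]
    rfl
  rw [this, smul_smul]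

theorem raiseGen_mem_gr (q t : ℝ) (σ : Specialization) (d : ℕ) : raiseGen q t σ d ∈ gr d := by
  rw [raiseGen, hsum_psum_eq]
  exact Submodule.sum_mem _ fun l _ => Submodule.smul_mem _ _ (psumPart_mem_gr ⟨d, l⟩)

theorem raise_mem_gr (q t : ℝ) (σ : Specialization) (d : ℕ) {m : ℤ} {f : SymFun} (hf : f ∈ gr m) :
    raise q t σ d f ∈ gr (m + d) := by
  rw [add_comm]
  exact mul_mem_gr (raiseGen_mem_gr q t σ d) hf

open Finset in
theorem lowerHom_raiseGen (q t : ℝ) (σ ρ : Specialization) (b : ℕ) :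
    lowerHom ρ (raiseGen q t σ b) = ∑ p ∈ HasAntidiagonal.antidiagonal b,
      Polynomial.C (raiseGen q t σ p.1) * (Polynomial.X ^ p.2 *
        Polynomial.C (algebraMap ℝ SymFun (pairing q t σ ρ p.2))) := by
  refine (map_hsum (R := SymFun) (S := Polynomial SymFun) (lowerHom ρ) _ b).trans ?_
  have h : ∀ r, r ≠ 0 → lowerHom ρ ((kerCoeff q t 0 r * σ (psum r)) • psum r) =
      Polynomial.C ((kerCoeff q t 0 r * σ (psum r)) • psum r) + Polynomial.X ^ r *
        Polynomial.C (algebraMap ℝ SymFun (kerCoeff q t 0 r * (σ (psum r) * ρ (psum r)))) := by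
    intro r hr
    rw [map_smul, lowerHom_psum ρ hr, smul_add, Polynomial.smul_C, ← mul_smul_comm,
      Polynomial.smul_C, ← mul_assoc, map_mul (algebraMap ℝ SymFun) (_ * _), ← Algebra.smul_def]
  rw [hsum_congr h, hsum_add]
  refine Finset.sum_congr rfl fun p _ => ?_
  have h1 := map_hsum (R := SymFun) (S := Polynomial SymFun) (Polynomial.CAlgHom (R := ℝ) (A := SymFun))
    (fun r => (kerCoeff q t 0 r * σ (psum r)) • psum r) p.1
  have h2 := map_hsum (R := ℝ) (S := Polynomial SymFun) ((Polynomial.CAlgHom (R := ℝ) (A := SymFun)).comp (Algebra.ofId ℝ SymFun))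
    (fun r => kerCoeff q t 0 r * (σ (psum r) * ρ (psum r))) p.2
  rw [hsum_pow_mul]
  exact congrArg₂ _ h1.symm (congrArg _ h2.symm)

open Finset in
/-- The commutation relation between skewing and multiplication operators. -/
theorem lower_mul_raise (q t : ℝ) (σ ρ : Specialization) (a b : ℕ) :
    lower ρ a * raise q t σ b = ∑ p ∈ HasAntidiagonal.antidiagonal b, if p.2 ≤ a then
      pairing q t σ ρ p.2 • (raise q t σ p.1 * lower ρ (a - p.2)) else 0 := by
  refine LinearMap.ext fun f => ?_
  change (lowerHom ρ (raiseGen q t σ b * f)).coeff a = _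
  rw [map_mul, lowerHom_raiseGen, sum_mul, Polynomial.finsetSum_coeff, LinearMap.sum_apply]
  refine sum_congr rfl fun p _ => ?_
  rw [mul_assoc, Polynomial.coeff_C_mul, mul_assoc, Polynomial.coeff_X_pow_mul']
  split_ifs with h
  · rw [Polynomial.coeff_C_mul, ← Algebra.smul_def, mul_smul_comm]
    rfl
  · rw [mul_zero]
    rfl

theorem lower_zero_right (ρ : Specialization) : lower ρ 0 = 1 := by
  refine LinearMap.ext fun f => ?_
  induction f using symFun_induction with
  | h1 => rw [lower_one_apply, if_pos rfl]; rfl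
  | hadd f g hf hg => rw [map_add, map_add, hf, hg]
  | hsmul c f hf => rw [map_smul, map_smul, hf]
  | hmul k f hf =>
    rw [lower_mul_psum, hf, if_neg (by omega), add_zero]
    rfl

theorem raise_zero_right (q t : ℝ) (σ : Specialization) : raise q t σ 0 = 1 := by
  refine LinearMap.ext fun f => ?_
  change raiseGen q t σ 0 * f = f
  rw [raiseGen, hsum_zero_right, one_mul]

/-! ### The two operators are adjoint -/

/-- The derivation `∂ / ∂p_{k+1}` of the ring of symmetric functions. -/
def psumDeriv (k : ℕ) : SymFun →ₗ[ℝ] SymFun :=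
  psumEquiv.toLinearMap ∘ₗ (MvPolynomial.pderiv k).toLinearMap ∘ₗ psumEquiv.symm.toLinearMap

theorem psumDeriv_psumEquiv (k : ℕ) (x : MvPolynomial ℕ ℝ) :
    psumDeriv k (psumEquiv x) = psumEquiv (MvPolynomial.pderiv k x) := by
  change psumEquiv (MvPolynomial.pderiv k (psumEquiv.symm (psumEquiv x))) = _
  rw [AlgEquiv.symm_apply_apply]

theorem psumDeriv_one (k : ℕ) : psumDeriv k 1 = 0 := by
  rw [← map_one psumEquiv, psumDeriv_psumEquiv, MvPolynomial.pderiv_one, map_zero]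

theorem psumDeriv_mul_psum (k i : ℕ) (f : SymFun) : psumDeriv k (f * psum (i + 1)) =
    psumDeriv k f * psum (i + 1) + if i = k then f else 0 := by
  obtain ⟨x, rfl⟩ := psumEquiv.surjective f
  rw [← psumEquiv_X, ← map_mul, psumDeriv_psumEquiv, psumDeriv_psumEquiv, MvPolynomial.pderiv_mul,
    map_add, map_mul]
  congr 1
  split_ifs with h
  · subst h
    rw [MvPolynomial.pderiv_X_self, mul_one]
  · rw [MvPolynomial.pderiv_X_of_ne h, mul_zero, map_zero]

theorem lower_psumDeriv (ρ : Specialization) (k : ℕ) (f : SymFun) (d : ℕ) :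
    lower ρ d (psumDeriv k f) = psumDeriv k (lower ρ d f) := by
  induction f using symFun_induction generalizing d with
  | h1 =>
    rw [psumDeriv_one, map_zero, lower_one_apply]
    split_ifs
    · rw [psumDeriv_one]
    · rw [map_zero]
  | hadd f g hf hg => simp only [map_add, hf, hg]
  | hsmul c f hf => simp only [map_smul, hf]
  | hmul i f hf =>
    rw [psumDeriv_mul_psum, map_add, lower_mul_psum, lower_mul_psum, map_add, psumDeriv_mul_psum,
      hf, hf, add_right_comm]
    congr 1
    · congr 1
      split_ifs <;> simp
    · split_ifs <;> simp

theorem zqt_eq (q t : ℝ) (l : Part) :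
    zqt q t l = zStd l.2.parts * (l.2.parts.map fun r => (1 - q ^ r) / (1 - t ^ r)).prod := rfl

theorem expEquiv_add_single (m : ℕ →₀ ℕ) (k : ℕ) :
    (expEquiv (m + Finsupp.single k 1)).2.parts = (k + 1) ::ₘ (expEquiv m).2.parts := by
  change (m + Finsupp.single k 1).toMultiset.map Nat.succ = (k + 1) ::ₘ m.toMultiset.map Nat.succ
  rw [map_add, Finsupp.toMultiset_single, one_smul, Multiset.map_add, add_comm]
  rfl

theorem count_expEquiv (m : ℕ →₀ ℕ) (k : ℕ) : (expEquiv m).2.parts.count (k + 1) = m k := by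
  change (m.toMultiset.map Nat.succ).count (Nat.succ k) = m k
  rw [Multiset.count_map_eq_count' _ _ Nat.succ_injective, Finsupp.count_toMultiset]

theorem zqt_expEquiv_add_single (q t : ℝ) (m : ℕ →₀ ℕ) (k : ℕ) :
    zqt q t (expEquiv (m + Finsupp.single k 1)) =
      (k + 1) * ((1 - q ^ (k + 1)) / (1 - t ^ (k + 1))) * (m k + 1) * zqt q t (expEquiv m) := by
  rw [zqt_eq, zqt_eq, expEquiv_add_single, zStd_cons, Multiset.count_cons_self, count_expEquiv,
    Multiset.map_cons, Multiset.prod_cons]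
  push_cast
  ring

/-- The adjoint of multiplication by `p_{k+1}` is a multiple of `∂ / ∂p_{k+1}`. -/
theorem form_psum_mul (q t : ℝ) (k : ℕ) (f h : SymFun) : form q t f (psum (k + 1) * h) =
    (k + 1) * ((1 - q ^ (k + 1)) / (1 - t ^ (k + 1))) * form q t (psumDeriv k f) h := by
  obtain ⟨x, rfl⟩ := psumEquiv.surjective f
  obtain ⟨y, rfl⟩ := psumEquiv.surjective h
  have hmon : ∀ (m : ℕ →₀ ℕ) (c : ℝ),
      MvPolynomial.monomial m c = c • MvPolynomial.monomial m (1 : ℝ) := fun m c => by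
    rw [MvPolynomial.smul_monomial, smul_eq_mul, mul_one]
  rw [psumDeriv_psumEquiv]
  induction x using MvPolynomial.induction_on' with
  | add x x' hx hx' => rw [map_add, map_add, map_add, form_add_left, form_add_left, hx, hx', mul_add]
  | monomial m c =>
  induction y using MvPolynomial.induction_on' with
  | add y y' hy hy' =>
    rw [map_add, mul_add, form_add_right, form_add_right, hy, hy', mul_add]
  | monomial m' c' =>
  rw [MvPolynomial.pderiv_monomial, hmon m c, hmon m' c', hmon _ (c * _), map_smul, map_smul,
    map_smul, mul_smul_comm, ← psumEquiv_X, ← map_mul, MvPolynomial.X, MvPolynomial.monomial_mul,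
    one_mul, add_comm (Finsupp.single k 1)]
  simp only [form_smul_left, form_smul_right, psumEquiv_monomial, form_psumPart,
    EmbeddingLike.apply_eq_iff_eq]
  by_cases h : m = m' + Finsupp.single k 1
  · subst h
    rw [if_pos rfl, if_pos (by simp), zqt_expEquiv_add_single]
    simp
    ring
  · rw [if_neg h]
    by_cases hk : m k = 0
    · simp [hk]
    · rw [if_neg]
      · simp
      · rintro rfl
        apply h
        rw [tsub_add_cancel_of_le]
        simpa [Finsupp.single_le_iff] using Nat.one_le_iff_ne_zero.2 hk

theorem kerCoeff_zero_mul {q t : ℝ} (H : Params q t) {r : ℕ} (hr : r ≠ 0) :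
    (1 - q ^ r) / (1 - t ^ r) * kerCoeff q t 0 r = 1 := by
  have h1 : 1 - q ^ r ≠ 0 := (sub_pos.2 (pow_lt_one₀ H.q_pos.le H.q_lt hr)).ne'
  have h2 : 1 - t ^ r ≠ 0 := (sub_pos.2 (pow_lt_one₀ H.t_pos.le H.t_lt hr)).ne'
  rw [kerCoeff, zero_pow hr]
  field_simp
  ring

theorem form_psumPart_raiseGen {q t : ℝ} (H : Params q t) (σ : Specialization) (l : Part) (d : ℕ) :
    form q t (psumPart l) (raiseGen q t σ d) = if l.1 = d then σ (psumPart l) else 0 := by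
  classical
  split_ifs with h
  · subst h
    obtain ⟨d, l⟩ := l
    dsimp only
    rw [raiseGen, hsum_psum_eq, form_sum_right, Finset.sum_eq_single l]
    · rw [form_smul_right, form_psumPart, if_pos rfl, zqt_eq, psumPart, map_multiset_prod,
        Multiset.map_map, Multiset.prod_map_mul]
      have h1 : (l.parts.map fun r => (1 - q ^ r) / (1 - t ^ r)).prod *
          (l.parts.map fun r => kerCoeff q t 0 r).prod = 1 := by
        rw [← Multiset.prod_map_mul]
        refine Multiset.prod_eq_one fun x hx => ?_
        obtain ⟨r, hr, rfl⟩ := Multiset.mem_map.1 hx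
        exact kerCoeff_zero_mul H (l.parts_pos hr).ne'
      have h2 : zStd l.parts ≠ 0 := zStd_ne_zero fun r hr => l.parts_pos hr
      have h3 : ∀ a b c z : ℝ, z ≠ 0 → a * b = 1 → z⁻¹ * (b * c) * (z * a) = c := by
        intro a b c z hz hab
        rw [show z⁻¹ * (b * c) * (z * a) = (z⁻¹ * z) * (a * b) * c by ring, hab,
          inv_mul_cancel₀ hz, one_mul, one_mul]
      exact h3 _ _ _ _ h2 h1
    · intro m _ hm
      rw [form_smul_right, form_psumPart, if_neg, mul_zero]
      intro h
      exact hm (by simpa using h.symm)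
    · intro h
      exact absurd (Finset.mem_univ l) h
  · exact form_eq_zero_of_ne q t (psumPart_mem_gr l) (raiseGen_mem_gr q t σ d) (by exact_mod_cast h)

/-- The reproducing property of the kernel. -/
theorem form_raiseGen {q t : ℝ} (H : Params q t) (σ : Specialization) {d : ℕ} {f : SymFun}
    (hf : f ∈ gr d) : form q t f (raiseGen q t σ d) = σ f := by
  obtain ⟨a, rfl⟩ := (Submodule.mem_span_range_iff_exists_fun ℝ).1 (mem_span_psumPart hf)
  rw [form_sum_left, map_sum]
  refine Finset.sum_congr rfl fun l _ => ?_
  rw [form_smul_left, form_psumPart_raiseGen H, if_pos rfl, map_smul, smul_eq_mul]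

/-- The part of `lower σ d` that reaches degree zero is evaluation at `σ`. -/
theorem form_lower_one (q t : ℝ) (σ : Specialization) (l : Part) (d : ℕ) :
    form q t (lower σ d (psumPart l)) 1 = if l.1 = d then σ (psumPart l) else 0 := by
  classical
  let e0 : Part := ⟨0, default⟩
  have h0 : psumPart e0 = 1 := by simp [psumPart, e0]
  have hz : zqt q t e0 = 1 := by simp [zqt, e0]
  -- pairing with `1` is the constant term in the power sums
  have hε : ∀ f, form q t f 1 = psumLift (R := ℝ) (fun _ => 0) f := by
    intro f
    have : formL q t 1 = (psumLift (R := ℝ) fun _ => 0).toLinearMap := by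
      refine psumBasis.ext fun m => ?_
      rw [psumBasis_apply, formL_apply, ← h0, form_psumPart, AlgHom.toLinearMap_apply, psumPart,
        map_multiset_prod, Multiset.map_map]
      split_ifs with h
      · rw [← h, hz]
        simp [e0]
      · symm
        rw [Multiset.prod_eq_zero_iff, Multiset.mem_map]
        obtain ⟨r, hr⟩ := Multiset.exists_mem_of_ne_zero (s := m.2.parts) fun h' =>
          h (part_ext (by rw [h']; simp [e0]))
        exact ⟨r, hr, psumLift_psum _ (m.ne_zero_of_mem hr)⟩
    rw [form_comm, ← formL_apply, this]
    rfl
  rw [hε, lower_apply, ← AlgHom.coe_toRingHom, ← Polynomial.coeff_map]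
  have h1 : ∀ s : Multiset ℕ, (∀ r ∈ s, r ≠ 0) →
      (lowerHom σ (s.map psum).prod).map (psumLift (R := ℝ) fun _ => 0).toRingHom =
        Polynomial.X ^ s.sum * Polynomial.C (σ (s.map psum).prod) := by
    intro s hs
    induction s using Multiset.induction_on with
    | empty => simp
    | cons r s ih =>
      have h2 : psumLift (R := ℝ) (fun _ => 0) (psum r) = 0 := psumLift_psum _ (hs r (by simp))
      rw [Multiset.map_cons, Multiset.prod_cons, map_mul, Polynomial.map_mul,
        ih fun k hk => hs k (by simp [hk]), lowerHom_psum σ (hs r (by simp)), Multiset.sum_cons,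
        map_mul, Polynomial.map_add, Polynomial.map_mul, Polynomial.map_pow, Polynomial.map_X,
        Polynomial.map_C, Polynomial.map_C, map_mul, pow_add]
      simp only [AlgHom.toRingHom_eq_coe, RingHom.coe_coe, h2, map_zero, zero_add,
        AlgHom.commutes, Algebra.algebraMap_self, RingHom.id_apply]
      ring
  have h3 := h1 l.2.parts fun r hr => l.ne_zero_of_mem hr
  rw [l.2.parts_sum] at h3
  change (Polynomial.map (psumLift (R := ℝ) fun _ => 0).toRingHom
    (lowerHom σ (l.2.parts.map psum).prod)).coeff d = _
  rw [h3, Polynomial.coeff_X_pow_mul', Polynomial.coeff_C]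
  split_ifs with h4 h5 h6 h7 h8
  · rfl
  · omega
  · omega
  · rfl
  · omega
  · rfl

/-- The operators `raise` and `lower` are adjoint to each other. -/
theorem form_raise {q t : ℝ} (H : Params q t) (σ : Specialization) (d : ℕ) (f h : SymFun) :
    form q t f (raise q t σ d h) = form q t (lower σ d f) h := by
  change form q t f (raiseGen q t σ d * h) = _
  induction h using symFun_induction generalizing f with
  | h1 =>
    rw [mul_one]
    have : formL q t (raiseGen q t σ d) = (formL q t 1).comp (lower σ d) := by
      refine psumBasis.ext fun l => ?_
      rw [psumBasis_apply, LinearMap.comp_apply, formL_apply, formL_apply, form_comm,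
        form_psumPart_raiseGen H, form_comm, form_lower_one]
    rw [form_comm, ← formL_apply, this, LinearMap.comp_apply, formL_apply, form_comm]
  | hadd g h hg hh => rw [mul_add, form_add_right, form_add_right, hg, hh]
  | hsmul c h hh => rw [mul_smul_comm, form_smul_right, form_smul_right, hh]
  | hmul k h hh =>
    rw [← mul_assoc, mul_comm _ (psum (k + 1)), form_psum_mul, hh, lower_psumDeriv,
      ← form_psum_mul, mul_comm h]

theorem pairing_eq_sum {q t : ℝ} (H : Params q t) (σ ρ : Specialization) (d : ℕ) :
    pairing q t σ ρ d =
      ∑ l : d.Partition, σ (macdonaldP q t ⟨d, l⟩) * ρ (macdonaldQ q t ⟨d, l⟩) := by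
  have h1 : ρ (raiseGen q t σ d) = pairing q t σ ρ d := by
    rw [raiseGen, map_hsum, pairing]
    congr 1
    ext1 r
    rw [map_smul, smul_eq_mul, mul_assoc]
  rw [← h1, eq_sum_macdonaldQ H (raiseGen_mem_gr q t σ d), map_sum]
  refine Finset.sum_congr rfl fun l _ => ?_
  rw [map_smul, smul_eq_mul, form_raiseGen H σ (macdonaldP_mem_gr q t ⟨d, l⟩)]

/-- Macdonald positivity enters only here: the specialized kernel has non-negative components. -/
theorem pairing_nonneg {q t : ℝ} (H : Params q t) {σ ρ : Specialization}
    (hσ : MacdonaldPositive q t σ) (hρ : MacdonaldPositive q t ρ) (d : ℕ) :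
    0 ≤ pairing q t σ ρ d := by
  rw [pairing_eq_sum H]
  refine Finset.sum_nonneg fun l _ => mul_nonneg (hσ _) ?_
  rw [macdonaldQ, map_smul, smul_eq_mul]
  exact mul_nonneg (inv_nonneg.2 (form_macdonaldP_self_pos H _).le) (hρ _)

end PeriodicMacdonald

namespace PeriodicMacdonald

/-! ### Skew functions as matrix coefficients -/

open TensorProduct

/-- `f(X, Y)` as an algebra homomorphism. -/
def inXYHom : SymFun →ₐ[ℝ] Series2 :=
  (MvPowerSeries.renameEquiv ℝ Equiv.natSumNatEquivNat.symm).toAlgHom.comp SymFun.val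

theorem inXYHom_apply (f : SymFun) : inXYHom f = inXY f := rfl

/-- The coproduct of symmetric functions, for which the power sums are primitive. -/
def coprod : SymFun →ₐ[ℝ] SymFun ⊗[ℝ] SymFun :=
  psumLift (R := SymFun ⊗[ℝ] SymFun) fun r => psum r ⊗ₜ 1 + 1 ⊗ₜ psum r

/-- The embedding of `f ⊗ g` as `f(X) g(Y)`. -/
def tensorSeries : SymFun ⊗[ℝ] SymFun →ₐ[ℝ] Series2 :=
  Algebra.TensorProduct.productMap inXHom inYHom

theorem tensorSeries_tmul (f g : SymFun) : tensorSeries (f ⊗ₜ g) = inX f * inY g :=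
  Algebra.TensorProduct.productMap_apply_tmul _ _ _ _

theorem coeff_inXY (f : SymFun) (e : (ℕ ⊕ ℕ) →₀ ℕ) : MvPowerSeries.coeff e (inXY f) =
    symCoeff (e.mapDomain Equiv.natSumNatEquivNat) f := by
  have h := MvPowerSeries.coeff_embDomain_rename Equiv.natSumNatEquivNat.symm.toEmbedding f.1
    (e.mapDomain Equiv.natSumNatEquivNat)
  rw [Finsupp.embDomain_eq_mapDomain, ← Finsupp.mapDomain_comp] at h
  have h2 : (⇑Equiv.natSumNatEquivNat.symm.toEmbedding ∘ ⇑Equiv.natSumNatEquivNat) = id := by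
    ext1 x
    exact Equiv.symm_apply_apply _ x
  rw [h2, Finsupp.mapDomain_id] at h
  exact h

theorem inXY_psum {r : ℕ} (hr : r ≠ 0) : inXY (psum r) = inX (psum r) + inY (psum r) := by
  ext e
  rw [coeff_inXY, map_add]
  by_cases h : symCoeff (e.mapDomain Equiv.natSumNatEquivNat) (psum r) = 0
  · have h1 : ∀ x : ℕ ⊕ ℕ, e ≠ Finsupp.single x r := by
      rintro x rfl
      rw [Finsupp.mapDomain_single, symCoeff_psum_single _ hr] at h
      exact one_ne_zero h
    rw [h]
    obtain ⟨a, b, rfl⟩ := exists_sumElim e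
    have h2 : MvPowerSeries.coeff (a.sumElim b) (inX (psum r)) = 0 := by
      rw [coeff_inX]
      split_ifs with hb
      · by_contra h3
        obtain ⟨i, rfl⟩ := symCoeff_psum a h3
        exact h1 (Sum.inl i) (by rw [hb, Finsupp.sumElim_single_zero])
      · rfl
    have h3 : MvPowerSeries.coeff (a.sumElim b) (inY (psum r)) = 0 := by
      rw [coeff_inY]
      split_ifs with hb
      · by_contra h3
        obtain ⟨i, rfl⟩ := symCoeff_psum b h3
        exact h1 (Sum.inr i) (by rw [hb, Finsupp.sumElim_zero_single])
      · rfl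
    rw [h2, h3, add_zero]
  · obtain ⟨k, hk⟩ := symCoeff_psum _ h
    rw [hk, symCoeff_psum_single _ hr]
    have he : e = Finsupp.single (Equiv.natSumNatEquivNat.symm k) r := by
      refine Finsupp.mapDomain_injective Equiv.natSumNatEquivNat.injective ?_
      rw [hk, Finsupp.mapDomain_single, Equiv.apply_symm_apply]
    rw [he]
    have hne : ∀ i : ℕ, Finsupp.single i r ≠ 0 := fun i => by simpa using hr
    rcases Equiv.natSumNatEquivNat.symm k with i | i
    · rw [← Finsupp.sumElim_single_zero, coeff_inX, coeff_inY, if_pos rfl, if_neg (hne i),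
        symCoeff_psum_single _ hr, add_zero]
    · rw [← Finsupp.sumElim_zero_single, coeff_inX, coeff_inY, if_pos rfl, if_neg (hne i),
        symCoeff_psum_single _ hr, zero_add]

theorem tensorSeries_coprod (f : SymFun) : tensorSeries (coprod f) = inXY f := by
  have : tensorSeries.comp coprod = inXYHom := by
    refine symFun_algHom_ext (R := Series2) fun k => ?_
    rw [AlgHom.comp_apply, coprod, psumLift_psum (R := SymFun ⊗[ℝ] SymFun) _ k.succ_ne_zero, map_add, tensorSeries_tmul,
      tensorSeries_tmul, inXYHom_apply, inXY_psum k.succ_ne_zero, ← inXHom_apply 1, ← inYHom_apply 1,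
      map_one, map_one, mul_one, one_mul]
  exact DFunLike.congr_fun this f

/-- An identity in two sets of variables determines its components in `SymFun ⊗ SymFun`; this is
what makes the skew functions unique. -/
theorem tensorSeries_injective : Function.Injective tensorSeries := by
  classical
  rw [injective_iff_map_eq_zero]
  intro x hx
  obtain ⟨S, rfl⟩ := (TensorProduct.equivFinsuppOfBasisRight (M := SymFun)
    psumBasis).symm.surjective x
  rw [TensorProduct.equivFinsuppOfBasisRight_symm_apply] at hx
  suffices S = 0 by rw [this, map_zero]
  ext1 m
  refine symFun_ext fun a => ?_
  rw [Finsupp.sum, map_sum] at hx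
  have h1 : ∑ l ∈ S.support, symCoeff a (S l) • psumBasis l = 0 := by
    refine symFun_ext fun b => ?_
    have := congrArg (MvPowerSeries.coeff (a.sumElim b)) hx
    rw [map_sum, map_zero] at this
    rw [map_sum, map_zero, ← this]
    refine Finset.sum_congr rfl fun l _ => ?_
    rw [tensorSeries_tmul, coeff_inX_mul_inY, map_smul, smul_eq_mul]
  have h2 := linearIndependent_iff'.1 psumBasis.linearIndependent _ _ h1
  by_cases hm : m ∈ S.support
  · rw [h2 m hm]
    rfl
  · rw [Finsupp.notMem_support_iff.1 hm]
    rfl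

/-- The defining expansion of the skew functions, read in the tensor square. -/
theorem coprod_eq_sum_skew (b : Module.Basis Part ℝ SymFun) (l : Part) :
    coprod (b l) = (skew b l).sum fun m f => f ⊗ₜ b m := by
  classical
  have hex : ∃ S : Part →₀ SymFun, inXY (b l) = S.sum fun m f => inX f * inY (b m) := by
    obtain ⟨S, hS⟩ := (TensorProduct.equivFinsuppOfBasisRight (M := SymFun) b).symm.surjective
      (coprod (b l))
    refine ⟨S, ?_⟩
    rw [← tensorSeries_coprod, ← hS, TensorProduct.equivFinsuppOfBasisRight_symm_apply, Finsupp.sum,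
      map_sum]
    exact Finset.sum_congr rfl fun m _ => tensorSeries_tmul _ _
  have hspec : inXY (b l) = (skew b l).sum fun m f => inX f * inY (b m) :=
    Classical.epsilon_spec hex
  apply tensorSeries_injective
  rw [tensorSeries_coprod, hspec, Finsupp.sum, Finsupp.sum, map_sum]
  exact Finset.sum_congr rfl fun m _ => (tensorSeries_tmul _ _).symm

/-- The algebra homomorphism `f ⊗ g ↦ f(ρ) g`. -/
def specLeft (ρ : Specialization) : SymFun ⊗[ℝ] SymFun →ₐ[ℝ] SymFun :=
  Algebra.TensorProduct.productMap ((Algebra.ofId ℝ SymFun).comp ρ) (AlgHom.id ℝ SymFun)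

theorem specLeft_tmul (ρ : Specialization) (f g : SymFun) : specLeft ρ (f ⊗ₜ g) = ρ f • g := by
  refine (Algebra.TensorProduct.productMap_apply_tmul _ _ _ _).trans ?_
  rw [Algebra.smul_def]
  rfl

/-- The algebra homomorphism `f ↦ f(ρ, X)`. -/
def addSpec (ρ : Specialization) : SymFun →ₐ[ℝ] SymFun := (specLeft ρ).comp coprod

theorem addSpec_basis (ρ : Specialization) (b : Module.Basis Part ℝ SymFun) (l : Part) :
    addSpec ρ (b l) = (skew b l).sum fun m f => ρ f • b m := by
  rw [addSpec, AlgHom.comp_apply, coprod_eq_sum_skew, Finsupp.sum, map_sum]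
  exact Finset.sum_congr rfl fun m _ => specLeft_tmul ρ _ _

theorem addSpec_eq_eval (ρ : Specialization) (f : SymFun) :
    addSpec ρ f = (lowerHom ρ f).eval 1 := by
  have : addSpec ρ = ((Polynomial.aeval (1 : SymFun)).restrictScalars ℝ).comp (lowerHom ρ) := by
    refine symFun_algHom_ext (R := SymFun) fun k => ?_
    rw [AlgHom.comp_apply, lowerHom_psum ρ k.succ_ne_zero, addSpec, AlgHom.comp_apply, coprod,
      psumLift_psum (R := SymFun ⊗[ℝ] SymFun) _ k.succ_ne_zero, map_add, specLeft_tmul, specLeft_tmul]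
    simp [add_comm, Algebra.smul_def]
  rw [this]
  simp

theorem form_addSpec (q t : ℝ) (ρ : Specialization) {f g : SymFun} {n m : ℕ} (hf : f ∈ gr n)
    (hg : g ∈ gr m) : form q t g (addSpec ρ f) =
      if m ≤ n then form q t g (lower ρ (n - m) f) else 0 := by
  rw [addSpec_eq_eval, Polynomial.eval_eq_sum, Polynomial.sum, form_sum_right]
  have h : ∀ d, d ≠ n - m ∨ n < m →
      form q t g ((lowerHom ρ f).coeff d * 1 ^ d) = 0 := by
    intro d hd
    rw [one_pow, mul_one]
    exact form_eq_zero_of_ne q t hg (lower_mem_gr ρ d hf) (by omega)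
  split_ifs with hmn
  · rw [Finset.sum_eq_single (n - m)]
    · rw [one_pow, mul_one]
      rfl
    · exact fun d _ hd => h d (Or.inl hd)
    · intro hd
      rw [Polynomial.notMem_support_iff.1 hd, zero_mul, form_zero_right]
  · exact Finset.sum_eq_zero fun d _ => h d (Or.inr (by omega))

theorem skewQ_eq {q t : ℝ} (H : Params q t) (ρ : Specialization) (l m : Part) :
    ρ (skewQ q t l m) =
      if m.1 ≤ l.1 then form q t (macdonaldP q t m) (lower ρ (l.1 - m.1) (macdonaldQ q t l))
      else 0 := by
  classical
  rw [← form_addSpec q t ρ (macdonaldQ_mem_gr q t l) (macdonaldP_mem_gr q t m)]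
  have h := addSpec_basis ρ (macdonaldQBasis H) l
  rw [coe_macdonaldQBasis] at h
  rw [h, Finsupp.sum, form_sum_right, Finset.sum_eq_single m]
  · rw [form_smul_right, form_macdonaldP_macdonaldQ H, if_pos rfl, mul_one]
    rfl
  · intro k _ hk
    rw [form_smul_right, form_macdonaldP_macdonaldQ H, if_neg hk.symm, mul_zero]
  · intro hm
    rw [Finsupp.notMem_support_iff.1 hm, map_zero, zero_smul, form_zero_right]

theorem skewP_eq {q t : ℝ} (H : Params q t) (ρ : Specialization) (l m : Part) :
    ρ (skewP q t l m) =
      if m.1 ≤ l.1 then form q t (macdonaldP q t l) (raise q t ρ (l.1 - m.1) (macdonaldQ q t m))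
      else 0 := by
  classical
  rw [form_raise H, form_comm]
  rw [← form_addSpec q t ρ (macdonaldP_mem_gr q t l) (macdonaldQ_mem_gr q t m)]
  have h := addSpec_basis ρ (macdonaldPBasis H) l
  rw [coe_macdonaldPBasis] at h
  rw [h, Finsupp.sum, form_sum_right, Finset.sum_eq_single m]
  · rw [form_smul_right, form_comm, form_macdonaldP_macdonaldQ H, if_pos rfl, mul_one]
    rfl
  · intro k _ hk
    rw [form_smul_right, form_comm, form_macdonaldP_macdonaldQ H, if_neg hk, mul_zero]
  · intro hm
    rw [Finsupp.notMem_support_iff.1 hm, map_zero, zero_smul, form_zero_right]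

end PeriodicMacdonald

namespace PeriodicMacdonald

/-! ### Generating series of operators -/

section Words

variable {σ : Type*} {E : Type*} [Semiring E]

/-- The series `∑ d, φ d * x ^ d` in a single variable `x`. -/
def inVar [DecidableEq σ] (x : σ) (φ : ℕ → E) : MvPowerSeries σ E :=
  fun e => if e = Finsupp.single x (e x) then φ (e x) else 0

/-- The series `∑ d, h d * (x y) ^ d`. -/
def pairVar [DecidableEq σ] (x y : σ) (h : ℕ → ℝ) : MvPowerSeries σ ℝ :=
  fun e => if e = Finsupp.single x (e x) + Finsupp.single y (e x) then h (e x) else 0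

/-- Series with real coefficients, as central elements of the ring of operator series. -/
def scalarSeries [Algebra ℝ E] : MvPowerSeries σ ℝ →+* MvPowerSeries σ E := MvPowerSeries.map (algebraMap ℝ E)

theorem coeff_inVar [DecidableEq σ] (x : σ) (φ : ℕ → E) (e : σ →₀ ℕ) :
    MvPowerSeries.coeff e (inVar x φ) = if e = Finsupp.single x (e x) then φ (e x) else 0 := rfl

theorem coeff_pairVar [DecidableEq σ] (x y : σ) (h : ℕ → ℝ) (e : σ →₀ ℕ) :
    MvPowerSeries.coeff e (pairVar x y h) =
      if e = Finsupp.single x (e x) + Finsupp.single y (e x) then h (e x) else 0 := rfl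

theorem coeff_scalarSeries_mul [Algebra ℝ E] [DecidableEq σ] (f : MvPowerSeries σ ℝ) (F : MvPowerSeries σ E)
    (e : σ →₀ ℕ) : MvPowerSeries.coeff e (scalarSeries f * F) =
      ∑ p ∈ Finset.HasAntidiagonal.antidiagonal e,
        MvPowerSeries.coeff p.1 f • MvPowerSeries.coeff p.2 F := by
  rw [MvPowerSeries.coeff_mul]
  refine Finset.sum_congr rfl fun p _ => ?_
  rw [scalarSeries, MvPowerSeries.coeff_map, Algebra.smul_def]

theorem scalarSeries_mul_comm [Algebra ℝ E] (f : MvPowerSeries σ ℝ) (F : MvPowerSeries σ E) :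
    scalarSeries f * F = F * scalarSeries f := by
  classical
  ext e
  rw [MvPowerSeries.coeff_mul, MvPowerSeries.coeff_mul, Finsupp.sum_antidiagonal_swap e
    fun a b => MvPowerSeries.coeff a (scalarSeries f) * MvPowerSeries.coeff b F]
  refine Finset.sum_congr rfl fun p _ => ?_
  rw [scalarSeries, MvPowerSeries.coeff_map, Algebra.commutes]

theorem coeff_inVar_mul [DecidableEq σ] (x : σ) (φ : ℕ → E) {F : MvPowerSeries σ E}
    (hF : ∀ e : σ →₀ ℕ, e x ≠ 0 → MvPowerSeries.coeff e F = 0) (e : σ →₀ ℕ) :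
    MvPowerSeries.coeff e (inVar x φ * F) = φ (e x) * MvPowerSeries.coeff (e.erase x) F := by
  rw [MvPowerSeries.coeff_mul, Finset.sum_eq_single (Finsupp.single x (e x), e.erase x)]
  · rw [coeff_inVar, if_pos]
    · simp
    · simp
  · rintro ⟨p1, p2⟩ hp hne
    rw [Finset.HasAntidiagonal.mem_antidiagonal] at hp
    dsimp only at hp ⊢
    rw [coeff_inVar]
    split_ifs with h
    · rw [hF, mul_zero]
      intro h0
      refine hne ?_
      have h1 : e x = p1 x := by rw [← hp, Finsupp.add_apply, h0, add_zero]
      have h2 : p1 = Finsupp.single x (e x) := by rw [h1]; exact h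
      refine Prod.ext h2 (Finsupp.ext fun z => ?_)
      dsimp only
      by_cases hz : z = x
      · subst hz
        rw [h0, Finsupp.erase_same]
      · rw [Finsupp.erase_ne hz, ← hp, h, Finsupp.add_apply, Finsupp.single_eq_of_ne hz, zero_add]
    · rw [zero_mul]
  · intro h
    refine absurd ?_ h
    rw [Finset.HasAntidiagonal.mem_antidiagonal]
    exact Finsupp.single_add_erase x e

theorem coeff_inVar_of_ne [DecidableEq σ] {x y : σ} (hxy : x ≠ y) (φ : ℕ → E) (e : σ →₀ ℕ)
    (he : e x ≠ 0) : MvPowerSeries.coeff e (inVar y φ) = 0 := by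
  rw [coeff_inVar, if_neg]
  intro h
  apply he
  rw [h, Finsupp.single_eq_of_ne hxy]

theorem coeff_inVar_mul_inVar [DecidableEq σ] {x y : σ} (hxy : x ≠ y) (φ χ : ℕ → E) (e : σ →₀ ℕ) :
    MvPowerSeries.coeff e (inVar x φ * inVar y χ) =
      if e = Finsupp.single x (e x) + Finsupp.single y (e y) then φ (e x) * χ (e y) else 0 := by
  rw [coeff_inVar_mul x φ fun e he => coeff_inVar_of_ne hxy χ e he, coeff_inVar,
    Finsupp.erase_ne hxy.symm]
  have : e.erase x = Finsupp.single y (e y) ↔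
      e = Finsupp.single x (e x) + Finsupp.single y (e y) := by
    constructor
    · intro h
      rw [← h, Finsupp.single_add_erase]
    · intro h
      have h2 := Finsupp.single_add_erase x e
      conv_rhs at h2 => rw [h]
      exact add_left_cancel h2
  simp only [this]
  split_ifs <;> simp

open Finset in
/-- A commutation relation between two families of operators, as an identity of series. -/
theorem inVar_mul_inVar_comm [Algebra ℝ E] [DecidableEq σ] {x y : σ} (hxy : x ≠ y) {A B : ℕ → E} {h : ℕ → ℝ}
    (hAB : ∀ a b, A a * B b = ∑ p ∈ HasAntidiagonal.antidiagonal b, if p.2 ≤ a then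
      h p.2 • (B p.1 * A (a - p.2)) else 0) :
    inVar x A * inVar y B = scalarSeries (pairVar x y h) * (inVar y B * inVar x A) := by
  ext e
  rw [coeff_scalarSeries_mul, coeff_inVar_mul_inVar hxy]
  simp_rw [coeff_inVar_mul_inVar hxy.symm, coeff_pairVar]
  split_ifs with he
  · rw [hAB, ← sum_filter]
    refine sum_of_injOn (fun p => (Finsupp.single x p.2 + Finsupp.single y p.2,
      Finsupp.single x (e x - p.2) + Finsupp.single y p.1)) ?_ ?_ ?_ ?_
    · intro p hp p' hp' hpp
      simp only [coe_filter, HasAntidiagonal.mem_antidiagonal, Set.mem_ofPred_eq] at hp hp'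
      have h1 := DFunLike.congr_fun (congrArg Prod.fst hpp) x
      simp [Finsupp.single_eq_of_ne hxy] at h1
      exact Prod.ext (by omega) h1
    · intro p hp
      simp only [coe_filter, HasAntidiagonal.mem_antidiagonal, Set.mem_ofPred_eq] at hp
      rw [mem_coe, HasAntidiagonal.mem_antidiagonal]
      dsimp only
      rw [add_add_add_comm, ← Finsupp.single_add, ← Finsupp.single_add, Nat.add_sub_cancel' hp.2,
        add_comm p.2, hp.1]
      exact he.symm
    · rintro ⟨p1, p2⟩ hp hnot
      rw [HasAntidiagonal.mem_antidiagonal] at hp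
      dsimp only at hp ⊢
      split_ifs with h1 h2
      · refine absurd ?_ hnot
        have hx : e x = p1 x + p2 x := by rw [← hp, Finsupp.add_apply]
        have hy : e y = p1 x + p2 y := by
          rw [← hp, Finsupp.add_apply]
          congr 1
          conv_lhs => rw [h1]
          simp [Finsupp.single_eq_of_ne hxy.symm]
        refine ⟨(p2 y, p1 x), ?_, ?_⟩
        · simp only [coe_filter, HasAntidiagonal.mem_antidiagonal, Set.mem_ofPred_eq]
          omega
        · refine Prod.ext h1.symm ?_
          dsimp only
          rw [hx, Nat.add_sub_cancel_left, add_comm, ← h2]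
      all_goals simp
    · rintro ⟨b, k⟩ hp
      simp only [mem_filter, HasAntidiagonal.mem_antidiagonal] at hp
      simp [Finsupp.single_eq_of_ne hxy, Finsupp.single_eq_of_ne hxy.symm, add_comm]
  · symm
    refine sum_eq_zero ?_
    rintro ⟨p1, p2⟩ hp
    rw [HasAntidiagonal.mem_antidiagonal] at hp
    dsimp only at hp ⊢
    split_ifs with h1 h2
    · refine absurd ?_ he
      have h3 : ∀ a b c d : ℕ, (Finsupp.single x a + Finsupp.single y b : σ →₀ ℕ) +
          (Finsupp.single y c + Finsupp.single x d) =
          Finsupp.single x (a + d) + Finsupp.single y (b + c) := by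
        intro a b c d
        rw [Finsupp.single_add, Finsupp.single_add]
        abel
      rw [← hp, h1, h2, h3]
      simp [Finsupp.single_eq_of_ne hxy, Finsupp.single_eq_of_ne hxy.symm]
    all_goals simp

/-! ### Normal ordering of words -/

variable {R : Type*} [Semiring R]

/-- The word `A_{k-1} B_{k-1} ⋯ A_0 B_0`. -/
def word (A B : ℕ → R) : ℕ → R
  | 0 => 1
  | k + 1 => A k * B k * word A B k

/-- The word `A_{k-1} ⋯ A_0`. -/
def blockWord (A : ℕ → R) : ℕ → R
  | 0 => 1
  | k + 1 => A k * blockWord A k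

variable {S : Type*} [CommSemiring S] {ι : S →+* R} {A B : ℕ → R} {H : ℕ → ℕ → S}

theorem mul_blockWord (hι : ∀ s r, ι s * r = r * ι s)
    (hAB : ∀ i j, A j * B i = ι (H i j) * (B i * A j)) (j k : ℕ) :
    A j * blockWord B k = ι (∏ i ∈ Finset.range k, H i j) * (blockWord B k * A j) := by
  induction k with
  | zero => simp [blockWord]
  | succ k ih =>
    calc A j * (B k * blockWord B k) = ι (H k j) * (B k * (A j * blockWord B k)) := by
          rw [← mul_assoc, hAB, mul_assoc, mul_assoc]
      _ = ι (H k j) * (ι (∏ i ∈ Finset.range k, H i j) * (B k * (blockWord B k * A j))) := by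
          rw [ih, ← mul_assoc (B k), ← hι, mul_assoc (ι _) (B k)]
      _ = ι (∏ i ∈ Finset.range (k + 1), H i j) * (B k * blockWord B k * A j) := by
          rw [← mul_assoc, ← map_mul, Finset.prod_range_succ, mul_comm (H k j), mul_assoc (B k)]

theorem word_eq (hι : ∀ s r, ι s * r = r * ι s)
    (hAB : ∀ i j, A j * B i = ι (H i j) * (B i * A j)) (k : ℕ) :
    word A B k = ι (∏ j ∈ Finset.range k, ∏ i ∈ Finset.range (j + 1), H i j) *
      (blockWord B k * blockWord A k) := by
  induction k with
  | zero => simp [blockWord, word]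
  | succ k ih =>
    rw [word, ih, Finset.prod_range_succ, map_mul]
    calc A k * B k * (ι (∏ j ∈ Finset.range k, ∏ i ∈ Finset.range (j + 1), H i j) *
          (blockWord B k * blockWord A k))
        = ι (∏ j ∈ Finset.range k, ∏ i ∈ Finset.range (j + 1), H i j) *
          ((A k * blockWord B (k + 1)) * blockWord A k) := by
          rw [← mul_assoc, ← hι, blockWord]
          simp only [mul_assoc]
      _ = _ := by
          rw [mul_blockWord hι hAB]
          simp only [mul_assoc, blockWord]

theorem blockWord_mul_blockWord (hι : ∀ s r, ι s * r = r * ι s)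
    (hAB : ∀ i j, A j * B i = ι (H i j) * (B i * A j)) (m k : ℕ) :
    blockWord A m * blockWord B k = ι (∏ j ∈ Finset.range m, ∏ i ∈ Finset.range k, H i j) *
      (blockWord B k * blockWord A m) := by
  induction m with
  | zero => simp [blockWord]
  | succ m ih =>
    rw [Finset.prod_range_succ, map_mul]
    calc A m * blockWord A m * blockWord B k
        = ι (∏ j ∈ Finset.range m, ∏ i ∈ Finset.range k, H i j) *
          ((A m * blockWord B k) * blockWord A m) := by
          rw [mul_assoc, ih, ← mul_assoc, ← hι]
          simp only [mul_assoc]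
      _ = _ := by
          rw [mul_blockWord hι hAB]
          simp only [mul_assoc, blockWord]

end Words

end PeriodicMacdonald

namespace PeriodicMacdonald

/-! ### Graded operators and traces on homogeneous components -/

/-- The degree in the second family of variables. In a word of operators this family marks the
lowering operators, and the first one, measured by `xdeg`, the raising operators. -/
def ydeg : ((ℕ ⊕ ℕ) →₀ ℕ) →+ ℕ := Finsupp.weight (Sum.elim (fun _ => 0) fun _ => 1)

theorem ydeg_single_inl (i r : ℕ) : ydeg (Finsupp.single (Sum.inl i) r) = 0 := by
  simp [ydeg, Finsupp.weight_apply]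

theorem ydeg_single_inr (i r : ℕ) : ydeg (Finsupp.single (Sum.inr i) r) = r := by
  simp [ydeg, Finsupp.weight_apply]

theorem eq_zero_of_xdeg_ydeg {e : (ℕ ⊕ ℕ) →₀ ℕ} (hx : xdeg e = 0) (hy : ydeg e = 0) : e = 0 := by
  ext z
  have h := Finsupp.single_add_erase z e
  rw [← h, map_add] at hx hy
  rcases z with i | i
  · rw [xdeg_single_inl] at hx
    simp only [Finsupp.zero_apply]
    omega
  · rw [ydeg_single_inr] at hy
    simp only [Finsupp.zero_apply]
    omega

/-- The operators on symmetric functions that raise the degree by `m`. -/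
def shift (m : ℤ) : Submodule ℝ (Module.End ℝ SymFun) where
  carrier := {L | ∀ (n : ℤ) (f : SymFun), f ∈ gr n → L f ∈ gr (n + m)}
  add_mem' := fun hL hM n f hf => (gr _).add_mem (hL n f hf) (hM n f hf)
  zero_mem' := fun _ _ _ => (gr _).zero_mem
  smul_mem' := fun c _ hL n f hf => (gr _).smul_mem c (hL n f hf)

theorem mul_mem_shift {a b : ℤ} {L M : Module.End ℝ SymFun} (hL : L ∈ shift a) (hM : M ∈ shift b) :
    L * M ∈ shift (a + b) := by
  intro n f hf
  rw [add_comm a b, ← add_assoc]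
  exact hL _ _ (hM _ _ hf)

theorem one_mem_shift : (1 : Module.End ℝ SymFun) ∈ shift 0 := fun n f hf => by simpa using hf

theorem raise_mem_shift (q t : ℝ) (σ : Specialization) (d : ℕ) : raise q t σ d ∈ shift d :=
  fun _ _ hf => raise_mem_gr q t σ d hf

theorem lower_mem_shift (ρ : Specialization) (d : ℕ) : lower ρ d ∈ shift (-d) :=
  fun n f hf => by
    rw [← sub_eq_add_neg]
    exact lower_mem_gr ρ d hf

/-- The operator series in which the coefficient of a monomial shifts degrees by the difference of
its two partial degrees. -/
def Graded (F : MvPowerSeries (ℕ ⊕ ℕ) (Module.End ℝ SymFun)) : Prop :=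
  ∀ e, MvPowerSeries.coeff e F ∈ shift (xdeg e - ydeg e)

theorem Graded.mul {F G : MvPowerSeries (ℕ ⊕ ℕ) (Module.End ℝ SymFun)} (hF : Graded F)
    (hG : Graded G) : Graded (F * G) := by
  classical
  intro e
  rw [MvPowerSeries.coeff_mul]
  refine Submodule.sum_mem _ fun p hp => ?_
  rw [Finset.HasAntidiagonal.mem_antidiagonal] at hp
  have h := mul_mem_shift (hF p.1) (hG p.2)
  rw [← hp, map_add, map_add]
  convert h using 2
  push_cast
  ring

theorem Graded.one : Graded 1 := by
  classical
  intro e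
  rw [MvPowerSeries.coeff_one]
  split_ifs with h
  · subst h
    simpa using one_mem_shift
  · exact Submodule.zero_mem _

theorem graded_inVar_inl {φ : ℕ → Module.End ℝ SymFun} (h : ∀ d : ℕ, φ d ∈ shift d) (i : ℕ) :
    Graded (inVar (Sum.inl i) φ) := by
  intro e
  rw [coeff_inVar]
  split_ifs with he
  · rw [he, xdeg_single_inl, ydeg_single_inl]
    simpa using h _
  · exact Submodule.zero_mem _

theorem graded_inVar_inr {φ : ℕ → Module.End ℝ SymFun} (h : ∀ d : ℕ, φ d ∈ shift (-d)) (i : ℕ) :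
    Graded (inVar (Sum.inr i) φ) := by
  intro e
  rw [coeff_inVar]
  split_ifs with he
  · rw [he, xdeg_single_inr, ydeg_single_inr]
    simpa using h _
  · exact Submodule.zero_mem _

/-- The series supported on monomials of weighted degree `0`. -/
def FreeOf {σ R : Type*} [Semiring R] (w : (σ →₀ ℕ) →+ ℕ) (F : MvPowerSeries σ R) : Prop :=
  ∀ e, w e ≠ 0 → MvPowerSeries.coeff e F = 0

theorem FreeOf.mul {σ R : Type*} [Semiring R] {w : (σ →₀ ℕ) →+ ℕ} {F G : MvPowerSeries σ R}
    (hF : FreeOf w F) (hG : FreeOf w G) : FreeOf w (F * G) := by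
  classical
  intro e he
  rw [MvPowerSeries.coeff_mul]
  refine Finset.sum_eq_zero fun p hp => ?_
  rw [Finset.HasAntidiagonal.mem_antidiagonal] at hp
  by_cases h1 : w p.1 = 0
  · rw [hG p.2, mul_zero]
    intro h2
    exact he (by rw [← hp, map_add, h1, h2])
  · rw [hF _ h1, zero_mul]

theorem FreeOf.one {σ R : Type*} [Semiring R] {w : (σ →₀ ℕ) →+ ℕ} :
    FreeOf w (1 : MvPowerSeries σ R) := by
  classical
  intro e he
  rw [MvPowerSeries.coeff_one, if_neg]
  rintro rfl
  exact he (map_zero w)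

theorem freeOf_inVar {σ R : Type*} [Semiring R] [DecidableEq σ] {w : (σ →₀ ℕ) →+ ℕ} {x : σ}
    (h : ∀ r, w (Finsupp.single x r) = 0) (φ : ℕ → R) : FreeOf w (inVar x φ) := by
  intro e he
  rw [coeff_inVar, if_neg]
  intro h1
  exact he (by rw [h1, h])

theorem blockWord_induction {R : Type*} [Semiring R] {p : R → Prop} (h1 : p 1)
    (hmul : ∀ a b, p a → p b → p (a * b)) {A : ℕ → R} (hA : ∀ k, p (A k)) (k : ℕ) :
    p (blockWord A k) := by
  induction k with
  | zero => exact h1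
  | succ k ih => exact hmul _ _ (hA k) ih

/-- The trace of the degree `n` component of an operator, computed in the basis `(Q_l)` with dual
basis `(P_l)`. -/
def grTrace (q t : ℝ) (n : ℕ) : Module.End ℝ SymFun →ₗ[ℝ] ℝ where
  toFun L := ∑ l : n.Partition, form q t (macdonaldP q t ⟨n, l⟩) (L (macdonaldQ q t ⟨n, l⟩))
  map_add' L M := by
    rw [← Finset.sum_add_distrib]
    exact Finset.sum_congr rfl fun l _ => form_add_right ..
  map_smul' c L := by
    rw [smul_eq_mul, Finset.mul_sum]
    exact Finset.sum_congr rfl fun l _ => form_smul_right ..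

theorem grTrace_apply (q t : ℝ) (n : ℕ) (L : Module.End ℝ SymFun) : grTrace q t n L =
    ∑ l : n.Partition, form q t (macdonaldP q t ⟨n, l⟩) (L (macdonaldQ q t ⟨n, l⟩)) := rfl

theorem grTrace_eq_zero (q t : ℝ) (n : ℕ) {L : Module.End ℝ SymFun} {m : ℤ} (hL : L ∈ shift m)
    (hm : m ≠ 0) : grTrace q t n L = 0 := by
  rw [grTrace_apply]
  refine Finset.sum_eq_zero fun l _ => ?_
  refine form_eq_zero_of_ne q t (macdonaldP_mem_gr q t ⟨n, l⟩)
    (hL _ _ (macdonaldQ_mem_gr q t ⟨n, l⟩)) ?_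
  dsimp only
  omega

theorem grTrace_mul_comm {q t : ℝ} (H : Params q t) {a b : ℕ} {X Y : Module.End ℝ SymFun}
    (hY : ∀ f ∈ gr a, Y f ∈ gr b) (hX : ∀ f ∈ gr b, X f ∈ gr a) :
    grTrace q t a (X * Y) = grTrace q t b (Y * X) := by
  have key : ∀ {c d : ℕ} (Z W : Module.End ℝ SymFun), (∀ f ∈ gr c, W f ∈ gr d) →
      grTrace q t c (Z * W) = ∑ l : c.Partition, ∑ m : d.Partition,
        form q t (macdonaldP q t ⟨d, m⟩) (W (macdonaldQ q t ⟨c, l⟩)) *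
          form q t (macdonaldP q t ⟨c, l⟩) (Z (macdonaldQ q t ⟨d, m⟩)) := by
    intro c d Z W hW
    rw [grTrace_apply]
    refine Finset.sum_congr rfl fun l _ => ?_
    rw [Module.End.mul_apply,
      eq_sum_macdonaldQ H (hW _ (macdonaldQ_mem_gr q t ⟨c, l⟩)), map_sum, form_sum_right]
    refine Finset.sum_congr rfl fun m _ => ?_
    rw [map_smul, form_smul_right, ← eq_sum_macdonaldQ H (hW _ (macdonaldQ_mem_gr q t ⟨c, l⟩))]
  rw [key X Y hY, key Y X hX, Finset.sum_comm]
  exact Finset.sum_congr rfl fun m _ => Finset.sum_congr rfl fun l _ => mul_comm _ _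

theorem grTrace_one {q t : ℝ} (H : Params q t) (n : ℕ) :
    grTrace q t n 1 = Fintype.card n.Partition := by
  classical
  rw [grTrace_apply, Finset.sum_congr rfl fun l _ => by
    rw [Module.End.one_apply, form_macdonaldP_macdonaldQ H, if_pos rfl]]
  simp

/-- The series of traces in degree `n` of the coefficients of an operator series. -/
def traceSeries (q t : ℝ) (n : ℕ) (F : MvPowerSeries (ℕ ⊕ ℕ) (Module.End ℝ SymFun)) :
    MvPowerSeries (ℕ ⊕ ℕ) ℝ := fun e => grTrace q t n (MvPowerSeries.coeff e F)

theorem coeff_traceSeries (q t : ℝ) (n : ℕ) (F : MvPowerSeries (ℕ ⊕ ℕ) (Module.End ℝ SymFun))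
    (e : (ℕ ⊕ ℕ) →₀ ℕ) : MvPowerSeries.coeff e (traceSeries q t n F) =
      grTrace q t n (MvPowerSeries.coeff e F) := rfl

theorem traceSeries_scalarSeries_mul (q t : ℝ) (n : ℕ) (f : MvPowerSeries (ℕ ⊕ ℕ) ℝ)
    (F : MvPowerSeries (ℕ ⊕ ℕ) (Module.End ℝ SymFun)) :
    traceSeries q t n (scalarSeries f * F) = f * traceSeries q t n F := by
  classical
  ext e
  rw [coeff_traceSeries, coeff_scalarSeries_mul, map_sum, MvPowerSeries.coeff_mul]
  exact Finset.sum_congr rfl fun p _ => map_smul _ _ _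

/-- Cyclicity of the trace: moving the degree lowering factor to the front lowers the degree of the
component on which the trace is taken. -/
theorem coeff_traceSeries_mul {q t : ℝ} (H : Params q t)
    {X Y : MvPowerSeries (ℕ ⊕ ℕ) (Module.End ℝ SymFun)} (hX : Graded X) (hY : Graded Y)
    (hXy : FreeOf ydeg X) (hYx : FreeOf xdeg Y) (n : ℕ) (e : (ℕ ⊕ ℕ) →₀ ℕ) :
    MvPowerSeries.coeff e (traceSeries q t n (X * Y)) = if ydeg e ≤ n then
      MvPowerSeries.coeff e (traceSeries q t (n - ydeg e) (Y * X)) else 0 := by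
  classical
  by_cases hxy : xdeg e = ydeg e
  · rw [coeff_traceSeries, coeff_traceSeries, MvPowerSeries.coeff_mul, MvPowerSeries.coeff_mul,
      map_sum, map_sum, Finsupp.sum_antidiagonal_swap e fun a b => grTrace q t (n - ydeg e)
        (MvPowerSeries.coeff a Y * MvPowerSeries.coeff b X)]
    have hterm : ∀ p ∈ Finset.HasAntidiagonal.antidiagonal e,
        grTrace q t n (MvPowerSeries.coeff p.1 X * MvPowerSeries.coeff p.2 Y) =
          if ydeg e ≤ n then grTrace q t (n - ydeg e)
            (MvPowerSeries.coeff p.2 Y * MvPowerSeries.coeff p.1 X) else 0 := by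
      intro p hp
      rw [Finset.HasAntidiagonal.mem_antidiagonal] at hp
      by_cases h1 : ydeg p.1 = 0
      swap
      · simp [hXy _ h1]
      by_cases h2 : xdeg p.2 = 0
      swap
      · simp [hYx _ h2]
      have hx : xdeg p.1 = ydeg e := by rw [← hxy, ← hp, map_add, h2, add_zero]
      have hy : ydeg p.2 = ydeg e := by rw [← hp, map_add, h1, zero_add]
      have hX1 := hX p.1
      have hY2 := hY p.2
      rw [h1, hx] at hX1
      rw [h2, hy] at hY2
      split_ifs with hle
      · refine grTrace_mul_comm H (fun f hf => ?_) fun f hf => ?_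
        · convert hY2 _ f hf using 2
          push_cast [hle]
          ring
        · convert hX1 _ f hf using 2
          push_cast [hle]
          ring
      · rw [grTrace_apply]
        refine Finset.sum_eq_zero fun l _ => ?_
        rw [Module.End.mul_apply, eq_zero_of_mem_gr_neg _ (hY2 _ _ (macdonaldQ_mem_gr q t ⟨n, l⟩)),
          map_zero, form_zero_right]
        dsimp only
        push_cast
        omega
    rw [Finset.sum_congr rfl hterm]
    split_ifs
    · rfl
    · exact Finset.sum_const_zero
  · have h0 : ∀ (m : ℕ) {Z : MvPowerSeries (ℕ ⊕ ℕ) (Module.End ℝ SymFun)}, Graded Z →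
        MvPowerSeries.coeff e (traceSeries q t m Z) = 0 := fun m Z hZ =>
      grTrace_eq_zero q t m (hZ e) (by omega)
    rw [h0 _ (hX.mul hY), h0 _ (hY.mul hX), ite_self]

end PeriodicMacdonald

namespace PeriodicMacdonald

/-! ### Traces of words in the raising and lowering operators -/

theorem blockWord_congr {R : Type*} [Semiring R] {A B : ℕ → R} {k : ℕ} (h : ∀ i < k, A i = B i) :
    blockWord A k = blockWord B k := by
  induction k with
  | zero => rfl
  | succ k ih => rw [blockWord, blockWord, h k k.lt_succ_self, ih fun i hi => h i (by omega)]

/-- A coefficient of the word in the generating series `A_i`, `B_i`, each in its own variable, is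
the corresponding word in the coefficients of these series. -/
theorem coeff_word {E : Type*} [Semiring E] (φ χ : ℕ → ℕ → E) (k : ℕ) (e : (ℕ ⊕ ℕ) →₀ ℕ)
    [Decidable (∀ j, k ≤ j → e (Sum.inl j) = 0 ∧ e (Sum.inr j) = 0)] :
    MvPowerSeries.coeff e (word (fun i => inVar (Sum.inr i) (φ i))
      (fun i => inVar (Sum.inl i) (χ i)) k) =
      if ∀ j, k ≤ j → e (Sum.inl j) = 0 ∧ e (Sum.inr j) = 0 then
        blockWord (fun i => φ i (e (Sum.inr i)) * χ i (e (Sum.inl i))) k else 0 := by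
  classical
  induction k generalizing e with
  | zero =>
    rw [word, blockWord, MvPowerSeries.coeff_one]
    refine if_congr ⟨fun h j _ => by simp [h], fun h => ?_⟩ rfl rfl
    ext (j | j)
    · exact (h j (Nat.zero_le j)).1
    · exact (h j (Nat.zero_le j)).2
  | succ k ih =>
    have h1 : ∀ e : (ℕ ⊕ ℕ) →₀ ℕ, e (Sum.inl k) ≠ 0 → MvPowerSeries.coeff e (word
        (fun i => inVar (Sum.inr i) (φ i)) (fun i => inVar (Sum.inl i) (χ i)) k) = 0 :=
      fun e he => by rw [ih, if_neg fun h => he (h k le_rfl).1]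
    have h2 : ∀ e : (ℕ ⊕ ℕ) →₀ ℕ, e (Sum.inr k) ≠ 0 → MvPowerSeries.coeff e (
        inVar (Sum.inl k) (χ k) * word
        (fun i => inVar (Sum.inr i) (φ i)) (fun i => inVar (Sum.inl i) (χ i)) k) = 0 := by
      intro e he
      rw [coeff_inVar_mul _ _ h1, ih, if_neg, mul_zero]
      intro h
      refine he ?_
      have := (h k le_rfl).2
      rwa [Finsupp.erase_ne (by simp)] at this
    rw [word, mul_assoc, coeff_inVar_mul _ _ h2, coeff_inVar_mul _ _ h1, ih,
      Finsupp.erase_ne (by simp)]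
    have h3 : (∀ j, k ≤ j → ((e.erase (Sum.inr k)).erase (Sum.inl k)) (Sum.inl j) = 0 ∧
        ((e.erase (Sum.inr k)).erase (Sum.inl k)) (Sum.inr j) = 0) ↔
        ∀ j, k + 1 ≤ j → e (Sum.inl j) = 0 ∧ e (Sum.inr j) = 0 := by
      constructor
      · intro h j hj
        have := h j (by omega)
        rwa [Finsupp.erase_ne (by simp; omega), Finsupp.erase_ne (by simp),
          Finsupp.erase_ne (by simp), Finsupp.erase_ne (by simp; omega)] at this
      · intro h j hj
        rcases hj.eq_or_lt with rfl | hj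
        · simp
        · have := h j hj
          rwa [Finsupp.erase_ne (by simp; omega), Finsupp.erase_ne (by simp),
            Finsupp.erase_ne (by simp), Finsupp.erase_ne (by simp; omega)]
    rw [if_congr h3 rfl rfl]
    split_ifs with h
    · rw [blockWord, mul_assoc]
      congr 2
      refine blockWord_congr fun i hi => ?_
      rw [Finsupp.erase_ne (by simp), Finsupp.erase_ne (by simp; omega),
        Finsupp.erase_ne (by simp; omega), Finsupp.erase_ne (by simp)]
    · simp

variable (q t : ℝ) (rp rm : ℕ → Specialization)

/-- The generating series of the raising operators of the `i`-th specialization. -/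
def raiseSeries (i : ℕ) : MvPowerSeries (ℕ ⊕ ℕ) (Module.End ℝ SymFun) :=
  inVar (Sum.inl i) (raise q t (rp i))

/-- The generating series of the lowering operators of the `j`-th specialization. -/
def lowerSeries (j : ℕ) : MvPowerSeries (ℕ ⊕ ℕ) (Module.End ℝ SymFun) :=
  inVar (Sum.inr j) (lower (rm j))

/-- The scalar series by which the raising and lowering series fail to commute. -/
def pairSeries (i j : ℕ) : MvPowerSeries (ℕ ⊕ ℕ) ℝ :=
  pairVar (Sum.inr j) (Sum.inl i) (pairing q t (rp i) (rm j))

theorem lowerSeries_mul_raiseSeries (i j : ℕ) : lowerSeries rm j * raiseSeries q t rp i =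
    scalarSeries (pairSeries q t rp rm i j) * (raiseSeries q t rp i * lowerSeries rm j) :=
  inVar_mul_inVar_comm (by simp) fun a b => lower_mul_raise q t (rp i) (rm j) a b

/-- The series of traces in degree `n` of the normally ordered word in all raising and lowering
series. -/
def normalTrace (N n : ℕ) : MvPowerSeries (ℕ ⊕ ℕ) ℝ :=
  traceSeries q t n (blockWord (raiseSeries q t rp) N * blockWord (lowerSeries rm) N)

theorem traceSeries_word (N n : ℕ) :
    traceSeries q t n (word (lowerSeries rm) (raiseSeries q t rp) N) =
      (∏ j ∈ Finset.range N, ∏ i ∈ Finset.range (j + 1), pairSeries q t rp rm i j) *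
        normalTrace q t rp rm N n := by
  rw [word_eq (H := pairSeries q t rp rm) scalarSeries_mul_comm
    (lowerSeries_mul_raiseSeries q t rp rm), traceSeries_scalarSeries_mul, normalTrace]

variable {q t rp rm}

/-- The recursion for the traces of the normally ordered word, which follows from cyclicity of the
trace and restoration of the normal order. -/
theorem coeff_normalTrace (H : Params q t) (N n : ℕ) (e : (ℕ ⊕ ℕ) →₀ ℕ) :
    MvPowerSeries.coeff e (normalTrace q t rp rm N n) = if ydeg e ≤ n then
      MvPowerSeries.coeff e ((∏ j ∈ Finset.range N, ∏ i ∈ Finset.range N,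
        pairSeries q t rp rm i j) * normalTrace q t rp rm N (n - ydeg e)) else 0 := by
  rw [normalTrace, coeff_traceSeries_mul H, blockWord_mul_blockWord (H := pairSeries q t rp rm)
    scalarSeries_mul_comm (lowerSeries_mul_raiseSeries q t rp rm), traceSeries_scalarSeries_mul,
    ← normalTrace]
  · exact blockWord_induction Graded.one (fun _ _ => Graded.mul)
      (fun k => graded_inVar_inl (fun d => raise_mem_shift q t (rp k) d) k) N
  · exact blockWord_induction Graded.one (fun _ _ => Graded.mul)
      (fun k => graded_inVar_inr (fun d => lower_mem_shift (rm k) d) k) N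
  · exact blockWord_induction FreeOf.one (fun _ _ => FreeOf.mul)
      (fun k => freeOf_inVar (fun r => ydeg_single_inl k r) _) N
  · exact blockWord_induction FreeOf.one (fun _ _ => FreeOf.mul)
      (fun k => freeOf_inVar (fun r => xdeg_single_inr k r) _) N

/-- The balanced coefficients are the only nonzero ones. -/
theorem coeff_normalTrace_of_ne (N n : ℕ) {e : (ℕ ⊕ ℕ) →₀ ℕ} (he : xdeg e ≠ ydeg e) :
    MvPowerSeries.coeff e (normalTrace q t rp rm N n) = 0 := by
  refine grTrace_eq_zero q t n ((Graded.mul ?_ ?_) e) (by omega)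
  · exact blockWord_induction Graded.one (fun _ _ => Graded.mul)
      (fun k => graded_inVar_inl (fun d => raise_mem_shift q t (rp k) d) k) N
  · exact blockWord_induction Graded.one (fun _ _ => Graded.mul)
      (fun k => graded_inVar_inr (fun d => lower_mem_shift (rm k) d) k) N

theorem coeff_zero_normalTrace (H : Params q t) (N n : ℕ) :
    MvPowerSeries.coeff 0 (normalTrace q t rp rm N n) = Fintype.card n.Partition := by
  rw [normalTrace, coeff_traceSeries, MvPowerSeries.coeff_zero_eq_constantCoeff_apply, map_mul]
  rw [blockWord_induction (p := fun F => MvPowerSeries.constantCoeff F = 1) (map_one _)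
    (fun a b ha hb => by rw [map_mul, ha, hb, one_mul]) (fun k => ?_) N,
    blockWord_induction (p := fun F => MvPowerSeries.constantCoeff F = 1) (map_one _)
    (fun a b ha hb => by rw [map_mul, ha, hb, one_mul]) (fun k => ?_) N, one_mul, grTrace_one H]
  · rw [← MvPowerSeries.coeff_zero_eq_constantCoeff_apply, lowerSeries, coeff_inVar, if_pos (by simp)]
    exact lower_zero_right _
  · rw [← MvPowerSeries.coeff_zero_eq_constantCoeff_apply, raiseSeries, coeff_inVar, if_pos (by simp)]
    exact raise_zero_right q t _

/-- The power series with non-negative coefficients. -/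
def CoeffNonneg {σ : Type*} (F : MvPowerSeries σ ℝ) : Prop := ∀ e, 0 ≤ MvPowerSeries.coeff e F

theorem CoeffNonneg.mul {σ : Type*} {F G : MvPowerSeries σ ℝ} (hF : CoeffNonneg F)
    (hG : CoeffNonneg G) : CoeffNonneg (F * G) := by
  classical
  intro e
  rw [MvPowerSeries.coeff_mul]
  exact Finset.sum_nonneg fun p _ => mul_nonneg (hF _) (hG _)

theorem CoeffNonneg.prod {σ ι : Type*} {F : ι → MvPowerSeries σ ℝ} (s : Finset ι)
    (hF : ∀ i ∈ s, CoeffNonneg (F i)) : CoeffNonneg (∏ i ∈ s, F i) := by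
  classical
  refine Finset.prod_induction _ CoeffNonneg (fun _ _ => CoeffNonneg.mul) (fun e => ?_) hF
  rw [MvPowerSeries.coeff_one]
  split_ifs
  · exact zero_le_one
  · exact le_rfl

theorem coeffNonneg_pairSeries (H : Params q t) (hp : ∀ i, MacdonaldPositive q t (rp i))
    (hm : ∀ i, MacdonaldPositive q t (rm i)) (i j : ℕ) :
    CoeffNonneg (pairSeries q t rp rm i j) := by
  intro e
  rw [pairSeries, coeff_pairVar]
  split_ifs
  · exact pairing_nonneg H (hp i) (hm j) _
  · exact le_rfl

theorem coeffNonneg_normalTrace (H : Params q t) (hp : ∀ i, MacdonaldPositive q t (rp i))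
    (hm : ∀ i, MacdonaldPositive q t (rm i)) (N n : ℕ) :
    CoeffNonneg (normalTrace q t rp rm N n) := by
  induction n using Nat.strong_induction_on with
  | _ n ih =>
  intro e
  by_cases he : ydeg e = 0
  · by_cases hx : xdeg e = 0
    · rw [eq_zero_of_xdeg_ydeg hx he, coeff_zero_normalTrace H]
      exact Nat.cast_nonneg _
    · rw [coeff_normalTrace_of_ne _ _ (by omega)]
  · rw [coeff_normalTrace H]
    split_ifs with hle
    · refine CoeffNonneg.mul (CoeffNonneg.prod _ fun j _ => CoeffNonneg.prod _ fun i _ =>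
        coeffNonneg_pairSeries H hp hm i j) (ih _ (by omega)) e
    · exact le_rfl

end PeriodicMacdonald

namespace PeriodicMacdonald

/-! ### The periodic weight as a trace -/

theorem blockWord_succ_mul {R : Type*} [Semiring R] (A : ℕ → R) (k : ℕ) :
    blockWord A (k + 1) = blockWord (fun i => A (i + 1)) k * A 0 := by
  induction k with
  | zero => simp [blockWord]
  | succ k ih => rw [blockWord, ih, blockWord, mul_assoc]

/-- Iterated matrix products as sums over paths: `d k` are the matrices and `K k` is the product of
the first `k` of them. -/
theorem sum_path (r : ℕ → ℕ) (d K : ℕ → Part → Part → ℝ)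
    (M : ℕ) (h0 : ∀ x y : (r 0).Partition, K 0 ⟨r 0, x⟩ ⟨r 0, y⟩ = if x = y then 1 else 0)
    (hs : ∀ k < M, ∀ (x : (r 0).Partition) (z : (r (k + 1)).Partition),
      K (k + 1) ⟨r 0, x⟩ ⟨r (k + 1), z⟩ =
        ∑ y : (r k).Partition, K k ⟨r 0, x⟩ ⟨r k, y⟩ * d k ⟨r k, y⟩ ⟨r (k + 1), z⟩)
    (F : Part → Part → ℝ) :
    ∑ p : (i : Fin (M + 1)) → (r i).Partition, (∏ i : Fin M,
      d i ⟨r i.castSucc, p i.castSucc⟩ ⟨r (i.succ : Fin (M + 1)), p i.succ⟩) *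
        F ⟨r (0 : Fin (M + 1)), p 0⟩ ⟨r (Fin.last M), p (Fin.last M)⟩ =
    ∑ x : (r 0).Partition, ∑ y : (r M).Partition,
      K M ⟨r 0, x⟩ ⟨r M, y⟩ * F ⟨r 0, x⟩ ⟨r M, y⟩ := by
  classical
  induction M generalizing F with
  | zero =>
    have h : ∀ x : (r 0).Partition, ∑ y : (r 0).Partition,
        K 0 ⟨r 0, x⟩ ⟨r 0, y⟩ * F ⟨r 0, x⟩ ⟨r 0, y⟩ = F ⟨r 0, x⟩ ⟨r 0, x⟩ := by
      intro x
      rw [Finset.sum_eq_single x]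
      · rw [h0, if_pos rfl, one_mul]
      · intro y _ hy
        rw [h0, if_neg (Ne.symm hy), zero_mul]
      · simp
    rw [Finset.sum_congr rfl fun x _ => h x]
    refine Fintype.sum_equiv (Equiv.piUnique fun i : Fin 1 => (r i).Partition) _ _ fun p => ?_
    rw [Finset.univ_eq_empty, Finset.prod_empty, one_mul]
    rfl
  | succ M ih =>
    rw [← (Fin.snocEquiv fun i : Fin (M + 1 + 1) => (r i).Partition).sum_comp,
      Fintype.sum_prod_type, Finset.sum_comm]
    have key := ih (fun k hk => hs k (by omega)) fun x y => ∑ z : (r (M + 1)).Partition, d M y ⟨r (M + 1), z⟩ * F x ⟨r (M + 1), z⟩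
    refine Eq.trans ?_ (key.trans ?_)
    · refine Finset.sum_congr rfl fun p _ => ?_
      rw [Finset.mul_sum]
      refine Finset.sum_congr rfl fun z _ => ?_
      rw [Fin.prod_univ_castSucc, mul_assoc]
      have e1 : ∀ i : Fin (M + 1), (Fin.snocEquiv fun i : Fin (M + 1 + 1) => (r i).Partition) (z, p)
        i.castSucc = p i := fun i => Fin.snoc_castSucc (α := fun i : Fin (M + 1 + 1) =>
          (r i).Partition) z p i
      have e2 : (Fin.snocEquiv fun i : Fin (M + 1 + 1) => (r i).Partition) (z, p)
        (Fin.last (M + 1)) = z := Fin.snoc_last (α := fun i : Fin (M + 1 + 1) =>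
          (r i).Partition) z p
      congr 1
      · refine Finset.prod_congr rfl fun i _ => ?_
        exact congrArg₂ (fun a b => d i ⟨r i, a⟩ ⟨r (i + 1), b⟩) (e1 i.castSucc) (e1 i.succ)
      · exact congrArg₂ (· * ·)
          (congrArg₂ (fun a b => d M ⟨r M, a⟩ ⟨r (M + 1), b⟩) (e1 (Fin.last M)) e2)
          (congrArg₂ (fun a b => F ⟨r 0, a⟩ ⟨r (M + 1), b⟩) (e1 0) e2)
    · refine Finset.sum_congr rfl fun x _ => ?_
      simp_rw [hs M M.lt_succ_self, Finset.mul_sum, Finset.sum_mul]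
      rw [Finset.sum_comm]
      exact Finset.sum_congr rfl fun z _ => Finset.sum_congr rfl fun y _ => (mul_assoc _ _ _).symm

/-- The sum of the periodic weights over all sequences of partitions of prescribed sizes is a trace
of a word in the raising and lowering operators. In the indexing used here `rr k` is the size of
the partition preceding the one of size `s k`, and `rr (k + 1)` that of the partition following
it. -/
theorem sum_weight {q t : ℝ} (H : Params q t) (u : ℝ) (rp rm : ℕ → Specialization) (M : ℕ)
    (s rr : ℕ → ℕ) (hrr : rr 0 = rr (M + 1))
    [Decidable (∀ k < M + 1, rr k ≤ s k ∧ rr (k + 1) ≤ s k)] :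
    ∑ lam : (k : Fin (M + 1)) → (s k).Partition,
      ∑ mu : (k : Fin (M + 1)) → (rr (k + 1)).Partition,
        weight q t u (fun i => rp i) (fun i => rm i) (fun k => ⟨s k, lam k⟩)
          (fun k => ⟨rr (k + 1), mu k⟩) =
      u ^ rr 0 * if ∀ k < M + 1, rr k ≤ s k ∧ rr (k + 1) ≤ s k then
        grTrace q t (rr 0) (blockWord (fun i => lower (rm i) (s i - rr (i + 1)) *
          raise q t (rp i) (s i - rr i)) (M + 1)) else 0 := by
  classical
  set D : Fin (M + 1) → Part → Part → ℝ := fun k l m =>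
    if m.1 ≤ l.1 then form q t (macdonaldP q t m) (lower (rm k) (l.1 - m.1) (macdonaldQ q t l)) else 0
    with hD
  set U : Fin (M + 1) → Part → Part → ℝ := fun k l m =>
    if m.1 ≤ l.1 then form q t (macdonaldP q t l) (raise q t (rp k) (l.1 - m.1) (macdonaldQ q t m))
      else 0 with hU
  have hw : ∀ lam mu : Fin (M + 1) → Part, weight q t u (fun i => rp i) (fun i => rm i) lam mu =
      u ^ (mu (Fin.last M)).1 * ∏ k : Fin (M + 1), (D k (lam k) (mu k) * U k (lam k) (mu (k - 1))) := by
    intro lam mu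
    rw [weight, Fin.top_eq_last, Finset.prod_mul_distrib, Finset.prod_mul_distrib]
    congr 2
    · exact Finset.prod_congr rfl fun k _ => skewQ_eq H _ _ _
    · refine Fintype.prod_equiv (Equiv.addRight 1) _ _ fun k => ?_
      rw [Equiv.coe_addRight, add_sub_cancel_right]
      exact skewP_eq H _ _ _
  simp_rw [hw]
  have hsucc : ∀ i : Fin M, (i.succ - 1 : Fin (M + 1)) = i.castSucc := by
    intro i
    rw [← Fin.coeSucc_eq_succ, add_sub_cancel_right]
  have hzero : (0 - 1 : Fin (M + 1)) = Fin.last M := by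
    rw [sub_eq_iff_eq_add, Fin.last_add_one]
  split_ifs with hcond
  · set L : ℕ → Module.End ℝ SymFun := fun i => lower (rm i) (s i - rr (i + 1)) *
      raise q t (rp i) (s i - rr i) with hLdef
    have hLgr : ∀ k < M + 1, ∀ f ∈ gr (rr k), L k f ∈ gr (rr (k + 1)) := by
      intro k hk f hf
      obtain ⟨h1, h2⟩ := hcond k hk
      have := lower_mem_gr (rm k) (s k - rr (k + 1)) (raise_mem_gr q t (rp k) (s k - rr k) hf)
      change lower (rm k) (s k - rr (k + 1)) (raise q t (rp k) (s k - rr k) f) ∈ _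
      convert this using 2
      push_cast [h1, h2]
      ring
    set G : ℕ → Part → Part → ℝ := fun i x y => form q t (macdonaldP q t y) (L i (macdonaldQ q t x))
      with hG
    -- summation over the upper partitions turns pairs of edges into matrix entries of `L k`
    have hlam : ∀ mu : (k : Fin (M + 1)) → (rr (k + 1)).Partition,
        ∑ lam : (k : Fin (M + 1)) → (s k).Partition, ∏ k : Fin (M + 1),
          (D k ⟨s k, lam k⟩ ⟨rr (k + 1), mu k⟩ *
            U k ⟨s k, lam k⟩ ⟨rr ((k - 1 : Fin (M + 1)) + 1), mu (k - 1)⟩) =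
        (∏ i : Fin M, G (i + 1) ⟨rr (i.castSucc + 1), mu i.castSucc⟩ ⟨rr (i.succ + 1), mu i.succ⟩) *
          G 0 ⟨rr ((Fin.last M : Fin (M + 1)) + 1), mu (Fin.last M)⟩ ⟨rr ((0 : Fin (M + 1)) + 1), mu 0⟩ := by
      intro mu
      have hedge : ∀ (k : Fin (M + 1)) (x : (rr k).Partition) (y : (rr (k + 1)).Partition),
          ∑ l : (s k).Partition, D k ⟨s k, l⟩ ⟨rr (k + 1), y⟩ * U k ⟨s k, l⟩ ⟨rr k, x⟩ =
            G k ⟨rr k, x⟩ ⟨rr (k + 1), y⟩ := by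
        intro k x y
        obtain ⟨h1, h2⟩ := hcond k k.2
        have hgr : raise q t (rp k) (s k - rr k) (macdonaldQ q t ⟨rr k, x⟩) ∈ gr (s k) := by
          convert raise_mem_gr q t (rp k) (s k - rr k) (macdonaldQ_mem_gr q t ⟨rr k, x⟩) using 2
          push_cast [h1]
          ring
        rw [hG, hLdef]
        dsimp only
        rw [Module.End.mul_apply, eq_sum_macdonaldQ H hgr, map_sum, form_sum_right]
        refine Finset.sum_congr rfl fun l _ => ?_
        rw [hD, hU]
        dsimp only
        rw [if_pos h1, if_pos h2, map_smul, form_smul_right, mul_comm]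
      have h3 := Finset.prod_univ_sum (fun k : Fin (M + 1) =>
        (Finset.univ : Finset (s k).Partition)) fun k l =>
          D k ⟨s k, l⟩ ⟨rr (k + 1), mu k⟩ *
            U k ⟨s k, l⟩ ⟨rr ((k - 1 : Fin (M + 1)) + 1), mu (k - 1)⟩
      rw [Fintype.piFinset_univ] at h3
      rw [← h3, Fin.prod_univ_succ, mul_comm]
      congr 1
      · refine Finset.prod_congr rfl fun i _ => ?_
        rw [hsucc]
        exact hedge i.succ _ _
      · rw [hzero]
        have h4 : ∀ (a : ℕ) (ha : a = rr 0) (x : a.Partition) (y : (rr 1).Partition),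
            ∑ l : (s 0).Partition, D 0 ⟨s 0, l⟩ ⟨rr 1, y⟩ * U 0 ⟨s 0, l⟩ ⟨a, x⟩ =
              G 0 ⟨a, x⟩ ⟨rr 1, y⟩ := by
          rintro _ rfl x y
          exact hedge 0 x y
        exact h4 _ hrr.symm _ _
    have hW : ∀ k ≤ M, ∀ f ∈ gr (rr 1), blockWord (fun i => L (i + 1)) k f ∈ gr (rr (k + 1)) := by
      intro k hk f hf
      induction k with
      | zero => exact hf
      | succ k ih => exact hLgr (k + 1) (by omega) _ (ih (by omega))
    have hmu := sum_path (fun i => rr (i + 1)) (fun i => G (i + 1))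
      (fun k x y => form q t (macdonaldP q t y) (blockWord (fun i => L (i + 1)) k (macdonaldQ q t x)))
      M (fun x y => ?_) (fun k hk x z => ?_) (fun x y => G 0 y x)
    · have hu : ∀ (mu : (k : Fin (M + 1)) → (rr (k + 1)).Partition),
          ∑ lam : (k : Fin (M + 1)) → (s k).Partition,
            u ^ rr ((Fin.last M : Fin (M + 1)) + 1) * ∏ k : Fin (M + 1),
          (D k ⟨s k, lam k⟩ ⟨rr (k + 1), mu k⟩ *
            U k ⟨s k, lam k⟩ ⟨rr ((k - 1 : Fin (M + 1)) + 1), mu (k - 1)⟩) = u ^ rr 0 *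
        ((∏ i : Fin M, G (i + 1) ⟨rr (i.castSucc + 1), mu i.castSucc⟩ ⟨rr (i.succ + 1), mu i.succ⟩) *
          G 0 ⟨rr ((Fin.last M : Fin (M + 1)) + 1), mu (Fin.last M)⟩
            ⟨rr ((0 : Fin (M + 1)) + 1), mu 0⟩) := by
        intro mu
        rw [← Finset.mul_sum, hlam]
        exact congrArg (fun n => u ^ n * _) hrr.symm
      rw [Finset.sum_comm]
      refine (Finset.sum_congr rfl fun mu _ => hu mu).trans ?_
      rw [← Finset.mul_sum]
      refine congrArg (fun z => u ^ rr 0 * z) (hmu.trans ?_)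
      rw [Finset.sum_comm, hrr, grTrace_apply]
      refine Finset.sum_congr rfl fun y _ => ?_
      have h0 : L 0 (macdonaldQ q t ⟨rr (M + 1), y⟩) ∈ gr (rr 1) :=
        hLgr 0 (by omega) _ (by rw [hrr]; exact macdonaldQ_mem_gr q t ⟨rr (M + 1), y⟩)
      rw [blockWord_succ_mul, Module.End.mul_apply]
      change _ = form q t _ (blockWord (fun i => L (i + 1)) M (L 0 _))
      rw [eq_sum_macdonaldQ H h0, map_sum, form_sum_right]
      refine Finset.sum_congr rfl fun x _ => ?_
      rw [map_smul, form_smul_right, mul_comm]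
    · change form q t (macdonaldP q t ⟨rr 1, y⟩) (macdonaldQ q t ⟨rr 1, x⟩) = _
      rw [form_macdonaldP_macdonaldQ H]
      refine if_congr ?_ rfl rfl
      simp [eq_comm]
    · change form q t _ (L (k + 1) (blockWord (fun i => L (i + 1)) k _)) = _
      conv_lhs => rw [eq_sum_macdonaldQ H (hW k hk.le _ (macdonaldQ_mem_gr q t ⟨rr 1, x⟩)), map_sum,
        form_sum_right]
      exact Finset.sum_congr rfl fun y _ => by rw [map_smul, form_smul_right]
  · rw [mul_zero]
    refine Finset.sum_eq_zero fun lam _ => Finset.sum_eq_zero fun mu _ => ?_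
    push Not at hcond
    obtain ⟨k, hk, hlt⟩ := hcond
    rw [Finset.prod_eq_zero (Finset.mem_univ ⟨k, hk⟩), mul_zero]
    by_cases h1 : rr k ≤ s k
    · rw [hD]
      dsimp only
      rw [if_neg (by have := hlt h1; omega), zero_mul]
    · rw [hU]
      dsimp only
      rw [if_neg, mul_zero]
      rcases k with _ | k
      · have : (⟨0, hk⟩ : Fin (M + 1)) = 0 := rfl
        rw [this, hzero, Fin.val_last, ← hrr]
        exact h1
      · have : (⟨k + 1, hk⟩ : Fin (M + 1)) = Fin.succ ⟨k, by omega⟩ := rfl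
        rw [this, hsucc]
        exact h1

end PeriodicMacdonald

namespace PeriodicMacdonald

/-! ### Reindexing by the increments of the sizes -/

/-- The degree reached from degree `n` after `k` steps, where step `i` raises the degree by
`e (Sum.inl i)` and then lowers it by `e (Sum.inr i)`. -/
def level (n : ℕ) (e : (ℕ ⊕ ℕ) →₀ ℕ) (k : ℕ) : ℤ :=
  n + ∑ i ∈ Finset.range k, ((e (Sum.inl i) : ℤ) - e (Sum.inr i))

theorem level_zero (n : ℕ) (e : (ℕ ⊕ ℕ) →₀ ℕ) : level n e 0 = n := by simp [level]

theorem level_succ (n : ℕ) (e : (ℕ ⊕ ℕ) →₀ ℕ) (k : ℕ) :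
    level n e (k + 1) = level n e k + e (Sum.inl k) - e (Sum.inr k) := by
  rw [level, level, Finset.sum_range_succ]
  ring

variable {q t : ℝ} {rp rm : ℕ → Specialization}

/-- The operator that performs the steps encoded by `e`. -/
def stepWord (q t : ℝ) (rp rm : ℕ → Specialization) (e : (ℕ ⊕ ℕ) →₀ ℕ) (k : ℕ) :
    Module.End ℝ SymFun :=
  blockWord (fun i => lower (rm i) (e (Sum.inr i)) * raise q t (rp i) (e (Sum.inl i))) k

theorem stepWord_mem_gr {n : ℕ} (e : (ℕ ⊕ ℕ) →₀ ℕ) (k : ℕ) {f : SymFun} (hf : f ∈ gr n) :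
    stepWord q t rp rm e k f ∈ gr (level n e k) := by
  induction k with
  | zero => simpa [level_zero, stepWord, blockWord] using hf
  | succ k ih =>
    rw [level_succ]
    exact lower_mem_gr (rm k) _ (raise_mem_gr q t (rp k) _ ih)

theorem stepWord_eq_zero {n : ℕ} {e : (ℕ ⊕ ℕ) →₀ ℕ} {k m : ℕ} (hkm : k ≤ m)
    (hk : level n e k < 0) {f : SymFun} (hf : f ∈ gr n) : stepWord q t rp rm e m f = 0 := by
  induction m, hkm using Nat.le_induction with
  | base => exact eq_zero_of_mem_gr_neg hk (stepWord_mem_gr e k hf)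
  | succ m _ ih =>
    change (lower (rm m) (e (Sum.inr m)) * raise q t (rp m) (e (Sum.inl m)))
      (stepWord q t rp rm e m f) = 0
    rw [ih, map_zero]

theorem level_of_grTrace_ne_zero {n N : ℕ} {e : (ℕ ⊕ ℕ) →₀ ℕ}
    (h : grTrace q t n (stepWord q t rp rm e N) ≠ 0) :
    (∀ k ≤ N, 0 ≤ level n e k) ∧ level n e N = n := by
  constructor
  · intro k hk
    by_contra hneg
    push Not at hneg
    apply h
    rw [grTrace_apply]
    refine Finset.sum_eq_zero fun l _ => ?_
    rw [stepWord_eq_zero hk hneg (macdonaldQ_mem_gr q t ⟨n, l⟩), form_zero_right]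
  · by_contra hne
    apply h
    rw [grTrace_apply]
    refine Finset.sum_eq_zero fun l _ => ?_
    exact form_eq_zero_of_ne q t (macdonaldP_mem_gr q t ⟨n, l⟩)
      (stepWord_mem_gr e N (macdonaldQ_mem_gr q t ⟨n, l⟩)) (Ne.symm hne)

theorem coeff_traceSeries_word (n N : ℕ) (e : (ℕ ⊕ ℕ) →₀ ℕ)
    [Decidable (∀ j, N ≤ j → e (Sum.inl j) = 0 ∧ e (Sum.inr j) = 0)] :
    MvPowerSeries.coeff e (traceSeries q t n (word (lowerSeries rm) (raiseSeries q t rp) N)) =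
      if ∀ j, N ≤ j → e (Sum.inl j) = 0 ∧ e (Sum.inr j) = 0 then
        grTrace q t n (stepWord q t rp rm e N) else 0 := by
  have h : MvPowerSeries.coeff e (word (lowerSeries rm) (raiseSeries q t rp) N) = _ :=
    coeff_word (fun i => lower (rm i)) (fun i => raise q t (rp i)) N e
  rw [coeff_traceSeries, h]
  split_ifs
  · rfl
  · exact map_zero _

/-- The sum of the periodic weights over partitions of prescribed sizes. -/
def sizeSum (q t u : ℝ) {N : ℕ} [NeZero N] (ρp ρm : Fin N → Specialization)
    (sr : (Fin N → ℕ) × (Fin N → ℕ)) : ℝ :=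
  ∑ lam : (k : Fin N) → (sr.1 k).Partition, ∑ mu : (k : Fin N) → (sr.2 k).Partition,
    weight q t u ρp ρm (fun k => ⟨sr.1 k, lam k⟩) (fun k => ⟨sr.2 k, mu k⟩)

/-- The increments between consecutive sizes `rr 0 ≤ s 0 ≥ rr 1 ≤ s 1 ≥ ⋯` in the first `N`
steps. -/
def increments (N : ℕ) (s rr : ℕ → ℕ) : (ℕ ⊕ ℕ) →₀ ℕ :=
  Finsupp.onFinset (Finset.disjSum (Finset.range N) (Finset.range N))
    (Sum.elim (fun k => if k < N then s k - rr k else 0)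
      fun k => if k < N then s k - rr (k + 1) else 0) (by
    rintro (k | k) h
    · by_contra hk
      simp at hk
      simp [hk] at h
    · by_contra hk
      simp at hk
      simp [hk] at h)

theorem increments_inl (N : ℕ) (s rr : ℕ → ℕ) (k : ℕ) :
    increments N s rr (Sum.inl k) = if k < N then s k - rr k else 0 := rfl

theorem increments_inr (N : ℕ) (s rr : ℕ → ℕ) (k : ℕ) :
    increments N s rr (Sum.inr k) = if k < N then s k - rr (k + 1) else 0 := rfl

theorem level_increments {N : ℕ} {s rr : ℕ → ℕ}
    (h : ∀ k < N, rr k ≤ s k ∧ rr (k + 1) ≤ s k) (k : ℕ) (hk : k ≤ N) :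
    level (rr 0) (increments N s rr) k = rr k := by
  induction k with
  | zero => exact level_zero _ _
  | succ k ih =>
    obtain ⟨h1, h2⟩ := h k hk
    rw [level_succ, ih (by omega), increments_inl, increments_inr, if_pos (show k < N from hk),
      if_pos (show k < N from hk)]
    omega

theorem sizeSum_eq (H : Params q t) (u : ℝ) (M : ℕ) {s rr : ℕ → ℕ} (hrr : rr 0 = rr (M + 1))
    [Decidable (∀ k < M + 1, rr k ≤ s k ∧ rr (k + 1) ≤ s k)] :
    sizeSum q t u (N := M + 1) (fun i => rp i) (fun i => rm i)
      (fun k => s k, fun k => rr (k + 1)) =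
      if ∀ k < M + 1, rr k ≤ s k ∧ rr (k + 1) ≤ s k then
        u ^ rr 0 * MvPowerSeries.coeff (increments (M + 1) s rr)
          (traceSeries q t (rr 0) (word (lowerSeries rm) (raiseSeries q t rp) (M + 1))) else 0 := by
  classical
  refine (sum_weight H u rp rm M s rr hrr).trans ?_
  rw [coeff_traceSeries_word, mul_ite, mul_zero]
  refine if_congr Iff.rfl ?_ rfl
  rw [if_pos]
  · refine congrArg (fun L => u ^ rr 0 * grTrace q t (rr 0) L) (blockWord_congr fun i hi => ?_)
    rw [increments_inl, increments_inr, if_pos hi, if_pos hi]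
  · intro j hj
    rw [increments_inl, increments_inr, if_neg (by omega), if_neg (by omega)]
    exact ⟨rfl, rfl⟩

/-- The sum over all sizes is a sum over the top size `n` and the increments `e`. -/
theorem hasSum_sizeSum (H : Params q t) (u : ℝ) (M : ℕ) (V : ℝ)
    (h : HasSum (fun p : ℕ × ((ℕ ⊕ ℕ) →₀ ℕ) => u ^ p.1 * MvPowerSeries.coeff p.2
      (traceSeries q t p.1 (word (lowerSeries rm) (raiseSeries q t rp) (M + 1)))) V) :
    HasSum (sizeSum q t u (N := M + 1) (fun i => rp i) fun i => rm i) V := by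
  classical
  set g : ℕ × ((ℕ ⊕ ℕ) →₀ ℕ) → ℝ := fun p => u ^ p.1 * MvPowerSeries.coeff p.2
      (traceSeries q t p.1 (word (lowerSeries rm) (raiseSeries q t rp) (M + 1))) with hg
  have hsupp : ∀ p, g p ≠ 0 → (∀ j, M + 1 ≤ j → p.2 (Sum.inl j) = 0 ∧ p.2 (Sum.inr j) = 0) ∧
      (∀ k ≤ M + 1, 0 ≤ level p.1 p.2 k) ∧ level p.1 p.2 (M + 1) = p.1 := by
    intro p hp
    have h1 := right_ne_zero_of_mul hp
    rw [coeff_traceSeries_word] at h1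
    split_ifs at h1 with h2
    · exact ⟨h2, level_of_grTrace_ne_zero h1⟩
    · exact absurd rfl h1
  -- `rr p k` are the sizes after lowering and `ss p k` those after raising. On the support of `g`
  -- the levels are non-negative and return to `n`, so the truncation loses nothing.
  set rr : ℕ × ((ℕ ⊕ ℕ) →₀ ℕ) → ℕ → ℕ := fun p k => (level p.1 p.2 k).toNat with hrr
  set ss : ℕ × ((ℕ ⊕ ℕ) →₀ ℕ) → ℕ → ℕ := fun p k => rr p k + p.2 (Sum.inl k) with hss
  have hlev : ∀ p, g p ≠ 0 → ∀ k ≤ M + 1, (rr p k : ℤ) = level p.1 p.2 k := fun p hp k hk =>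
    Int.toNat_of_nonneg ((hsupp p hp).2.1 k hk)
  have hr0 : ∀ p, rr p 0 = p.1 := fun p => by simp [hrr, level_zero]
  have hrN : ∀ p, g p ≠ 0 → rr p (M + 1) = p.1 := fun p hp => by
    simp [hrr, (hsupp p hp).2.2]
  have hstep : ∀ p, g p ≠ 0 → ∀ k < M + 1, rr p (k + 1) + p.2 (Sum.inr k) = ss p k := by
    intro p hp k hk
    have h1 := hlev p hp k hk.le
    have h2 := hlev p hp (k + 1) hk
    rw [level_succ] at h2
    simp only [hss]
    omega
  have hinc : ∀ p, g p ≠ 0 → increments (M + 1) (ss p) (rr p) = p.2 := by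
    intro p hp
    have h1 := (hsupp p hp).1
    ext (k | k)
    · rw [increments_inl]
      split_ifs with hk
      · simp [hss]
      · exact (h1 k (by omega)).1.symm
    · rw [increments_inr]
      split_ifs with hk
      · rw [← hstep p hp k hk]
        simp
      · exact (h1 k (by omega)).2.symm
  refine (hasSum_iff_hasSum_of_ne_zero_bij
    (fun p : Function.support g => ((fun k : Fin (M + 1) => ss p.1 k,
      fun k : Fin (M + 1) => rr p.1 (k + 1)) : (Fin (M + 1) → ℕ) × (Fin (M + 1) → ℕ)))
      ?_ ?_ ?_).2 h
  · rintro ⟨p, hp⟩ ⟨p', hp'⟩ hpp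
    have h1 : ∀ k < M + 1, ss p k = ss p' k := fun k hk =>
      congrFun (congrArg Prod.fst hpp) ⟨k, hk⟩
    have h2 : ∀ k < M + 1, rr p (k + 1) = rr p' (k + 1) := fun k hk =>
      congrFun (congrArg Prod.snd hpp) ⟨k, hk⟩
    have h3 : p.1 = p'.1 := by rw [← hrN p hp, ← hrN p' hp', h2 M (by omega)]
    have h4 : ∀ k < M + 1, rr p k = rr p' k := by
      rintro (_ | k) hk
      · rw [hr0, hr0, h3]
      · exact h2 k (by omega)
    refine Subtype.ext (Prod.ext h3 ?_)
    dsimp only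
    rw [← hinc p hp, ← hinc p' hp']
    ext (k | k)
    · rw [increments_inl, increments_inl]
      split_ifs with hk
      · rw [h1 k hk, h4 k hk]
      · rfl
    · rw [increments_inr, increments_inr]
      split_ifs with hk
      · rw [h1 k hk, h2 k hk]
      · rfl
  · rintro ⟨s, r⟩ hsr
    obtain ⟨s', hs'⟩ : ∃ s' : ℕ → ℕ, s = fun k : Fin (M + 1) => s' k :=
      ⟨fun k => s (Fin.ofNat (M + 1) k), by ext k; simp⟩
    obtain ⟨r', hr', hcyc⟩ : ∃ r' : ℕ → ℕ, (r = fun k : Fin (M + 1) => r' (k + 1)) ∧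
        r' 0 = r' (M + 1) := by
      refine ⟨fun k => r (Fin.ofNat (M + 1) k - 1), ?_, ?_⟩
      · ext k
        congr 1
        rw [eq_sub_iff_add_eq]
        ext
        simp [Fin.val_add]
      · have h0 : Fin.ofNat (M + 1) 0 = Fin.ofNat (M + 1) (M + 1) := by
          ext
          simp
        exact congrArg (fun x => r (x - 1)) h0
    subst hs' hr'
    rw [Function.mem_support, sizeSum_eq H u M hcyc] at hsr
    split_ifs at hsr with hc
    · have hp : g (r' 0, increments (M + 1) s' r') ≠ 0 := hsr
      have h1 : ∀ k ≤ M + 1, rr (r' 0, increments (M + 1) s' r') k = r' k := by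
        intro k hk
        simp only [hrr]
        rw [level_increments hc k hk, Int.toNat_natCast]
      refine ⟨⟨_, hp⟩, ?_⟩
      refine Prod.ext (funext fun k => ?_) (funext fun k => ?_)
      · simp only [hss]
        rw [h1 k k.2.le, increments_inl, if_pos k.2]
        exact Nat.add_sub_cancel' (hc k k.2).1
      · exact h1 _ k.2
    · exact absurd rfl hsr
  · rintro ⟨p, hp⟩
    dsimp only
    rw [sizeSum_eq H u M ((hr0 p).trans (hrN p hp).symm), if_pos, hinc p hp, hr0 p]
    intro k hk
    have := hstep p hp k hk
    constructor
    · simp [hss]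
    · omega

end PeriodicMacdonald

namespace PeriodicMacdonald

/-! ### Values of series with non-negative coefficients -/

open scoped ENNReal

section WeightedSum

variable {A : Type*} [AddCommMonoid A]

/-- The value `∑ e, a e * c ^ w e`, in the extended non-negative reals, of the series with
coefficients `a` at a variable `c` of weight `w`. Negative coefficients count as zero. -/
def wsum (w : A →+ ℕ) (c : ℝ≥0∞) (a : A → ℝ) : ℝ≥0∞ := ∑' e, c ^ w e * ENNReal.ofReal (a e)

theorem wsum_mul [Finset.HasAntidiagonal A] (w : A →+ ℕ) (c : ℝ≥0∞) {a b : A → ℝ}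
    (ha : ∀ e, 0 ≤ a e) (hb : ∀ e, 0 ≤ b e) :
    wsum w c (fun e => ∑ p ∈ Finset.HasAntidiagonal.antidiagonal e, a p.1 * b p.2) =
      wsum w c a * wsum w c b := by
  rw [wsum, wsum, wsum, ← ENNReal.tsum_mul_right]
  simp_rw [← ENNReal.tsum_mul_left]
  rw [← ENNReal.tsum_prod, ← Finset.HasAntidiagonal.sigmaAntidiagonalEquivProd.tsum_eq,
    ENNReal.tsum_sigma']
  refine tsum_congr fun e => ?_
  have h1 := Finset.tsum_subtype (Finset.HasAntidiagonal.antidiagonal e) fun p : A × A =>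
    c ^ w p.1 * ENNReal.ofReal (a p.1) * (c ^ w p.2 * ENNReal.ofReal (b p.2))
  refine Eq.trans ?_ h1.symm
  rw [ENNReal.ofReal_sum_of_nonneg fun p _ => mul_nonneg (ha _) (hb _), Finset.mul_sum]
  refine Finset.sum_congr rfl fun p hp => ?_
  rw [Finset.HasAntidiagonal.mem_antidiagonal] at hp
  rw [← hp, map_add, pow_add, ENNReal.ofReal_mul (ha _)]
  ring

theorem wsum_mono (w : A →+ ℕ) {c c' : ℝ≥0∞} (h : c ≤ c') (a : A → ℝ) :
    wsum w c a ≤ wsum w c' a :=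
  ENNReal.tsum_le_tsum fun e => by gcongr

/-- A series whose support lies in the range of an injective sequence of exponents. -/
theorem wsum_of_support (w : A →+ ℕ) (c : ℝ≥0∞) {a : A → ℝ} {i : ℕ → A}
    (hi : Function.Injective i) (h : ∀ e, a e ≠ 0 → e ∈ Set.range i) :
    wsum w c a = ∑' d, c ^ w (i d) * ENNReal.ofReal (a (i d)) := by
  rw [wsum, ← hi.tsum_eq]
  intro e he
  refine h e fun h0 => he ?_
  simp [h0]

end WeightedSum

theorem wsum_coeff_mul {σ : Type*} (w : (σ →₀ ℕ) →+ ℕ) (c : ℝ≥0∞) {F G : MvPowerSeries σ ℝ}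
    (hF : CoeffNonneg F) (hG : CoeffNonneg G) :
    wsum w c (fun e => MvPowerSeries.coeff e (F * G)) =
      wsum w c (fun e => MvPowerSeries.coeff e F) * wsum w c (fun e => MvPowerSeries.coeff e G) := by
  classical
  rw [← wsum_mul w c hF hG]
  simp_rw [MvPowerSeries.coeff_mul]

theorem wsum_coeff_one {σ : Type*} (w : (σ →₀ ℕ) →+ ℕ) (c : ℝ≥0∞) :
    wsum w c (fun e => MvPowerSeries.coeff e (1 : MvPowerSeries σ ℝ)) = 1 := by
  classical
  rw [wsum, tsum_eq_single 0]
  · simp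
  · intro e he
    rw [MvPowerSeries.coeff_one, if_neg he, ENNReal.ofReal_zero, mul_zero]

theorem wsum_coeff_prod {σ ι : Type*} (w : (σ →₀ ℕ) →+ ℕ) (c : ℝ≥0∞) {F : ι → MvPowerSeries σ ℝ}
    (s : Finset ι) (hF : ∀ i ∈ s, CoeffNonneg (F i)) :
    wsum w c (fun e => MvPowerSeries.coeff e (∏ i ∈ s, F i)) =
      ∏ i ∈ s, wsum w c (fun e => MvPowerSeries.coeff e (F i)) := by
  classical
  induction s using Finset.induction_on with
  | empty => exact wsum_coeff_one w c
  | insert i s hi ih =>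
    rw [Finset.prod_insert hi, Finset.prod_insert hi, wsum_coeff_mul w c
      (hF i (Finset.mem_insert_self i s))
      (CoeffNonneg.prod s fun j hj => hF j (Finset.mem_insert_of_mem hj)),
      ih fun j hj => hF j (Finset.mem_insert_of_mem hj)]

/-- The value at `c` of the series in one variable with coefficients `a`. -/
def value (c : ℝ≥0∞) (a : ℕ → ℝ) : ℝ≥0∞ := ∑' d, c ^ d * ENNReal.ofReal (a d)

theorem value_mul (c : ℝ≥0∞) {a b : ℕ → ℝ} (ha : ∀ e, 0 ≤ a e) (hb : ∀ e, 0 ≤ b e) :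
    value c (fun e => ∑ p ∈ Finset.HasAntidiagonal.antidiagonal e, a p.1 * b p.2) =
      value c a * value c b :=
  wsum_mul (AddMonoidHom.id ℕ) c ha hb

theorem value_pow_mul {u : ℝ} (hu : 0 ≤ u) (c : ℝ≥0∞) (a : ℕ → ℝ) :
    value c (fun d => u ^ d * a d) = value (ENNReal.ofReal u * c) a := by
  refine tsum_congr fun d => ?_
  rw [ENNReal.ofReal_mul (pow_nonneg hu d), ENNReal.ofReal_pow hu, mul_pow]
  ring

theorem one_le_value (c : ℝ≥0∞) {a : ℕ → ℝ} (h0 : a 0 = 1) : 1 ≤ value c a := by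
  refine le_trans ?_ (ENNReal.le_tsum 0)
  simp [h0]

theorem value_mul_le {a : ℕ → ℝ} (h0 : a 0 = 1) {v : ℝ≥0∞} (hv : v ≤ 1) (c : ℝ≥0∞) :
    value (v * c) a ≤ 1 + v * value c a := by
  rw [value, tsum_eq_zero_add' ENNReal.summable]
  refine add_le_add (by simp [h0]) ?_
  rw [value, ← ENNReal.tsum_mul_left]
  refine le_trans (ENNReal.tsum_le_tsum fun d => ?_)
    (ENNReal.tsum_comp_le_tsum_of_injective (add_left_injective 1) _)
  rw [mul_pow, mul_assoc]
  gcongr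
  exact pow_le_of_le_one zero_le hv (by omega)

theorem wsum_pairVar {x y : ℕ ⊕ ℕ} (hxy : x ≠ y) {w : ((ℕ ⊕ ℕ) →₀ ℕ) →+ ℕ}
    (hw : ∀ d, w (Finsupp.single x d + Finsupp.single y d) = d) (c : ℝ≥0∞) (h : ℕ → ℝ) :
    wsum w c (fun e => MvPowerSeries.coeff e (pairVar x y h)) = value c h := by
  have hx : ∀ d : ℕ, (Finsupp.single x d + Finsupp.single y d : (ℕ ⊕ ℕ) →₀ ℕ) x = d := by
    intro d
    simp [Finsupp.single_eq_of_ne hxy]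
  rw [wsum_of_support w c (i := fun d => Finsupp.single x d + Finsupp.single y d)]
  · refine tsum_congr fun d => ?_
    rw [hw, coeff_pairVar, hx, if_pos rfl]
  · intro d d' hd
    rw [← hx d, ← hx d']
    exact DFunLike.congr_fun hd x
  · intro e he
    rw [coeff_pairVar] at he
    split_ifs at he with h1
    · exact ⟨e x, h1.symm⟩
    · exact absurd rfl he

/-! ### The specialized kernels -/

/-- The components of the specialized kernel with parameter `u`. -/
def kernelSum (q t u : ℝ) (θ η : Specialization) (d : ℕ) : ℝ :=
  hsum (fun r => kerCoeff q t u r * (θ (psum r) * η (psum r))) d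

variable {q t u : ℝ} {θ η : Specialization}

theorem kernelSum_zero_eq (θ η : Specialization) : kernelSum q t 0 θ η = pairing q t θ η := rfl

theorem kernelSum_zero_right (u : ℝ) (θ η : Specialization) : kernelSum q t u θ η 0 = 1 :=
  hsum_zero_right _

theorem kerCoeff_eq_add (H : Params q t) (hu0 : 0 ≤ u) (hu1 : u < 1) {r : ℕ} (hr : r ≠ 0) :
    kerCoeff q t u r = kerCoeff q t 0 r + u ^ r * kerCoeff q t u r := by
  have h1 : 1 - q ^ r ≠ 0 := (sub_pos.2 (pow_lt_one₀ H.q_pos.le H.q_lt hr)).ne'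
  have h2 : 1 - u ^ r ≠ 0 := (sub_pos.2 (pow_lt_one₀ hu0 hu1 hr)).ne'
  rw [kerCoeff, kerCoeff, zero_pow hr]
  field_simp
  ring

/-- The factorization of the kernel with parameter `u`, in its specialized form. -/
theorem kernelSum_eq_sum (H : Params q t) (hu0 : 0 ≤ u) (hu1 : u < 1) (d : ℕ) :
    kernelSum q t u θ η d = ∑ p ∈ Finset.HasAntidiagonal.antidiagonal d,
      pairing q t θ η p.1 * (u ^ p.2 * kernelSum q t u θ η p.2) := by
  have h : kernelSum q t u θ η d = hsum (fun r => kerCoeff q t 0 r * (θ (psum r) * η (psum r)) +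
      u ^ r * (kerCoeff q t u r * (θ (psum r) * η (psum r)))) d :=
    hsum_congr (fun r hr => by
      conv_lhs => rw [kerCoeff_eq_add H hu0 hu1 hr]
      ring) d
  rw [h, hsum_add]
  refine Finset.sum_congr rfl fun p _ => ?_
  rw [hsum_pow_mul]
  rfl

/-- From `kernel u = kernel 0 * (kernel u with one variable scaled by u)` the component of degree `d`
times `1 - u ^ d` is a combination of components of lower degree with non-negative coefficients. -/
theorem kernelSum_nonneg (H : Params q t) (hu0 : 0 ≤ u) (hu1 : u < 1)
    (hθ : MacdonaldPositive q t θ) (hη : MacdonaldPositive q t η) (d : ℕ) :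
    0 ≤ kernelSum q t u θ η d := by
  induction d using Nat.strong_induction_on with
  | _ d ih =>
  rcases Nat.eq_zero_or_pos d with rfl | hd
  · rw [kernelSum_zero_right]
    exact zero_le_one
  · have h := kernelSum_eq_sum (θ := θ) (η := η) H hu0 hu1 d
    rw [← Finset.add_sum_erase _ _ (show (0, d) ∈ Finset.HasAntidiagonal.antidiagonal d by simp),
      ← kernelSum_zero_eq, kernelSum_zero_right, one_mul] at h
    have h1 : 0 ≤ ∑ p ∈ (Finset.HasAntidiagonal.antidiagonal d).erase (0, d),
        kernelSum q t 0 θ η p.1 * (u ^ p.2 * kernelSum q t u θ η p.2) := by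
      refine Finset.sum_nonneg fun p hp => ?_
      rw [Finset.mem_erase, Finset.HasAntidiagonal.mem_antidiagonal] at hp
      have hlt : p.2 < d := by
        by_contra hge
        exact hp.1 (Prod.ext (by dsimp only; omega) (by dsimp only; omega))
      exact mul_nonneg (pairing_nonneg H hθ hη _) (mul_nonneg (pow_nonneg hu0 _) (ih _ hlt))
    -- The term of `(0, d)` is `u ^ d` times the left-hand side.
    have h2 : 0 < 1 - u ^ d := sub_pos.2 (pow_lt_one₀ hu0 hu1 hd.ne')
    have h3 : 0 ≤ (1 - u ^ d) * kernelSum q t u θ η d := by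
      dsimp only at h
      linarith
    exact nonneg_of_mul_nonneg_right h3 h2

/-- The functional equation `F(c) = H(c) F(u c)` of the specialized kernel. -/
theorem value_kernelSum (H : Params q t) (hu0 : 0 ≤ u) (hu1 : u < 1)
    (hθ : MacdonaldPositive q t θ) (hη : MacdonaldPositive q t η) (c : ℝ≥0∞) :
    value c (kernelSum q t u θ η) =
      value c (pairing q t θ η) * value (ENNReal.ofReal u * c) (kernelSum q t u θ η) := by
  rw [← value_pow_mul hu0, ← value_mul c (pairing_nonneg H hθ hη) fun d =>
    mul_nonneg (pow_nonneg hu0 d) (kernelSum_nonneg H hu0 hu1 hθ hη d)]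
  exact congrArg _ (funext fun d => kernelSum_eq_sum H hu0 hu1 d)

theorem specComponent_kernel (H : Params q t) (hu0 : 0 ≤ u) (hu1 : u < 1) (d : ℕ × ℕ) :
    specComponent (kernel q t u) θ η d = if d.1 = d.2 then kernelSum q t u θ η d.1 else 0 := by
  rw [kernel_eq_expSeries H hu0 hu1, specComponent_expSeries]
  rfl

theorem specComponent_kernel_quotient (H : Params q t) (hu0 : 0 ≤ u) (hu1 : u < 1) (d : ℕ × ℕ) :
    specComponent (kernel q t u * (kernel q t 0)⁻¹) θ η d =
      if d.1 = d.2 then u ^ d.1 * kernelSum q t u θ η d.1 else 0 := by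
  rw [pairKernel_quotient_eq_expSeries H hu0 hu1, specComponent_expSeries]
  simp_rw [mul_assoc]
  rw [hsum_pow_mul]
  rfl

theorem hasSum_diagonal_iff {a : ℕ → ℝ} {V : ℝ} :
    HasSum (fun d : ℕ × ℕ => if d.1 = d.2 then a d.1 else 0) V ↔ HasSum a V := by
  have hi : Function.Injective fun d : ℕ => (d, d) := fun a b h => congrArg Prod.fst h
  rw [← hi.hasSum_iff]
  · simp [Function.comp_def]
  · rintro ⟨d1, d2⟩ hd
    refine if_neg ?_
    intro h
    exact hd ⟨d1, Prod.ext rfl h⟩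

theorem summable_iff_value_ne_top {a : ℕ → ℝ} (ha : ∀ d, 0 ≤ a d) :
    Summable a ↔ value 1 a ≠ ⊤ := by
  have h : value 1 a = ∑' d, ENNReal.ofReal (a d) := by simp [value]
  rw [h]
  refine ⟨fun hs => hs.tsum_ofReal_ne_top, fun hs => ?_⟩
  have := ENNReal.summable_toReal hs
  simpa [ENNReal.toReal_ofReal (ha _)] using this

theorem specConverges_iff {F : Series2} {a : ℕ → ℝ} (ha : ∀ d, 0 ≤ a d)
    (hF : ∀ d, specComponent F θ η d = if d.1 = d.2 then a d.1 else 0) :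
    SpecConverges F θ η ↔ value 1 a ≠ ⊤ := by
  rw [← summable_iff_value_ne_top ha, SpecConverges, funext hF, Summable, Summable]
  exact exists_congr fun V => hasSum_diagonal_iff

theorem ofReal_specValue {F : Series2} {a : ℕ → ℝ} (ha : ∀ d, 0 ≤ a d)
    (hF : ∀ d, specComponent F θ η d = if d.1 = d.2 then a d.1 else 0)
    (hc : SpecConverges F θ η) : ENNReal.ofReal (specValue F θ η) = value 1 a := by
  have hs := (summable_iff_value_ne_top ha).2 ((specConverges_iff ha hF).1 hc)
  rw [specValue, funext hF, (hasSum_diagonal_iff.2 hs.hasSum).tsum_eq,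
    ENNReal.ofReal_tsum_of_nonneg ha hs]
  simp [value]

theorem specValue_nonneg {F : Series2} {a : ℕ → ℝ} (ha : ∀ d, 0 ≤ a d)
    (hF : ∀ d, specComponent F θ η d = if d.1 = d.2 then a d.1 else 0) :
    0 ≤ specValue F θ η := by
  refine tsum_nonneg fun d => ?_
  rw [hF]
  split_ifs
  · exact ha _
  · exact le_rfl

end PeriodicMacdonald

namespace PeriodicMacdonald

open scoped ENNReal Topology

/-! ### The generating function of partitions -/

/-- The size of the partition with multiplicities `m`. -/
def partWeight : (ℕ →₀ ℕ) →+ ℕ := Finsupp.weight fun k => k + 1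

theorem partWeight_single (k d : ℕ) : partWeight (Finsupp.single k d) = d * (k + 1) := by
  simp [partWeight, Finsupp.weight_apply]

theorem fst_expEquiv (m : ℕ →₀ ℕ) : (expEquiv m).1 = partWeight m := by
  change (m.toMultiset.map Nat.succ).sum = partWeight m
  induction m using Finsupp.induction_linear with
  | zero => simp
  | add f g hf hg => rw [map_add, Multiset.map_add, Multiset.sum_add, hf, hg, map_add]
  | single k d =>
    rw [Finsupp.toMultiset_single, Multiset.map_nsmul, Multiset.map_singleton, Multiset.sum_nsmul,
      Multiset.sum_singleton, smul_eq_mul, partWeight_single]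

theorem tsum_part (f : ℕ → ℝ≥0∞) :
    ∑' n, Fintype.card n.Partition * f n = ∑' m : ℕ →₀ ℕ, f (partWeight m) := by
  have h : ∑' l : Part, f l.1 = ∑' n, Fintype.card n.Partition * f n := by
    rw [ENNReal.tsum_sigma']
    refine tsum_congr fun n => ?_
    rw [tsum_fintype]
    simp
  rw [← h, ← expEquiv.tsum_eq]
  exact tsum_congr fun m => by rw [fst_expEquiv]

/-- The generating series of the partitions with parts at most `K`, one variable for each size of
the parts. -/
theorem coeff_blockWord_one (K : ℕ) (e : ℕ →₀ ℕ) [Decidable (∀ j, K ≤ j → e j = 0)] :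
    MvPowerSeries.coeff e (blockWord (fun k => inVar k fun _ => (1 : ℝ)) K) =
      if ∀ j, K ≤ j → e j = 0 then 1 else 0 := by
  classical
  induction K generalizing e with
  | zero =>
    rw [blockWord, MvPowerSeries.coeff_one]
    refine if_congr ⟨fun h j _ => by simp [h], fun h => ?_⟩ rfl rfl
    ext j
    exact h j (Nat.zero_le j)
  | succ K ih =>
    rw [blockWord, coeff_inVar_mul, one_mul, ih]
    · refine if_congr ?_ rfl rfl
      constructor
      · intro h j hj
        have := h j (by omega)
        rwa [Finsupp.erase_ne (by omega)] at this
      · intro h j hj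
        rcases hj.eq_or_lt with rfl | hj
        · simp
        · rw [Finsupp.erase_ne (by omega)]
          exact h j hj
    · intro e he
      rw [ih, if_neg fun h => he (h K le_rfl)]

theorem wsum_blockWord_one (c : ℝ≥0∞) (K : ℕ) :
    wsum partWeight c (fun e => MvPowerSeries.coeff e
      (blockWord (fun k => inVar k fun _ => (1 : ℝ)) K)) =
      ∏ k ∈ Finset.range K, (1 - c ^ (k + 1))⁻¹ := by
  have hnn : ∀ k : ℕ, CoeffNonneg (inVar k fun _ => (1 : ℝ)) := by
    intro k e
    rw [coeff_inVar]
    split_ifs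
    · exact zero_le_one
    · exact le_rfl
  have hB : ∀ K, CoeffNonneg (blockWord (fun k => inVar k fun _ => (1 : ℝ)) K) := by
    classical
    intro K e
    rw [coeff_blockWord_one]
    split_ifs
    · exact zero_le_one
    · exact le_rfl
  induction K with
  | zero => exact wsum_coeff_one _ _
  | succ K ih =>
    rw [blockWord, wsum_coeff_mul _ _ (hnn K) (hB K), ih, Finset.prod_range_succ, mul_comm]
    congr 1
    rw [wsum_of_support partWeight c (i := Finsupp.single K) (Finsupp.single_injective K),
      ← ENNReal.tsum_geometric]
    · refine tsum_congr fun d => ?_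
      rw [partWeight_single, coeff_inVar, if_pos (by simp), ENNReal.ofReal_one, mul_one, mul_comm,
        pow_mul]
    · intro e he
      rw [coeff_inVar] at he
      split_ifs at he with h1
      · exact ⟨e K, h1.symm⟩
      · exact absurd rfl he

theorem tendsto_prod_partitions (c : ℝ≥0∞) :
    Filter.Tendsto (fun K => ∏ k ∈ Finset.range K, (1 - c ^ (k + 1))⁻¹) Filter.atTop
      (𝓝 (∑' n, Fintype.card n.Partition * c ^ n)) := by
  classical
  rw [tsum_part fun n => c ^ n]
  simp_rw [← wsum_blockWord_one]
  have hterm : ∀ (K : ℕ) (e : ℕ →₀ ℕ), c ^ partWeight e * ENNReal.ofReal (MvPowerSeries.coeff e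
      (blockWord (fun k => inVar k fun _ => (1 : ℝ)) K)) =
      if ∀ j, K ≤ j → e j = 0 then c ^ partWeight e else 0 := by
    intro K e
    rw [coeff_blockWord_one]
    split_ifs <;> simp
  have hmono : Monotone fun K => wsum partWeight c (fun e => MvPowerSeries.coeff e
      (blockWord (fun k => inVar k fun _ => (1 : ℝ)) K)) := by
    intro K K' hK
    refine ENNReal.tsum_le_tsum fun e => ?_
    rw [hterm, hterm]
    split_ifs with h1 h2
    · exact le_rfl
    · exact absurd (fun j hj => h1 j (hK.trans hj)) h2
    · exact zero_le
    · exact le_rfl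
  have hsup : ⨆ K, wsum partWeight c (fun e => MvPowerSeries.coeff e
      (blockWord (fun k => inVar k fun _ => (1 : ℝ)) K)) = ∑' m : ℕ →₀ ℕ, c ^ partWeight m := by
    refine le_antisymm (iSup_le fun K => ENNReal.tsum_le_tsum fun e => ?_) ?_
    · rw [hterm]
      split_ifs
      · exact le_rfl
      · exact zero_le
    · rw [ENNReal.tsum_eq_iSup_sum]
      refine iSup_le fun S => ?_
      obtain ⟨K, hK⟩ : ∃ K, ∀ e ∈ S, ∀ j, K ≤ j → e j = 0 := by
        refine ⟨(S.biUnion fun e => e.support).sup id + 1, fun e he j hj => ?_⟩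
        by_contra h0
        have : j ≤ (S.biUnion fun e => e.support).sup id :=
          Finset.le_sup (f := id) (Finset.mem_biUnion.2 ⟨e, he, Finsupp.mem_support_iff.2 h0⟩)
        omega
      refine le_trans ?_ (le_iSup _ K)
      refine le_trans (Finset.sum_le_sum fun e he => ?_) (ENNReal.sum_le_tsum S)
      rw [hterm, if_pos (hK e he)]
  rw [← hsup]
  exact tendsto_atTop_iSup hmono

/-- Euler's product for the generating function of partitions. -/
theorem tsum_partitions {u : ℝ} (hu0 : 0 < u) (hu1 : u < 1) :
    0 < qPoch u ![u] ∧ ∑' n, (Fintype.card n.Partition : ℝ≥0∞) * ENNReal.ofReal u ^ n =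
      ENNReal.ofReal (qPoch u ![u])⁻¹ := by
  have hq : qPoch u ![u] = ∏' k : ℕ, (1 + -u ^ (k + 1)) := by
    rw [qPoch, ← (Equiv.funUnique (Fin 1) ℕ).symm.tprod_eq]
    refine tprod_congr fun k => ?_
    simp [pow_succ, sub_eq_add_neg]
  have hs : Summable fun k : ℕ => ‖-u ^ (k + 1)‖ := by
    simp_rw [norm_neg, norm_pow, pow_succ]
    exact (summable_geometric_of_lt_one (norm_nonneg u)
      (by rwa [Real.norm_of_nonneg hu0.le])).mul_right _
  have hlt : ∀ k : ℕ, u ^ (k + 1) < 1 := fun k => pow_lt_one₀ hu0.le hu1 k.succ_ne_zero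
  have ht := (multipliable_one_add_of_summable hs).hasProd.tendsto_prod_nat
  rw [← hq] at ht
  have hne : qPoch u ![u] ≠ 0 := by
    rw [hq]
    exact tprod_one_add_ne_zero_of_summable (fun k => by have := hlt k; linarith) hs
  have hpos : 0 < qPoch u ![u] := by
    refine lt_of_le_of_ne (ge_of_tendsto' ht fun K => Finset.prod_nonneg fun k _ => ?_) hne.symm
    have := hlt k
    linarith
  refine ⟨hpos, ?_⟩
  refine tendsto_nhds_unique (tendsto_prod_partitions (ENNReal.ofReal u)) ?_
  have h2 := ENNReal.tendsto_ofReal (ht.inv₀ hne)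
  refine h2.congr fun K => ?_
  rw [← Finset.prod_inv_distrib, ENNReal.ofReal_prod_of_nonneg]
  · refine Finset.prod_congr rfl fun k _ => ?_
    have := hlt k
    rw [ENNReal.ofReal_inv_of_pos (by linarith), ← ENNReal.ofReal_pow hu0.le, ← ENNReal.ofReal_one,
      ← ENNReal.ofReal_sub _ (pow_nonneg hu0.le _), sub_eq_add_neg]
  · intro k _
    have := hlt k
    rw [inv_nonneg]
    linarith

end PeriodicMacdonald

namespace PeriodicMacdonald

open scoped ENNReal Topology

/-! ### Summation of the traces -/

variable {q t : ℝ} {rp rm : ℕ → Specialization}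

/-- The product of all the scalar series arising from restoring the normal order. -/
def fullPair (q t : ℝ) (rp rm : ℕ → Specialization) (N : ℕ) : MvPowerSeries (ℕ ⊕ ℕ) ℝ :=
  ∏ j ∈ Finset.range N, ∏ i ∈ Finset.range N, pairSeries q t rp rm i j

theorem wsum_pairSeries (c : ℝ≥0∞) (i j : ℕ) :
    wsum ydeg c (fun e => MvPowerSeries.coeff e (pairSeries q t rp rm i j)) =
      value c (pairing q t (rp i) (rm j)) :=
  wsum_pairVar (by simp)
    (fun d => by rw [map_add, ydeg_single_inr, ydeg_single_inl, add_zero]) c _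

/-- The sum of `u ^ n` times the traces in degree `n`, evaluated at `c` and weighted by `χ n`. -/
def traceSum (q t : ℝ) (rp rm : ℕ → Specialization) (N : ℕ) (U : ℝ≥0∞) (χ : ℕ → ℝ≥0∞)
    (c : ℝ≥0∞) : ℝ≥0∞ :=
  ∑' n, χ n * (U ^ n * wsum ydeg c fun e => MvPowerSeries.coeff e (normalTrace q t rp rm N n))

/-- The recursion for the traces, summed over all degrees. -/
theorem traceSum_eq (H : Params q t) (N : ℕ) (U : ℝ≥0∞) (χ : ℕ → ℝ≥0∞) (c : ℝ≥0∞) :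
    traceSum q t rp rm N U χ c = ∑' m, ∑' e, χ (m + ydeg e) * (U ^ m * ((U * c) ^ ydeg e *
      ENNReal.ofReal (MvPowerSeries.coeff e
        (fullPair q t rp rm N * normalTrace q t rp rm N m)))) := by
  have h1 : traceSum q t rp rm N U χ c = ∑' e, ∑' n, χ n * (U ^ n * (c ^ ydeg e *
      ENNReal.ofReal (MvPowerSeries.coeff e (normalTrace q t rp rm N n)))) := by
    rw [traceSum, ENNReal.tsum_comm]
    simp_rw [wsum, ENNReal.tsum_mul_left]
  rw [h1, ENNReal.tsum_comm (α := ℕ)]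
  refine tsum_congr fun e => ?_
  rw [← (add_left_injective (ydeg e)).tsum_eq]
  · refine tsum_congr fun m => ?_
    rw [coeff_normalTrace H, if_pos (Nat.le_add_left _ _), Nat.add_sub_cancel, ← fullPair]
    ring
  · intro n hn
    refine ⟨n - ydeg e, ?_⟩
    by_cases h : ydeg e ≤ n
    · exact Nat.sub_add_cancel h
    · refine absurd ?_ hn
      dsimp only
      rw [coeff_normalTrace H, if_neg h]
      simp

/-- The value of the product of all pairings. -/
def pairValue (q t : ℝ) (rp rm : ℕ → Specialization) (N : ℕ) (c : ℝ≥0∞) : ℝ≥0∞ :=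
  ∏ j ∈ Finset.range N, ∏ i ∈ Finset.range N, value c (pairing q t (rp i) (rm j))

/-- The product over all pairs of specializations of the kernels, with their variable scaled by
`c`. -/
def kernelValue (q t u : ℝ) (rp rm : ℕ → Specialization) (N : ℕ) (c : ℝ≥0∞) : ℝ≥0∞ :=
  ∏ j ∈ Finset.range N, ∏ i ∈ Finset.range N, value c (kernelSum q t u (rp i) (rm j))

theorem coeffNonneg_fullPair (H : Params q t) (hp : ∀ i, MacdonaldPositive q t (rp i))
    (hm : ∀ i, MacdonaldPositive q t (rm i)) (N : ℕ) : CoeffNonneg (fullPair q t rp rm N) :=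
  CoeffNonneg.prod _ fun _ _ => CoeffNonneg.prod _ fun _ _ => coeffNonneg_pairSeries H hp hm _ _

theorem wsum_fullPair (H : Params q t) (hp : ∀ i, MacdonaldPositive q t (rp i))
    (hm : ∀ i, MacdonaldPositive q t (rm i)) (N : ℕ) (c : ℝ≥0∞) :
    wsum ydeg c (fun e => MvPowerSeries.coeff e (fullPair q t rp rm N)) =
      pairValue q t rp rm N c := by
  rw [fullPair, wsum_coeff_prod _ _ _ fun _ _ => CoeffNonneg.prod _ fun _ _ =>
    coeffNonneg_pairSeries H hp hm _ _]
  refine Finset.prod_congr rfl fun j _ => ?_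
  rw [wsum_coeff_prod _ _ _ fun _ _ => coeffNonneg_pairSeries H hp hm _ _]
  exact Finset.prod_congr rfl fun i _ => wsum_pairSeries c i j

theorem pairValue_mul_traceSum (H : Params q t) (hp : ∀ i, MacdonaldPositive q t (rp i))
    (hm : ∀ i, MacdonaldPositive q t (rm i)) (N : ℕ) (U : ℝ≥0∞) (χ : ℕ → ℝ≥0∞) (c : ℝ≥0∞) :
    pairValue q t rp rm N c * traceSum q t rp rm N U χ c =
      ∑' m, ∑' e, χ m * (U ^ m * (c ^ ydeg e * ENNReal.ofReal
        (MvPowerSeries.coeff e (fullPair q t rp rm N * normalTrace q t rp rm N m)))) := by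
  rw [traceSum, ← ENNReal.tsum_mul_left]
  refine tsum_congr fun m => ?_
  rw [ENNReal.tsum_mul_left, ENNReal.tsum_mul_left]
  have h := wsum_coeff_mul ydeg c (coeffNonneg_fullPair H hp hm N)
    (coeffNonneg_normalTrace H hp hm N m)
  rw [wsum_fullPair H hp hm] at h
  rw [← wsum, h]
  ring

theorem traceSum_le (H : Params q t) (hp : ∀ i, MacdonaldPositive q t (rp i))
    (hm : ∀ i, MacdonaldPositive q t (rm i)) (N : ℕ) (U : ℝ≥0∞) {χ : ℕ → ℝ≥0∞} (hχ : Antitone χ)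
    (c : ℝ≥0∞) : traceSum q t rp rm N U χ c ≤
      pairValue q t rp rm N (U * c) * traceSum q t rp rm N U χ (U * c) := by
  rw [traceSum_eq H, pairValue_mul_traceSum H hp hm]
  refine ENNReal.tsum_le_tsum fun m => ENNReal.tsum_le_tsum fun e => ?_
  gcongr
  exact hχ (Nat.le_add_right _ _)

theorem traceSum_one_eq (H : Params q t) (hp : ∀ i, MacdonaldPositive q t (rp i))
    (hm : ∀ i, MacdonaldPositive q t (rm i)) (N : ℕ) (U : ℝ≥0∞) (c : ℝ≥0∞) :
    traceSum q t rp rm N U 1 c =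
      pairValue q t rp rm N (U * c) * traceSum q t rp rm N U 1 (U * c) := by
  rw [traceSum_eq H, pairValue_mul_traceSum H hp hm]
  rfl

theorem coeff_normalTrace_le (H : Params q t) (N n : ℕ) (e : (ℕ ⊕ ℕ) →₀ ℕ) [Decidable (e = 0)]
    (he : ydeg e = 0) : ENNReal.ofReal (MvPowerSeries.coeff e (normalTrace q t rp rm N n)) ≤
      if e = 0 then (Fintype.card n.Partition : ℝ≥0∞) else 0 := by
  by_cases hx : xdeg e = 0
  · obtain rfl := eq_zero_of_xdeg_ydeg hx he
    rw [coeff_zero_normalTrace H, if_pos rfl, ENNReal.ofReal_natCast]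
  · rw [coeff_normalTrace_of_ne _ _ (by omega), ENNReal.ofReal_zero]
    exact zero_le

theorem wsum_normalTrace_le (H : Params q t) (N n : ℕ) {c : ℝ≥0∞} (hc : c ≤ 1) :
    wsum ydeg c (fun e => MvPowerSeries.coeff e (normalTrace q t rp rm N n)) ≤
      Fintype.card n.Partition +
        c * wsum ydeg 1 (fun e => MvPowerSeries.coeff e (normalTrace q t rp rm N n)) := by
  classical
  have h1 : (Fintype.card n.Partition : ℝ≥0∞) =
      ∑' e : (ℕ ⊕ ℕ) →₀ ℕ, if e = 0 then (Fintype.card n.Partition : ℝ≥0∞) else 0 :=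
    (tsum_ite_eq 0 fun _ => (Fintype.card n.Partition : ℝ≥0∞)).symm
  rw [wsum, wsum, ← ENNReal.tsum_mul_left, h1, ← ENNReal.tsum_add]
  refine ENNReal.tsum_le_tsum fun e => ?_
  by_cases he : ydeg e = 0
  · rw [he, pow_zero, one_mul]
    exact (coeff_normalTrace_le H N n e he).trans (le_add_right le_rfl)
  · refine le_trans ?_ (le_add_left le_rfl)
    rw [one_pow, one_mul]
    gcongr
    exact pow_le_of_le_one zero_le hc he

/-- Terms of degree zero contribute at most the number of partitions; every other term carries at
least one factor `c`. -/
theorem traceSum_le_add (H : Params q t) (N : ℕ) (U : ℝ≥0∞) {χ : ℕ → ℝ≥0∞} (hχ : ∀ n, χ n ≤ 1)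
    {c : ℝ≥0∞} (hc : c ≤ 1) : traceSum q t rp rm N U χ c ≤
      ∑' n, (Fintype.card n.Partition : ℝ≥0∞) * U ^ n + c * traceSum q t rp rm N U χ 1 := by
  rw [traceSum, traceSum, ← ENNReal.tsum_mul_left, ← ENNReal.tsum_add]
  refine ENNReal.tsum_le_tsum fun n => ?_
  calc χ n * (U ^ n * wsum ydeg c fun e => MvPowerSeries.coeff e (normalTrace q t rp rm N n))
      ≤ χ n * (U ^ n * (Fintype.card n.Partition + c * wsum ydeg 1 fun e =>
        MvPowerSeries.coeff e (normalTrace q t rp rm N n))) := by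
        gcongr
        exact wsum_normalTrace_le H N n hc
    _ = χ n * (Fintype.card n.Partition * U ^ n) + c * (χ n * (U ^ n * wsum ydeg 1 fun e =>
        MvPowerSeries.coeff e (normalTrace q t rp rm N n))) := by ring
    _ ≤ _ := add_le_add (mul_le_of_le_one_left zero_le (hχ n)) le_rfl

/-- The terms of degree zero alone, namely the traces of the identity. -/
theorem le_traceSum_one (H : Params q t) (N : ℕ) (U c : ℝ≥0∞) :
    ∑' n, (Fintype.card n.Partition : ℝ≥0∞) * U ^ n ≤ traceSum q t rp rm N U 1 c := by
  refine ENNReal.tsum_le_tsum fun n => ?_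
  rw [Pi.one_apply, one_mul, mul_comm]
  gcongr
  refine le_trans ?_ (ENNReal.le_tsum 0)
  dsimp only
  rw [coeff_zero_normalTrace H, ENNReal.ofReal_natCast, map_zero, pow_zero, one_mul]

/-- Each trace has a finite sum. By the recursion its coefficient at `e` is one of a trace of degree
`n - ydeg e`, multiplied by the pair factors; as `U ^ n ≤ U ^ ydeg e`, the factor `U ^ n` pays for
evaluating at `1` instead of `U`. -/
theorem wsum_normalTrace_ne_top (H : Params q t) (hp : ∀ i, MacdonaldPositive q t (rp i))
    (hm : ∀ i, MacdonaldPositive q t (rm i)) (N : ℕ) {U : ℝ≥0∞} (hU0 : U ≠ 0) (hU1 : U ≤ 1)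
    (hfin : pairValue q t rp rm N U ≠ ⊤) (n : ℕ) :
    wsum ydeg 1 (fun e => MvPowerSeries.coeff e (normalTrace q t rp rm N n)) ≠ ⊤ := by
  classical
  have hUt : U ≠ ⊤ := ne_top_of_le_ne_top ENNReal.one_ne_top hU1
  induction n using Nat.strong_induction_on with
  | _ n ih =>
  have hkey : U ^ n * wsum ydeg 1 (fun e => MvPowerSeries.coeff e (normalTrace q t rp rm N n)) ≤
      Fintype.card n.Partition + ∑ m ∈ Finset.range n, wsum ydeg U (fun e => MvPowerSeries.coeff e
        (fullPair q t rp rm N * normalTrace q t rp rm N m)) := by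
    have h1 : (Fintype.card n.Partition : ℝ≥0∞) =
        ∑' e : (ℕ ⊕ ℕ) →₀ ℕ, if e = 0 then (Fintype.card n.Partition : ℝ≥0∞) else 0 :=
      (tsum_ite_eq 0 fun _ => (Fintype.card n.Partition : ℝ≥0∞)).symm
    simp_rw [wsum]
    rw [← ENNReal.tsum_mul_left, h1, ← Summable.tsum_finsetSum fun _ _ => ENNReal.summable,
      ← ENNReal.tsum_add]
    refine ENNReal.tsum_le_tsum fun e => ?_
    rw [one_pow, one_mul]
    by_cases he : ydeg e = 0
    · exact (mul_le_of_le_one_left zero_le (pow_le_one₀ zero_le hU1)).trans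
        (le_add_right (coeff_normalTrace_le H N n e he))
    · by_cases hle : ydeg e ≤ n
      · refine le_trans ?_ (le_add_left (Finset.single_le_sum (fun _ _ => zero_le)
          (Finset.mem_range.2 (show n - ydeg e < n by omega))))
        rw [coeff_normalTrace H, if_pos hle, ← fullPair]
        exact mul_le_mul_left (pow_le_pow_of_le_one zero_le hU1 hle) _
      · rw [coeff_normalTrace H, if_neg hle, ENNReal.ofReal_zero, mul_zero]
        exact zero_le
  have hfin2 : U ^ n * wsum ydeg 1 (fun e =>
      MvPowerSeries.coeff e (normalTrace q t rp rm N n)) ≠ ⊤ := by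
    refine ne_top_of_le_ne_top (ENNReal.add_ne_top.2 ⟨ENNReal.natCast_ne_top _, ?_⟩) hkey
    refine ENNReal.sum_ne_top.2 fun m hmn => ?_
    rw [wsum_coeff_mul ydeg U (coeffNonneg_fullPair H hp hm N)
      (coeffNonneg_normalTrace H hp hm N m), wsum_fullPair H hp hm]
    exact ENNReal.mul_ne_top hfin (ne_top_of_le_ne_top (ih m (Finset.mem_range.1 hmn))
      (wsum_mono ydeg hU1 _))
  intro htop
  exact hfin2 (by rw [htop, ENNReal.mul_top (pow_ne_zero n hU0)])

theorem kernelValue_eq {u : ℝ} (H : Params q t) (hu0 : 0 ≤ u) (hu1 : u < 1)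
    (hp : ∀ i, MacdonaldPositive q t (rp i)) (hm : ∀ i, MacdonaldPositive q t (rm i)) (N : ℕ)
    (c : ℝ≥0∞) : kernelValue q t u rp rm N c =
      pairValue q t rp rm N c * kernelValue q t u rp rm N (ENNReal.ofReal u * c) := by
  simp_rw [kernelValue, pairValue, ← Finset.prod_mul_distrib]
  exact Finset.prod_congr rfl fun j _ => Finset.prod_congr rfl fun i _ =>
    value_kernelSum H hu0 hu1 (hp i) (hm j) c

theorem one_le_kernelValue (u : ℝ) (N : ℕ) (c : ℝ≥0∞) : 1 ≤ kernelValue q t u rp rm N c :=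
  Finset.one_le_prod' fun _ _ => Finset.one_le_prod' fun _ _ =>
    one_le_value c (kernelSum_zero_right u _ _)

theorem tendsto_pow_mul {U x : ℝ≥0∞} (hU : U < 1) (hx : x ≠ ⊤) :
    Filter.Tendsto (fun K : ℕ => U ^ K * x) Filter.atTop (𝓝 0) := by
  have := ENNReal.Tendsto.mul_const (ENNReal.tendsto_pow_atTop_nhds_zero_of_lt_one hU) (Or.inr hx)
  rwa [zero_mul] at this

theorem tendsto_kernelValue {u : ℝ} (N : ℕ) {U c : ℝ≥0∞} (hU : U < 1)
    (hfin : ∀ i < N, ∀ j < N, value c (kernelSum q t u (rp i) (rm j)) ≠ ⊤) :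
    Filter.Tendsto (fun K : ℕ => kernelValue q t u rp rm N (U ^ K * c)) Filter.atTop (𝓝 1) := by
  have h1 : ∀ i ∈ Finset.range N, ∀ j ∈ Finset.range N, Filter.Tendsto (fun K : ℕ =>
      value (U ^ K * c) (kernelSum q t u (rp i) (rm j))) Filter.atTop (𝓝 1) := by
    intro i hi j hj
    have h2 := (tendsto_pow_mul hU (hfin i (Finset.mem_range.1 hi) j (Finset.mem_range.1 hj))).const_add 1
    rw [add_zero] at h2
    exact tendsto_of_tendsto_of_tendsto_of_le_of_le tendsto_const_nhds h2
      (fun K => one_le_value _ (kernelSum_zero_right u _ _))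
      fun K => value_mul_le (kernelSum_zero_right u _ _) (pow_le_one₀ zero_le hU.le) c
  have h3 := ENNReal.tendsto_finsetProd_of_ne_top (Finset.range N) (fun j hj =>
    ENNReal.tendsto_finsetProd_of_ne_top (Finset.range N) (fun i hi => h1 i hi j hj)
      fun _ _ => ENNReal.one_ne_top) (by simp)
  simp only [Finset.prod_const_one] at h3
  exact h3

/-- The sum of all traces of the normally ordered word. -/
theorem traceSum_one {u : ℝ} (H : Params q t) (hu0 : 0 < u) (hu1 : u < 1)
    (hp : ∀ i, MacdonaldPositive q t (rp i)) (hm : ∀ i, MacdonaldPositive q t (rm i)) (N : ℕ)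
    (hfin : ∀ i < N, ∀ j < N,
      value (ENNReal.ofReal u) (kernelSum q t u (rp i) (rm j)) ≠ ⊤) :
    traceSum q t rp rm N (ENNReal.ofReal u) 1 1 = kernelValue q t u rp rm N (ENNReal.ofReal u) *
      ∑' n, (Fintype.card n.Partition : ℝ≥0∞) * ENNReal.ofReal u ^ n := by
  set U := ENNReal.ofReal u with hU
  set D : ℝ≥0∞ := ∑' n, (Fintype.card n.Partition : ℝ≥0∞) * U ^ n with hD
  have hUlt : U < 1 := by rwa [hU, ENNReal.ofReal_lt_one]
  have hU0 : U ≠ 0 := by simpa [hU] using hu0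
  have hFtop : kernelValue q t u rp rm N U ≠ ⊤ :=
    ENNReal.prod_ne_top fun j hj => ENNReal.prod_ne_top fun i hi =>
      hfin i (Finset.mem_range.1 hi) j (Finset.mem_range.1 hj)
  have hPtop : pairValue q t rp rm N U ≠ ⊤ := by
    refine ne_top_of_le_ne_top hFtop ?_
    rw [kernelValue_eq H hu0.le hu1 hp hm]
    exact le_mul_of_one_le_right zero_le (one_le_kernelValue u N _)
  -- iteration of the functional equation of the kernels
  have hF : ∀ K : ℕ, kernelValue q t u rp rm N U =
      (∏ k ∈ Finset.range K, pairValue q t rp rm N (U ^ (k + 1))) *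
        kernelValue q t u rp rm N (U ^ K * U) := by
    intro K
    induction K with
    | zero => simp
    | succ K ih =>
      rw [ih, Finset.prod_range_succ, kernelValue_eq H hu0.le hu1 hp hm N (U ^ K * U), mul_assoc,
        ← pow_succ, ← hU, ← mul_comm (U ^ (K + 1)) U]
  have hT : ∀ K : ℕ, traceSum q t rp rm N U 1 1 =
      (∏ k ∈ Finset.range K, pairValue q t rp rm N (U ^ (k + 1))) *
        traceSum q t rp rm N U 1 (U ^ K) := by
    intro K
    induction K with
    | zero => simp
    | succ K ih =>
      rw [ih, Finset.prod_range_succ, traceSum_one_eq H hp hm N U (U ^ K), mul_assoc, ← pow_succ']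
  have hTle : ∀ {χ : ℕ → ℝ≥0∞}, Antitone χ → ∀ K : ℕ, traceSum q t rp rm N U χ 1 ≤
      (∏ k ∈ Finset.range K, pairValue q t rp rm N (U ^ (k + 1))) *
        traceSum q t rp rm N U χ (U ^ K) := by
    intro χ hχ K
    induction K with
    | zero => simp
    | succ K ih =>
      refine ih.trans ?_
      rw [Finset.prod_range_succ, mul_assoc, pow_succ']
      gcongr
      exact traceSum_le H hp hm N U hχ (U ^ K)
  refine le_antisymm ?_ ?_
  · -- truncation to finitely many degrees makes the sums finite
    rw [traceSum]
    refine ENNReal.tsum_le_of_sum_range_le fun M => ?_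
    set χ : ℕ → ℝ≥0∞ := fun n => if n < M then 1 else 0 with hχ
    have hanti : Antitone χ := by
      intro a b hab
      simp only [hχ]
      split_ifs with h1 h2
      · exact le_rfl
      · omega
      · exact zero_le
      · exact le_rfl
    have hχ1 : ∀ n, χ n ≤ 1 := fun n => by
      simp only [hχ]
      split_ifs
      · exact le_rfl
      · exact zero_le
    have hsum : traceSum q t rp rm N U χ 1 = ∑ n ∈ Finset.range M, (1 : ℕ → ℝ≥0∞) n * (U ^ n *
        wsum ydeg 1 fun e => MvPowerSeries.coeff e (normalTrace q t rp rm N n)) := by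
      rw [traceSum, tsum_eq_sum (s := Finset.range M)]
      · refine Finset.sum_congr rfl fun n hn => ?_
        simp only [hχ, Pi.one_apply, if_pos (Finset.mem_range.1 hn)]
      · intro n hn
        simp only [hχ, if_neg fun h => hn (Finset.mem_range.2 h), zero_mul]
    rw [← hsum]
    have htop : traceSum q t rp rm N U χ 1 ≠ ⊤ := by
      rw [hsum]
      refine ENNReal.sum_ne_top.2 fun n _ => ?_
      rw [Pi.one_apply, one_mul]
      exact ENNReal.mul_ne_top (ENNReal.pow_ne_top ENNReal.ofReal_ne_top)
        (wsum_normalTrace_ne_top H hp hm N hU0 hUlt.le hPtop n)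
    have hbound : ∀ K : ℕ, traceSum q t rp rm N U χ 1 ≤
        kernelValue q t u rp rm N U * (D + U ^ K * traceSum q t rp rm N U χ 1) := by
      intro K
      refine (hTle hanti K).trans ?_
      gcongr
      · rw [hF K]
        exact le_mul_of_one_le_right zero_le (one_le_kernelValue u N _)
      · exact traceSum_le_add H N U hχ1 (pow_le_one₀ zero_le hUlt.le)
    have hlim := ENNReal.Tendsto.const_mul ((tendsto_pow_mul hUlt htop).const_add D)
      (Or.inr hFtop)
    rw [add_zero] at hlim
    exact ge_of_tendsto' hlim hbound
  · have hbound : ∀ K : ℕ, kernelValue q t u rp rm N U * D ≤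
        traceSum q t rp rm N U 1 1 * kernelValue q t u rp rm N (U ^ K * U) := by
      intro K
      rw [hF K, hT K, mul_right_comm]
      gcongr
      exact le_traceSum_one H N U _
    have hlim := ENNReal.Tendsto.const_mul (a := traceSum q t rp rm N U 1 1)
      (tendsto_kernelValue (q := q) (t := t) (u := u) (rp := rp) (rm := rm) N hUlt hfin)
      (Or.inl one_ne_zero)
    rw [mul_one] at hlim
    exact ge_of_tendsto' hlim hbound

end PeriodicMacdonald

namespace PeriodicMacdonald

open scoped ENNReal

/-! ### The partition function -/

theorem hasSum_of_tsum_ofReal {ι : Type*} {f : ι → ℝ} {V : ℝ} (hf : ∀ i, 0 ≤ f i) (hV : 0 ≤ V)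
    (h : ∑' i, ENNReal.ofReal (f i) = ENNReal.ofReal V) : HasSum f V := by
  have hs : Summable f := by
    have := ENNReal.summable_toReal (h ▸ ENNReal.ofReal_ne_top :
      ∑' i, ENNReal.ofReal (f i) ≠ ⊤)
    simpa [ENNReal.toReal_ofReal (hf _)] using this
  have h2 : ∑' i, f i = V := by
    rw [← ENNReal.ofReal_tsum_of_nonneg hf hs] at h
    exact (ENNReal.ofReal_eq_ofReal_iff (tsum_nonneg hf) hV).1 h
  exact h2 ▸ hs.hasSum

variable {q t u : ℝ} {rp rm : ℕ → Specialization}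

theorem tsum_traceSeries_word (H : Params q t) (hu0 : 0 < u) (hu1 : u < 1)
    (hp : ∀ i, MacdonaldPositive q t (rp i)) (hm : ∀ i, MacdonaldPositive q t (rm i)) (N : ℕ)
    (hfin : ∀ i < N, ∀ j < N,
      value (ENNReal.ofReal u) (kernelSum q t u (rp i) (rm j)) ≠ ⊤) :
    ∑' p : ℕ × ((ℕ ⊕ ℕ) →₀ ℕ), ENNReal.ofReal (u ^ p.1 * MvPowerSeries.coeff p.2
      (traceSeries q t p.1 (word (lowerSeries rm) (raiseSeries q t rp) N))) =
      (∏ j ∈ Finset.range N, ∏ i ∈ Finset.range (j + 1), value 1 (pairing q t (rp i) (rm j))) *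
        (kernelValue q t u rp rm N (ENNReal.ofReal u) * ENNReal.ofReal (qPoch u ![u])⁻¹) := by
  rw [← (tsum_partitions hu0 hu1).2, ← traceSum_one H hu0 hu1 hp hm N hfin, traceSum,
    ← ENNReal.tsum_mul_left, ENNReal.tsum_prod']
  refine tsum_congr fun n => ?_
  have hT : CoeffNonneg (∏ j ∈ Finset.range N, ∏ i ∈ Finset.range (j + 1),
      pairSeries q t rp rm i j) :=
    CoeffNonneg.prod _ fun _ _ => CoeffNonneg.prod _ fun _ _ => coeffNonneg_pairSeries H hp hm _ _
  have hval : wsum ydeg 1 (fun e => MvPowerSeries.coeff e (∏ j ∈ Finset.range N,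
      ∏ i ∈ Finset.range (j + 1), pairSeries q t rp rm i j)) =
      ∏ j ∈ Finset.range N, ∏ i ∈ Finset.range (j + 1), value 1 (pairing q t (rp i) (rm j)) := by
    rw [wsum_coeff_prod _ _ _ fun _ _ => CoeffNonneg.prod _ fun _ _ =>
      coeffNonneg_pairSeries H hp hm _ _]
    refine Finset.prod_congr rfl fun j _ => ?_
    rw [wsum_coeff_prod _ _ _ fun _ _ => coeffNonneg_pairSeries H hp hm _ _]
    exact Finset.prod_congr rfl fun i _ => wsum_pairSeries 1 i j
  have hmul := wsum_coeff_mul ydeg 1 hT (coeffNonneg_normalTrace H hp hm N n)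
  rw [hval] at hmul
  rw [Pi.one_apply, one_mul, mul_left_comm, ← hmul, wsum, ← ENNReal.tsum_mul_left]
  refine tsum_congr fun e => ?_
  rw [traceSeries_word, ENNReal.ofReal_mul (pow_nonneg hu0.le n), ENNReal.ofReal_pow hu0.le, one_pow,
    one_mul]

theorem coeffNonneg_traceSeries_word (H : Params q t) (hp : ∀ i, MacdonaldPositive q t (rp i))
    (hm : ∀ i, MacdonaldPositive q t (rm i)) (N n : ℕ) :
    CoeffNonneg (traceSeries q t n (word (lowerSeries rm) (raiseSeries q t rp) N)) := by
  rw [traceSeries_word]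
  exact CoeffNonneg.mul (CoeffNonneg.prod _ fun _ _ => CoeffNonneg.prod _ fun _ _ =>
    coeffNonneg_pairSeries H hp hm _ _) (coeffNonneg_normalTrace H hp hm N n)

/-- The components of the specialized factor of the partition function. -/
def pairKernelSum (q t u : ℝ) (θ η : Specialization) (quotient : Prop) [Decidable quotient]
    (d : ℕ) : ℝ := if quotient then u ^ d * kernelSum q t u θ η d else kernelSum q t u θ η d

section

variable {N : ℕ} {θ η : Specialization}

theorem specComponent_pairKernel (H : Params q t) (hu0 : 0 ≤ u) (hu1 : u < 1) (i j : Fin N)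
    (d : ℕ × ℕ) : specComponent (pairKernel q t u i j) θ η d =
      if d.1 = d.2 then pairKernelSum q t u θ η (j < i) d.1 else 0 := by
  rw [pairKernel]
  by_cases h : j < i
  · simp_rw [pairKernelSum, if_pos h]
    exact specComponent_kernel_quotient H hu0 hu1 d
  · simp_rw [pairKernelSum, if_neg h]
    exact specComponent_kernel H hu0 hu1 d

theorem pairKernelSum_nonneg (H : Params q t) (hu0 : 0 ≤ u) (hu1 : u < 1)
    (hθ : MacdonaldPositive q t θ) (hη : MacdonaldPositive q t η) (Z : Prop) [Decidable Z] (d : ℕ) :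
    0 ≤ pairKernelSum q t u θ η Z d := by
  rw [pairKernelSum]
  split_ifs
  · exact mul_nonneg (pow_nonneg hu0 d) (kernelSum_nonneg H hu0 hu1 hθ hη d)
  · exact kernelSum_nonneg H hu0 hu1 hθ hη d

theorem value_pairKernelSum (H : Params q t) (hu0 : 0 ≤ u) (hu1 : u < 1)
    (hθ : MacdonaldPositive q t θ) (hη : MacdonaldPositive q t η) (Z : Prop) [Decidable Z] :
    value 1 (pairKernelSum q t u θ η Z) = (if Z then 1 else value 1 (pairing q t θ η)) *
      value (ENNReal.ofReal u) (kernelSum q t u θ η) := by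
  by_cases h : Z
  · have h1 : pairKernelSum q t u θ η Z = fun d => u ^ d * kernelSum q t u θ η d :=
      funext fun d => if_pos h
    rw [h1, value_pow_mul hu0, mul_one, if_pos h, one_mul]
  · have h1 : pairKernelSum q t u θ η Z = kernelSum q t u θ η := funext fun d => if_neg h
    rw [h1, value_kernelSum H hu0 hu1 hθ hη, mul_one, if_neg h]

end

theorem specValue_pairKernel_nonneg {N : ℕ} (H : Params q t) (hu0 : 0 ≤ u) (hu1 : u < 1)
    {ρp ρm : Fin N → Specialization} (hp : ∀ i, MacdonaldPositive q t (ρp i))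
    (hm : ∀ j, MacdonaldPositive q t (ρm j)) (i j : Fin N) :
    0 ≤ specValue (pairKernel q t u i j) (ρp i) (ρm j) :=
  specValue_nonneg (fun d => pairKernelSum_nonneg H hu0 hu1 (hp i) (hm j) (j < i) d)
    (specComponent_pairKernel H hu0 hu1 i j)

/-- The partition function is the sum over the sizes. -/
theorem hasSum_sizeSum_partitionFunction {N : ℕ} [NeZero N] (H : Params q t) (hu0 : 0 < u)
    (hu1 : u < 1) {ρp ρm : Fin N → Specialization} (hρp : ∀ i, MacdonaldPositive q t (ρp i))
    (hρm : ∀ j, MacdonaldPositive q t (ρm j))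
    (hconv : ∀ i j : Fin N, SpecConverges (pairKernel q t u i j) (ρp i) (ρm j)) :
    HasSum (sizeSum q t u ρp ρm) ((qPoch u ![u])⁻¹ *
      ∏ i : Fin N, ∏ j : Fin N, specValue (pairKernel q t u i j) (ρp i) (ρm j)) := by
  classical
  obtain ⟨M, rfl⟩ : ∃ M, N = M + 1 := ⟨N - 1, (Nat.succ_pred_eq_of_ne_zero (NeZero.ne N)).symm⟩
  have hext : ∀ ρ : Fin (M + 1) → Specialization, (∀ i, MacdonaldPositive q t (ρ i)) →
      ∃ r : ℕ → Specialization, (ρ = fun i : Fin (M + 1) => r i) ∧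
        ∀ i, MacdonaldPositive q t (r i) := fun ρ hρ =>
    ⟨fun k => ρ (Fin.ofNat (M + 1) k), by ext1 k; simp, fun i => hρ _⟩
  obtain ⟨rp, rfl, hp⟩ := hext ρp hρp
  obtain ⟨rm, rfl, hm⟩ := hext ρm hρm
  have hval : ∀ i j : Fin (M + 1), (if (j : ℕ) < i then 1 else value 1 (pairing q t (rp i) (rm j))) *
      value (ENNReal.ofReal u) (kernelSum q t u (rp i) (rm j)) =
        ENNReal.ofReal (specValue (pairKernel q t u i j) (rp i) (rm j)) := by
    intro i j
    rw [ofReal_specValue (fun d => pairKernelSum_nonneg H hu0.le hu1 (hp i) (hm j) (j < i) d)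
      (specComponent_pairKernel H hu0.le hu1 i j) (hconv i j),
      value_pairKernelSum H hu0.le hu1 (hp i) (hm j)]
    rfl
  have hfin : ∀ i < M + 1, ∀ j < M + 1,
      value (ENNReal.ofReal u) (kernelSum q t u (rp i) (rm j)) ≠ ⊤ := by
    intro i hi j hj
    have h1 := ne_of_eq_of_ne (hval ⟨i, hi⟩ ⟨j, hj⟩) ENNReal.ofReal_ne_top
    refine ne_top_of_le_ne_top h1 (le_mul_of_one_le_left zero_le ?_)
    split_ifs
    · exact le_rfl
    · exact one_le_value 1 (kernelSum_zero_right 0 _ _)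
  have hnn : 0 ≤ ∏ i : Fin (M + 1), ∏ j : Fin (M + 1),
      specValue (pairKernel q t u i j) (rp i) (rm j) :=
    Finset.prod_nonneg fun i _ => Finset.prod_nonneg fun j _ =>
      specValue_pairKernel_nonneg (ρp := fun i : Fin (M + 1) => rp i)
        (ρm := fun i : Fin (M + 1) => rm i) H hu0.le hu1 (fun i => hp i) (fun j => hm j) i j
  have hq := inv_nonneg.2 (tsum_partitions hu0 hu1).1.le
  refine hasSum_sizeSum H u M _ (hasSum_of_tsum_ofReal (fun p => mul_nonneg (pow_nonneg hu0.le _)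
    (coeffNonneg_traceSeries_word H hp hm _ _ _)) (mul_nonneg hq hnn) ?_)
  rw [tsum_traceSeries_word H hu0 hu1 hp hm (M + 1) hfin, ENNReal.ofReal_mul hq, ← mul_assoc,
    mul_comm]
  congr 1
  rw [ENNReal.ofReal_prod_of_nonneg fun i _ => Finset.prod_nonneg fun j _ =>
    specValue_pairKernel_nonneg (ρp := fun i : Fin (M + 1) => rp i)
        (ρm := fun i : Fin (M + 1) => rm i) H hu0.le hu1 (fun i => hp i) (fun j => hm j) i j]
  simp_rw [ENNReal.ofReal_prod_of_nonneg fun j _ => specValue_pairKernel_nonneg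
    (ρp := fun i : Fin (M + 1) => rp i) (ρm := fun i : Fin (M + 1) => rm i) H hu0.le hu1
    (fun i => hp i) (fun j => hm j) _ j, ← hval]
  rw [Finset.prod_comm, kernelValue, ← Finset.prod_mul_distrib, Finset.prod_range]
  refine Finset.prod_congr rfl fun j _ => ?_
  rw [Finset.prod_mul_distrib, Finset.prod_range fun i =>
    value (ENNReal.ofReal u) (kernelSum q t u (rp i) (rm j))]
  congr 1
  have hrange : Finset.range (j + 1) = (Finset.range (M + 1)).filter fun i => ¬ (j : ℕ) < i := by
    ext i
    have := j.2
    simp only [Finset.mem_range, Finset.mem_filter]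
    omega
  rw [hrange, Finset.prod_filter, Finset.prod_range]
  exact Finset.prod_congr rfl fun i _ => ite_not ..

/-- Pairs of sequences of partitions, sorted by the sizes of the partitions. -/
def sizeEquiv (N : ℕ) : (Σ sr : (Fin N → ℕ) × (Fin N → ℕ),
    ((k : Fin N) → (sr.1 k).Partition) × ((k : Fin N) → (sr.2 k).Partition)) ≃
      (Fin N → Part) × (Fin N → Part) where
  toFun x := (fun k => ⟨x.1.1 k, x.2.1 k⟩, fun k => ⟨x.1.2 k, x.2.2 k⟩)
  invFun p := ⟨(fun k => (p.1 k).1, fun k => (p.2 k).1), (fun k => (p.1 k).2, fun k => (p.2 k).2)⟩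
  left_inv _ := rfl
  right_inv _ := rfl

/-- For non-negative weights, summation by sizes first can be undone. -/
theorem hasSum_weight {N : ℕ} [NeZero N] {ρp ρm : Fin N → Specialization} {V : ℝ}
    (h : HasSum (sizeSum q t u ρp ρm) V)
    (hnn : ∀ lam mu : Fin N → Part, 0 ≤ weight q t u ρp ρm lam mu) :
    HasSum (fun p : (Fin N → Part) × (Fin N → Part) => weight q t u ρp ρm p.1 p.2) V := by
  have hs : ∀ sr, 0 ≤ sizeSum q t u ρp ρm sr := fun sr =>
    Finset.sum_nonneg fun _ _ => Finset.sum_nonneg fun _ _ => hnn _ _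
  refine hasSum_of_tsum_ofReal (fun p => hnn _ _) (h.nonneg hs) ?_
  rw [← (sizeEquiv N).tsum_eq, ENNReal.tsum_sigma', ← h.tsum_eq,
    ENNReal.ofReal_tsum_of_nonneg hs h.summable]
  refine tsum_congr fun sr => ?_
  rw [tsum_fintype, Fintype.sum_prod_type, sizeSum, ENNReal.ofReal_sum_of_nonneg fun _ _ =>
    Finset.sum_nonneg fun _ _ => hnn _ _]
  refine Finset.sum_congr rfl fun lam _ => ?_
  rw [ENNReal.ofReal_sum_of_nonneg fun _ _ => hnn _ _]
  rfl

section

variable {θ η : Specialization}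

theorem specConverges_kernel_zero (H : Params q t) (hu0 : 0 ≤ u) (hu1 : u < 1)
    (hθ : MacdonaldPositive q t θ) (hη : MacdonaldPositive q t η)
    (h : SpecConverges (kernel q t u) θ η) : SpecConverges (kernel q t 0) θ η := by
  rw [specConverges_iff (kernelSum_nonneg H le_rfl one_pos hθ hη)
    (specComponent_kernel H le_rfl one_pos)]
  rw [specConverges_iff (kernelSum_nonneg H hu0 hu1 hθ hη) (specComponent_kernel H hu0 hu1),
    value_kernelSum H hu0 hu1 hθ hη] at h
  exact ne_top_of_le_ne_top h
    (le_mul_of_one_le_right zero_le (one_le_value _ (kernelSum_zero_right u θ η)))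

theorem one_le_specValue_kernel (H : Params q t) (hu0 : 0 ≤ u) (hu1 : u < 1)
    (hθ : MacdonaldPositive q t θ) (hη : MacdonaldPositive q t η)
    (h : SpecConverges (kernel q t u) θ η) : 1 ≤ specValue (kernel q t u) θ η := by
  rw [← ENNReal.one_le_ofReal, ofReal_specValue (kernelSum_nonneg H hu0 hu1 hθ hη)
    (specComponent_kernel H hu0 hu1) h]
  exact one_le_value _ (kernelSum_zero_right u θ η)

theorem specValue_pairKernel_mul {N : ℕ} (H : Params q t) (hu0 : 0 ≤ u) (hu1 : u < 1)
    (hθ : MacdonaldPositive q t θ) (hη : MacdonaldPositive q t η)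
    (h : SpecConverges (kernel q t u) θ η) (i j : Fin N)
    (hij : SpecConverges (pairKernel q t u i j) θ η) :
    specValue (pairKernel q t u i j) θ η * (if j < i then specValue (kernel q t 0) θ η else 1) =
      specValue (kernel q t u) θ η := by
  by_cases hji : j < i
  · have h0 := specConverges_kernel_zero H hu0 hu1 hθ hη h
    have hn0 := specValue_nonneg (kernelSum_nonneg H le_rfl one_pos hθ hη)
      (specComponent_kernel H le_rfl one_pos)
    have hnu := specValue_nonneg (kernelSum_nonneg H hu0 hu1 hθ hη)
      (specComponent_kernel H hu0 hu1)
    have hnp := specValue_nonneg (pairKernelSum_nonneg H hu0 hu1 hθ hη (j < i))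
      (specComponent_pairKernel H hu0 hu1 i j)
    rw [if_pos hji, ← ENNReal.ofReal_eq_ofReal_iff (mul_nonneg hnp hn0) hnu, ENNReal.ofReal_mul hnp,
      ofReal_specValue (kernelSum_nonneg H hu0 hu1 hθ hη) (specComponent_kernel H hu0 hu1) h,
      ofReal_specValue (kernelSum_nonneg H le_rfl one_pos hθ hη)
        (specComponent_kernel H le_rfl one_pos) h0,
      ofReal_specValue (pairKernelSum_nonneg H hu0 hu1 hθ hη (j < i))
        (specComponent_pairKernel H hu0 hu1 i j) hij,
      value_pairKernelSum H hu0 hu1 hθ hη, if_pos hji, one_mul, value_kernelSum H hu0 hu1 hθ hη 1,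
      mul_one, mul_comm]
    rfl
  · rw [if_neg hji, mul_one, pairKernel, if_neg hji]

end

end PeriodicMacdonald

end

open PeriodicMacdonald in
theorem mainTheorem1 (N : ℕ) [NeZero N] (q t u : ℝ)
    (hq0 : 0 < q) (hq1 : q < 1) (ht0 : 0 < t) (ht1 : t < 1) (hu0 : 0 < u) (hu1 : u < 1)
    (ρp ρm : Fin N → Specialization)
    (hρp : ∀ i, MacdonaldPositive q t (ρp i)) (hρm : ∀ j, MacdonaldPositive q t (ρm j))
    (hconv : ∀ i j : Fin N, SpecConverges (pairKernel q t u i j) (ρp i) (ρm j)) :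
    HasSum
        (fun sr : (Fin N → ℕ) × (Fin N → ℕ) =>
          ∑ lam : (k : Fin N) → (sr.1 k).Partition, ∑ mu : (k : Fin N) → (sr.2 k).Partition,
            weight q t u ρp ρm (fun k => ⟨sr.1 k, lam k⟩) (fun k => ⟨sr.2 k, mu k⟩))
        ((qPoch u ![u])⁻¹ *
          ∏ i : Fin N, ∏ j : Fin N, specValue (pairKernel q t u i j) (ρp i) (ρm j)) ∧
    ((∀ lam mu : Fin N → Part, 0 ≤ weight q t u ρp ρm lam mu) →
      HasSum
        (fun p : (Fin N → Part) × (Fin N → Part) => weight q t u ρp ρm p.1 p.2)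
        ((qPoch u ![u])⁻¹ *
          ∏ i : Fin N, ∏ j : Fin N, specValue (pairKernel q t u i j) (ρp i) (ρm j))) ∧
    ((∀ i j : Fin N, SpecConverges (kernel q t u) (ρp i) (ρm j)) →
      (∀ i j : Fin N, j < i → SpecConverges (kernel q t 0) (ρp i) (ρm j)) ∧
      ∏ i : Fin N, ∏ j : Fin N, specValue (pairKernel q t u i j) (ρp i) (ρm j) =
        (∏ i : Fin N, ∏ j : Fin N, specValue (kernel q t u) (ρp i) (ρm j)) /
          (∏ i : Fin N, ∏ j ∈ Finset.Iio i, specValue (kernel q t 0) (ρp i) (ρm j))) := by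
  have H : Params q t := ⟨hq0, hq1, ht0, ht1⟩
  have h1 := hasSum_sizeSum_partitionFunction H hu0 hu1 hρp hρm hconv
  refine ⟨h1, hasSum_weight h1, fun hK => ?_⟩
  have h0 : ∀ i j, SpecConverges (kernel q t 0) (ρp i) (ρm j) := fun i j =>
    specConverges_kernel_zero H hu0.le hu1 (hρp i) (hρm j) (hK i j)
  refine ⟨fun i j _ => h0 i j, ?_⟩
  rw [eq_div_iff, ← Finset.prod_mul_distrib]
  · refine Finset.prod_congr rfl fun i _ => ?_
    have hIio : Finset.Iio i = Finset.univ.filter fun j => j < i := by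
      ext j
      simp
    rw [hIio, Finset.prod_filter, ← Finset.prod_mul_distrib]
    exact Finset.prod_congr rfl fun j _ =>
      specValue_pairKernel_mul H hu0.le hu1 (hρp i) (hρm j) (hK i j) i j (hconv i j)
  · exact Finset.prod_ne_zero_iff.2 fun i _ => Finset.prod_ne_zero_iff.2 fun j _ =>
      (one_pos.trans_le (one_le_specValue_kernel H le_rfl one_pos (hρp i) (hρm j) (h0 i j))).ne'
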